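/- Let $d\ge 2$, $q,r\in[2,\infty)$, $\kappa\in[-1,0]$, and let $\beta_+,\beta_-\in\mathbb R$ satisfy $$\beta_++\beta_-=\frac dr+\frac1q-\frac d2 .$$ For $\kappa\in(-1,0]$ let $\mathrm d\mu_\kappa(v)=\Gamma(1+\kappa)^{-1}(1-|v|^2)^\kappa\,\mathbf 1_{|v|\le 1}\,\mathrm dv$ on $\mathbb R^d$, and let $\mu_{-1}=\frac12\sigma$, where $\sigma$ is the surface measure of the unit sphere $\mathbb S^{d-1}$ (so $\mu_{-1}$ is the weak limit of $\mu_\kappa$ as $\kappa\to-1$). For $f\in L^2(\mathbb R^d\times\mathbb R^d,\mathrm dx\,\mathrm d\mu_\kappa(v))$ define the velocity average $$\rho_\kappa f(x,t)=\int_{\mathbb R^d} f(x-tv,v)\,\mathrm d\mu_\kappa(v),\qquad (x,t)\in\mathbb R^d\times\mathbb R .$$ Let $D_+^{\beta_+}$ and $D_-^{\beta_-}$ be the space-time Fourier multiplier operators with multipliers $(|\xi|+|\tau|)^{\beta_+}$ and $||\xi|-|\tau||^{\beta_-}$. Fix $\phi\in C_c^\infty(\mathbb R)$, not identically zero, supported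 in $[\frac12,2]$, and for $\alpha\in\mathbb R$ let $\mathcal C^\alpha$ be the cone multiplier operator $$\widehat{\mathcal C^\alpha g}(\xi,\tau)=\Big(1-\frac{\tau^2}{|\xi|^2}\Big)_+^\alpha\phi(|\xi|)\,\widehat g(\xi,\tau),$$ where $x_+^\alpha=x^\alpha$ for $x>0$ and $x_+^\alpha=0$ for $x\le0$. Then the following are equivalent. (i) There is a constant $C<\infty$ such that, for every $f\in L^2(\mathrm dx\,\mathrm d\mu_\kappa)$, $D_+^{\beta_+}D_-^{\beta_-}\rho_\kappa f$ is well defined and $$\|D_+^{\beta_+}D_-^{\beta_-}\rho_\kappa f\|_{L^q_tL^r_x}\le C\,\|f\|_{L^2(\mathrm dx\,\mathrm d\mu_\kappa)} .$$ (ii) For $\alpha=\beta_-+\frac\kappa2+\frac{d-1}4$ the operator $\mathcal C^\alpha$ is bounded from $L^2(\mathbb R^d\times\mathbb R)$ to $L^q_tL^r_x$: there is a constant $C<\infty$ such that, for every $g\in L^2(\mathbb R^d\times\mathbb R)$, $\mathcal C^\alpha g$ is well defined and $\|\mathcal C^\alpha g\|_{L^q_tL^r_x}\le C\|g\|_{L^2}$.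 Here $\|u\|_{L^q_tL^r_x}=\big(\int_{\mathbb R}(\int_{\mathbb R^d}|u(x,t)|^r\,\mathrm dx)^{q/r}\,\mathrm dt\big)^{1/q}$, the Fourier transform is $\widehat g(\xi,\tau)=\int g(x,t)e^{-i(x\cdot\xi+t\tau)}\,\mathrm dx\,\mathrm dt$, extended to tempered distributions, and $\mathcal F^{-1}(m\widehat F)$ is well defined if $\widehat F$ and $m\widehat F$ are functions, integrable against some inverse power of $1+|(\xi,\tau)|$, and the inverse Fourier transform of $m\widehat F$ is a function, integrable against some inverse power of $1+|(x,t)|$. -/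

import Mathlib

open MeasureTheory

open scoped ENNReal NNReal

noncomputable section

namespace KineticTransport

/-- Physical space `ℝ^d` with its Euclidean norm. The space-time `ℝ^d × ℝ` is `Space d × ℝ`. -/
abbrev Space (d : ℕ) : Type := EuclideanSpace ℝ (Fin d)

/-! ### Tempered functions, Fourier transform, Fourier multipliers on space-time -/

/-- A measurable function on space-time that is integrable against some inverse power of
`1 + |z|`, hence locally integrable and a tempered distribution. -/
def IsTempered {d : ℕ} (F : Space d × ℝ → ℂ) : Prop :=
  ∃ N : ℕ, Integrable (fun z : Space d × ℝ => (((1 + ‖z‖) ^ N)⁻¹ : ℝ) • F z)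

/-- The space-time Fourier transform
`(ξ, τ) ↦ ∫ ψ(x, t) e^{-i (x · ξ + t τ)} dx dt` of an integrable function `ψ`. -/
def fourierInt {d : ℕ} (ψ : Space d × ℝ → ℂ) (ζ : Space d × ℝ) : ℂ :=
  ∫ z : Space d × ℝ,
    ψ z * Complex.exp (-(Complex.I * ((inner ℝ z.1 ζ.1 + z.2 * ζ.2 : ℝ) : ℂ)))

/-- The tempered function `G` is the Fourier transform of the tempered function `F`,
in the sense of tempered distributions. -/
def IsFourierTransform {d : ℕ} (F G : Space d × ℝ → ℂ) : Prop :=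
  IsTempered F ∧ IsTempered G ∧
    ∀ ψ : SchwartzMap (Space d × ℝ) ℂ, ∫ z, F z * fourierInt ψ z = ∫ ζ, G ζ * ψ ζ

/-- `u = 𝓕⁻¹ (m 𝓕 F)`, where `𝓕 F` and `m 𝓕 F` are tempered functions. -/
def IsMultiplierImage {d : ℕ} (m : Space d × ℝ → ℂ) (F u : Space d × ℝ → ℂ) : Prop :=
  ∃ G : Space d × ℝ → ℂ,
    IsFourierTransform F G ∧ IsFourierTransform u (fun ζ => m ζ * G ζ)

/-- The mixed norm `‖u‖_{L^q_t L^r_x}`, with values in `[0, ∞]`. -/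
def mixedNorm {d : ℕ} (q r : ℝ) (u : Space d × ℝ → ℂ) : ℝ≥0∞ :=
  eLpNorm (fun t : ℝ => eLpNorm (fun x : Space d => u (x, t)) (ENNReal.ofReal r) volume)
    (ENNReal.ofReal q) volume

/-- The Fourier multiplier operator `g ↦ 𝓕⁻¹ (m 𝓕 g)` is defined on all of `L²(ℝ^d × ℝ)` and
bounded from `L²` to `L^q_t L^r_x`. -/
def IsBoundedMultiplier {d : ℕ} (q r : ℝ) (m : Space d × ℝ → ℂ) : Prop :=
  ∃ C : ℝ≥0, ∀ g : Space d × ℝ → ℂ, MemLp g 2 volume →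
    ∃ u : Space d × ℝ → ℂ, IsMultiplierImage m g u ∧
      mixedNorm q r u ≤ C * eLpNorm g 2 volume

/-! ### Velocity averages -/

/-- The surface measure of the unit sphere, as a measure on `ℝ^d`. -/
def sphereMeasure (d : ℕ) : Measure (Space d) :=
  ((volume : Measure (Space d)).toSphere).map Subtype.val

open Classical in
/-- The velocity measure: for `κ > -1` it has density `Γ(1+κ)⁻¹ (1 - |v|²)^κ` on the unit ball;
for `κ = -1` it is (the weak limit of these as `κ → -1`, namely) half of the surface measure of
the unit sphere. -/
def velocityMeasure (d : ℕ) (κ : ℝ) : Measure (Space d) :=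
  if κ = -1 then (2⁻¹ : ℝ≥0∞) • sphereMeasure d
  else volume.withDensity (fun v : Space d =>
    if ‖v‖ ≤ 1 then ENNReal.ofReal ((Real.Gamma (1 + κ))⁻¹ * (1 - ‖v‖ ^ 2) ^ κ) else 0)

/-- The velocity average `ρ_κ f (x, t) = ∫ f(x - t v, v) dμ_κ(v)`. -/
def velocityAverage (d : ℕ) (κ : ℝ) (f : Space d × Space d → ℂ) (z : Space d × ℝ) : ℂ :=
  ∫ v : Space d, f (z.1 - z.2 • v, v) ∂(velocityMeasure d κ)

/-- The multiplier `(|ξ| + |τ|)^{β₊} ||ξ| - |τ||^{β₋}` of `D₊^{β₊} D₋^{β₋}`. -/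
def hyperbolicMultiplier (d : ℕ) (βp βm : ℝ) (ζ : Space d × ℝ) : ℂ :=
  (((‖ζ.1‖ + |ζ.2|) ^ βp * (abs (‖ζ.1‖ - |ζ.2|)) ^ βm : ℝ) : ℂ)

/-- The estimate `‖D₊^{β₊} D₋^{β₋} ρ_κ f‖_{L^q_t L^r_x} ≲ ‖f‖_{L²}` for all
`f ∈ L²(ℝ^d × ℝ^d, dx dμ_κ(v))`, including that the left-hand side is well defined. -/
def SmoothingEstimate (d : ℕ) (q r κ βp βm : ℝ) : Prop :=
  ∃ C : ℝ≥0, ∀ f : Space d × Space d → ℂ,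
    MemLp f 2 ((volume : Measure (Space d)).prod (velocityMeasure d κ)) →
    ∃ u : Space d × ℝ → ℂ,
      IsMultiplierImage (hyperbolicMultiplier d βp βm) (velocityAverage d κ f) u ∧
      mixedNorm q r u ≤
        C * eLpNorm f 2 ((volume : Measure (Space d)).prod (velocityMeasure d κ))

/-! ### The cone multiplier -/

open Classical in
/-- `x_+^α`, which vanishes for `x ≤ 0` (also when `α ≤ 0`). -/
def posPow (x α : ℝ) : ℝ := if 0 < x then x ^ α else 0

/-- The multiplier `(1 - τ² / |ξ|²)_+^α φ(|ξ|)` of the cone multiplier operator of order `α`. -/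
def coneMultiplier (d : ℕ) (φ : ℝ → ℂ) (α : ℝ) (ζ : Space d × ℝ) : ℂ :=
  (posPow (1 - ζ.2 ^ 2 / ‖ζ.1‖ ^ 2) α : ℂ) * φ ‖ζ.1‖

end KineticTransport

end

/-! Both (i) and (ii) are statements about one kind of operator: multiply an arbitrary `G` in `L²`
by a function `m` on the Fourier side, invert, and measure the result in `L^q_t L^r_x`
(`IsL2Bounded`). For (ii) this is Plancherel's theorem (`isBoundedMultiplier_iff`). For (i) it rests
on an exact description of the range of the velocity average.

The adjoint of the average integrates a test function along the ray `t ↦ (y + t v, t)`. Applied to a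
Fourier transform, the ray integral only sees the hyperplane `τ = -v · ξ`, so by Plancherel its
squared `L²` norm is a constant times the integral of `|ψ(ξ, -v · ξ)|²` in `ξ` and `v`. The law of
`v · ω` under the velocity measure has a density proportional to `(1 - s²)_+^(κ + (d-1)/2)`, also at
`κ = -1`; hence that integral is a multiple of the `L²` norm of `ψ` with weight `|ξ|⁻¹ (1 -
τ²/|ξ|²)_+^(κ + (d-1)/2)`. Duality then shows that the Fourier transforms of velocity averages of
`L²` data are exactly the square root of the weight times `L²` functions, with comparable norms
(`exists_factorisation`).

So (i) concerns the product of the hyperbolic multiplier and the square root of the weight. It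
equals `(1 - τ²/|ξ|²)_+^α` times powers of `|ξ|` and `|ξ| + |τ|`
(`hyperbolicMultiplier_mul_sqrtWeight`), which are comparable to `1` in the solid cone when `|ξ|` is
comparable to `1`. A bounded factor can always be absorbed into `G`. Thus (i) implies (ii), and (ii)
implies (i) for frequencies in one annulus `a ≤ |ξ| < a λ` on which `φ` stays away from `0`.

To pass from one annulus to all of them, note that the scaling relation makes the product
homogeneous of the critical degree, so every annulus `a λ^k ≤ |ξ| < a λ^(k+1)` carries the same
bound. The pieces of `G` are orthogonal, and the outputs are summed with `‖∑ u_k‖² ≲ ∑ ‖u_k‖²` in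
`L^q_t L^r_x`, valid for `q, r ≥ 2` (`mixedNorm_sum_sq_le`, `isL2Bounded_of_annulus`).

At fixed time that inequality is the embedding of `B⁰_{p,2}` in `L^p` (`lpNorm_sum_sq_le`). Its
proof adds the `u_j` in order of increasing frequency and expands `|S + u_j|^p` to second order. The
linear term pairs `|S|^(p-2) S`, which varies slowly, with `u_j`, which is reproduced by a mean-zero
kernel at scale `λ^(-j)`; this gains `λ^(k-j)` against each earlier `u_k`, and the resulting double
sum is geometric. -/

noncomputable section

namespace KineticTransport

/-! ### The vector field `a ↦ |a|^s a` -/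

/-- The vector field `|a|^s a`. -/
def powField (s : ℝ) (a : ℂ) : ℂ := ((‖a‖ ^ s : ℝ) : ℂ) * a

/-- For `s ≤ 1` one has `x ≤ x ^ s`; for `s ≥ 1` this is Bernoulli's inequality. -/
lemma one_sub_rpow_le {x s : ℝ} (hx : 0 ≤ x) (hx1 : x ≤ 1) (hs : 0 ≤ s) :
    1 - x ^ s ≤ (s + 1) * (1 - x) := by
  rcases le_total s 1 with h | h
  · have : x ≤ x ^ s := by
      simpa using Real.rpow_le_rpow_of_exponent_ge' hx hx1 hs h
    nlinarith
  · have := one_add_mul_self_le_rpow_one_add (s := x - 1) (by linarith) h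
    rw [show 1 + (x - 1) = x by ring] at this
    nlinarith

/-- Splitting the difference as `|b|^s (a - b) + (|a|^s - |b|^s) a` leaves a scalar difference,
which `one_sub_rpow_le` controls at the ratio `|a| / |b|`. This covers all `s ≥ 0` at once, without
differentiating at the origin. -/
lemma norm_powField_sub_le_of_le {s : ℝ} (hs : 0 ≤ s) {a b : ℂ} (hab : ‖a‖ ≤ ‖b‖) :
    ‖powField s a - powField s b‖ ≤ (s + 2) * ‖a - b‖ * ‖b‖ ^ s := by
  rcases eq_or_lt_of_le (norm_nonneg b) with hb | hb
  · have hb0 : b = 0 := by simpa using hb.symm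
    have ha0 : a = 0 := by simpa [hb0] using hab
    simp [powField, ha0, hb0]
  have key : ‖b‖ ^ s - ‖a‖ ^ s ≤ (s + 1) * (1 - ‖a‖ / ‖b‖) * ‖b‖ ^ s := by
    have h := one_sub_rpow_le (x := ‖a‖ / ‖b‖) (by positivity) ((div_le_one hb).2 hab) hs
    rw [Real.div_rpow (norm_nonneg _) (norm_nonneg _)] at h
    have hbs : 0 < ‖b‖ ^ s := Real.rpow_pos_of_pos hb s
    have := mul_le_mul_of_nonneg_right h hbs.le
    rwa [sub_mul, div_mul_cancel₀ _ hbs.ne', one_mul] at this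
  have hmono : ‖a‖ ^ s ≤ ‖b‖ ^ s := Real.rpow_le_rpow (norm_nonneg _) hab hs
  have hdecomp : powField s a - powField s b
      = ((‖b‖ ^ s : ℝ) : ℂ) * (a - b) + ((‖a‖ ^ s - ‖b‖ ^ s : ℝ) : ℂ) * a := by
    simp only [powField]; push_cast; ring
  rw [hdecomp]
  refine (norm_add_le _ _).trans ?_
  rw [norm_mul, norm_mul, Complex.norm_real, Complex.norm_real, Real.norm_eq_abs, Real.norm_eq_abs,
    abs_of_nonneg (by positivity : (0 : ℝ) ≤ ‖b‖ ^ s), abs_of_nonpos (by linarith)]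
  have h1 : (1 - ‖a‖ / ‖b‖) * ‖a‖ ≤ ‖a - b‖ := by
    have h3 : ‖b‖ - ‖a‖ ≤ ‖a - b‖ := by
      rw [norm_sub_rev]; exact norm_sub_norm_le b a
    have h4 : (1 - ‖a‖ / ‖b‖) * ‖a‖ = (‖b‖ - ‖a‖) * (‖a‖ / ‖b‖) := by field_simp
    rw [h4]
    have h5 : ‖a‖ / ‖b‖ ≤ 1 := (div_le_one hb).2 hab
    nlinarith
  have h2 : -(‖a‖ ^ s - ‖b‖ ^ s) * ‖a‖ ≤ (s + 1) * ‖a - b‖ * ‖b‖ ^ s := by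
    calc -(‖a‖ ^ s - ‖b‖ ^ s) * ‖a‖ ≤ ((s + 1) * (1 - ‖a‖ / ‖b‖) * ‖b‖ ^ s) * ‖a‖ := by
          gcongr; linarith
      _ = (s + 1) * ((1 - ‖a‖ / ‖b‖) * ‖a‖) * ‖b‖ ^ s := by ring
      _ ≤ _ := by gcongr
  nlinarith

lemma norm_powField_sub_le {s : ℝ} (hs : 0 ≤ s) (a b : ℂ) :
    ‖powField s a - powField s b‖ ≤ (s + 2) * ‖a - b‖ * (‖a‖ ^ s + ‖b‖ ^ s) := by
  have ha : 0 ≤ ‖a‖ ^ s := by positivity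
  have hb : 0 ≤ ‖b‖ ^ s := by positivity
  rcases le_total ‖a‖ ‖b‖ with h | h
  · refine (norm_powField_sub_le_of_le hs h).trans ?_
    gcongr; linarith
  · rw [norm_sub_rev, norm_sub_rev a]
    refine (norm_powField_sub_le_of_le hs h).trans ?_
    gcongr; linarith

lemma norm_powField (s : ℝ) (a : ℂ) : ‖powField s a‖ = ‖a‖ ^ s * ‖a‖ := by
  simp [powField, abs_of_nonneg (Real.rpow_nonneg (norm_nonneg a) s)]

lemma rpow_sub_two_mul_sq {x p : ℝ} (hx : 0 ≤ x) (hp : 2 ≤ p) : x ^ (p - 2) * x * x = x ^ p := by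
  rcases eq_or_lt_of_le hx with rfl | hx
  · simp [Real.zero_rpow (by linarith : p ≠ 0)]
  · rw [mul_assoc, ← sq, ← Real.rpow_natCast x 2, ← Real.rpow_add hx]; norm_num

/-- The gradient inequality for the convex function `|a|^p`. -/
lemma norm_rpow_add_mul_re_le {p : ℝ} (hp : 2 ≤ p) (a c : ℂ) :
    ‖c‖ ^ p + p * (starRingEnd ℂ (powField (p - 2) c) * (a - c)).re ≤ ‖a‖ ^ p := by
  have hq : p.HolderConjugate (p / (p - 1)) := Real.HolderConjugate.conjExponent (by linarith)
  -- Young's inequality for `|a|` and `|c|^(p-1)` with exponents `p` and `p / (p - 1)` is the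
  -- supporting-hyperplane inequality at `c`.
  have young := Real.young_inequality_of_nonneg (norm_nonneg a)
    (by positivity : 0 ≤ ‖c‖ ^ (p - 2) * ‖c‖) hq
  have h1 : (‖c‖ ^ (p - 2) * ‖c‖) ^ (p / (p - 1)) = ‖c‖ ^ p := by
    rcases eq_or_lt_of_le (norm_nonneg c) with h0 | h0
    · have hp1 : p / (p - 1) ≠ 0 := (div_pos (by linarith) (by linarith)).ne'
      rw [← h0, mul_zero, Real.zero_rpow hp1, Real.zero_rpow (by linarith)]
    · have : ‖c‖ ^ (p - 2) * ‖c‖ = ‖c‖ ^ (p - 1) := by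
        rw [← Real.rpow_add_one h0.ne']; ring_nf
      rw [this, ← Real.rpow_mul h0.le]
      congr 1
      field_simp [(by linarith : p - 1 ≠ 0)]
  have h2 : (starRingEnd ℂ (powField (p - 2) c) * (a - c)).re
      ≤ ‖c‖ ^ (p - 2) * ‖c‖ * ‖a‖ - ‖c‖ ^ p := by
    rw [mul_sub, Complex.sub_re]
    have h3 : (starRingEnd ℂ (powField (p - 2) c) * c).re = ‖c‖ ^ p := by
      rw [powField, map_mul, Complex.conj_ofReal, mul_assoc, mul_comm _ c, Complex.mul_conj,
        ← Complex.ofReal_mul, Complex.ofReal_re, Complex.normSq_eq_norm_sq,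
        ← rpow_sub_two_mul_sq (norm_nonneg c) hp]
      ring
    rw [h3]
    gcongr
    refine (Complex.re_le_norm _).trans ?_
    rw [norm_mul, RCLike.norm_conj, norm_powField]
  rw [h1] at young
  have h4 : ‖c‖ ^ p / (p / (p - 1)) * p = ‖c‖ ^ p * (p - 1) := by
    field_simp
  have h5 : p * (‖a‖ * (‖c‖ ^ (p - 2) * ‖c‖)) ≤ ‖a‖ ^ p + ‖c‖ ^ p * (p - 1) := by
    have := mul_le_mul_of_nonneg_left young (by linarith : 0 ≤ p)
    rw [mul_add, mul_comm p (‖c‖ ^ p / _), h4] at this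
    rwa [mul_div_cancel₀ _ (by linarith : p ≠ 0)] at this
  nlinarith

/-- The gradient inequality based at `a + b`, not at `a`, bounds `|a + b|^p` from above. Moving the
base point of the gradient back to `a` costs the Lipschitz bound on `powField (p - 2)`, whose factor
is `(p - 2) + 2 = p`; this is the quadratic remainder. -/
lemma norm_add_rpow_le {p : ℝ} (hp : 2 ≤ p) (a b : ℂ) :
    ‖a + b‖ ^ p ≤ ‖a‖ ^ p + p * (starRingEnd ℂ (powField (p - 2) a) * b).re
      + p * p * (‖a + b‖ ^ (p - 2) * ‖b‖ * ‖b‖ + ‖a‖ ^ (p - 2) * ‖b‖ * ‖b‖) := by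
  have h1 := norm_rpow_add_mul_re_le hp a (a + b)
  have h2 := norm_powField_sub_le (s := p - 2) (by linarith) (a + b) a
  have h3 : (starRingEnd ℂ (powField (p - 2) (a + b)) * b).re
      ≤ (starRingEnd ℂ (powField (p - 2) a) * b).re
        + p * (‖a + b‖ ^ (p - 2) * ‖b‖ * ‖b‖ + ‖a‖ ^ (p - 2) * ‖b‖ * ‖b‖) := by
    have : (starRingEnd ℂ (powField (p - 2) (a + b)) * b).re
        - (starRingEnd ℂ (powField (p - 2) a) * b).re
        ≤ ‖powField (p - 2) (a + b) - powField (p - 2) a‖ * ‖b‖ := by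
      rw [← Complex.sub_re, ← sub_mul, ← map_sub]
      refine (Complex.re_le_norm _).trans ?_
      rw [norm_mul, RCLike.norm_conj]
    have h4 := mul_le_mul_of_nonneg_right h2 (norm_nonneg b)
    rw [add_sub_cancel_left] at h4
    nlinarith
  have h5 : a - (a + b) = -b := by ring
  rw [h5, mul_neg, Complex.neg_re] at h1
  nlinarith

/-! ### Hölder and Young inequalities -/

section Holder
variable {α : Type*} [MeasurableSpace α] {μ : Measure α}

/-- Hölder for three functions with weights `(p - 2)/p`, `1/p`, `1/p`. Writing it with weights
rather than exponents keeps `p = 2` admissible. -/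
lemma lintegral_rpow_mul_mul_le {p : ℝ} (hp : 2 ≤ p) {f g h : α → ℂ}
    (hf : AEStronglyMeasurable f μ) (hg : AEStronglyMeasurable g μ)
    (hh : AEStronglyMeasurable h μ) :
    ∫⁻ x, ‖f x‖ₑ ^ (p - 2) * ‖g x‖ₑ * ‖h x‖ₑ ∂μ ≤
      eLpNorm f (ENNReal.ofReal p) μ ^ (p - 2) * eLpNorm g (ENNReal.ofReal p) μ
        * eLpNorm h (ENNReal.ofReal p) μ := by
  have hp0 : 0 < p := by linarith
  have H := ENNReal.lintegral_prod_norm_pow_le (μ := μ) (Finset.univ : Finset (Fin 3))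
    (f := ![fun x => ‖f x‖ₑ ^ p, fun x => ‖g x‖ₑ ^ p, fun x => ‖h x‖ₑ ^ p])
    (by
      intro i _
      fin_cases i
      · exact hf.enorm.pow_const _
      · exact hg.enorm.pow_const _
      · exact hh.enorm.pow_const _)
    (p := ![(p - 2) / p, 1 / p, 1 / p])
    (by simp [Fin.sum_univ_three]; field_simp; ring)
    (by
      intro i _
      fin_cases i
      · exact div_nonneg (by linarith) hp0.le
      · simp; positivity
      · simp; positivity)
  have e1 : ∀ y : ℝ≥0∞, (y ^ p) ^ ((p - 2) / p) = y ^ (p - 2) := fun y => by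
    rw [← ENNReal.rpow_mul]; congr 1; field_simp
  have e2 : ∀ y : ℝ≥0∞, (y ^ p) ^ (1 / p) = y := fun y => by
    rw [← ENNReal.rpow_mul]; simp [hp0.ne']
  simp only [Fin.prod_univ_three, Matrix.cons_val_zero, Matrix.cons_val_one, Matrix.cons_val_two,
    Matrix.tail_cons, Matrix.head_cons, e1, e2] at H
  refine H.trans_eq ?_
  simp only [eLpNorm_eq_lintegral_rpow_enorm_toReal (p := ENNReal.ofReal p) (by simpa using hp0) (by simp),
    ENNReal.toReal_ofReal hp0.le]
  rw [← ENNReal.rpow_mul]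
  congr 3
  field_simp

variable {p : ℝ}

lemma integrable_rpow_mul_mul (hp : 2 ≤ p) {f g h : α → ℂ}
    (hf : MemLp f (ENNReal.ofReal p) μ) (hg : MemLp g (ENNReal.ofReal p) μ)
    (hh : MemLp h (ENNReal.ofReal p) μ) :
    Integrable (fun x => ‖f x‖ ^ (p - 2) * ‖g x‖ * ‖h x‖) μ := by
  refine ⟨?_, ?_⟩
  · exact (((hf.1.norm.aemeasurable.pow_const _).mul hg.1.norm.aemeasurable).mul
      hh.1.norm.aemeasurable).aestronglyMeasurable
  · have := lintegral_rpow_mul_mul_le hp hf.1 hg.1 hh.1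
    refine lt_of_le_of_lt ?_ (this.trans_lt ?_)
    · refine lintegral_mono fun x => ?_
      simp only [enorm_mul, enorm_norm]
      gcongr
      rw [Real.enorm_rpow_of_nonneg (norm_nonneg _) (by linarith), enorm_norm]
    · exact ENNReal.mul_lt_top (ENNReal.mul_lt_top
        (ENNReal.rpow_lt_top_of_nonneg (by linarith) hf.2.ne) hg.2) hh.2

lemma integral_rpow_mul_mul_le (hp : 2 ≤ p) {f g h : α → ℂ}
    (hf : MemLp f (ENNReal.ofReal p) μ) (hg : MemLp g (ENNReal.ofReal p) μ)
    (hh : MemLp h (ENNReal.ofReal p) μ) :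
    ∫ x, ‖f x‖ ^ (p - 2) * ‖g x‖ * ‖h x‖ ∂μ ≤
      lpNorm f (ENNReal.ofReal p) μ ^ (p - 2) * lpNorm g (ENNReal.ofReal p) μ
        * lpNorm h (ENNReal.ofReal p) μ := by
  rw [integral_eq_lintegral_of_nonneg_ae (.of_forall fun x => by positivity)
    (integrable_rpow_mul_mul hp hf hg hh).1, ← toReal_eLpNorm hf.1, ← toReal_eLpNorm hg.1,
    ← toReal_eLpNorm hh.1, ENNReal.toReal_rpow, ← ENNReal.toReal_mul, ← ENNReal.toReal_mul]
  refine ENNReal.toReal_mono ?_ ?_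
  · exact (ENNReal.mul_lt_top (ENNReal.mul_lt_top
        (ENNReal.rpow_lt_top_of_nonneg (by linarith) hf.2.ne) hg.2) hh.2).ne
  · refine le_trans (lintegral_mono fun x => ?_) (lintegral_rpow_mul_mul_le hp hf.1 hg.1 hh.1)
    rw [ENNReal.ofReal_mul (by positivity), ENNReal.ofReal_mul (by positivity),
      ← ENNReal.ofReal_rpow_of_nonneg (norm_nonneg _) (by linarith), ofReal_norm, ofReal_norm,
      ofReal_norm]

lemma integral_norm_rpow_eq_lpNorm_rpow (hp : 2 ≤ p) {f : α → ℂ}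
    (hf : MemLp f (ENNReal.ofReal p) μ) :
    ∫ x, ‖f x‖ ^ p ∂μ = lpNorm f (ENNReal.ofReal p) μ ^ p := by
  have hp0 : 0 < p := by linarith
  rw [lpNorm_eq_integral_norm_rpow_toReal (by simpa using hp0) (by simp) hf.1,
    ENNReal.toReal_ofReal hp0.le, ← Real.rpow_mul (integral_nonneg fun x => by positivity),
    inv_mul_cancel₀ hp0.ne', Real.rpow_one]

end Holder

section Young
variable {X : Type*} [NormedAddCommGroup X] [MeasurableSpace X] [BorelSpace X]
  [SecondCountableTopology X] {μ : Measure X} [SFinite μ] [μ.IsAddRightInvariant]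

/-- Jensen's inequality for the unnormalised measure `k μ`, obtained from Hölder by writing `k =
k^(1 - 1/p) k^(1/p)`. -/
lemma rpow_lintegral_mul_le {α : Type*} [MeasurableSpace α] {μ : Measure α} {p : ℝ} (hp : 1 ≤ p)
    {k U : α → ℝ≥0∞} (hk : AEMeasurable k μ) (hU : AEMeasurable U μ) :
    (∫⁻ y, k y * U y ∂μ) ^ p ≤ (∫⁻ y, k y ∂μ) ^ (p - 1) * ∫⁻ y, k y * U y ^ p ∂μ := by
  have hp0 : 0 < p := by linarith
  have h := ENNReal.lintegral_mul_norm_pow_le (μ := μ) hk (hk.mul (hU.pow_const p))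
    (p := 1 - 1 / p) (q := 1 / p)
    (by rw [sub_nonneg, div_le_one hp0]; exact hp) (by positivity) (by ring)
  have e : ∀ y, k y ^ (1 - 1 / p) * (k y * U y ^ p) ^ (1 / p) = k y * U y := fun y => by
    rw [ENNReal.mul_rpow_of_nonneg _ _ (by positivity), ← mul_assoc,
      ← ENNReal.rpow_add_of_nonneg _ _ (by rw [sub_nonneg, div_le_one hp0]; exact hp)
        (by positivity), ← ENNReal.rpow_mul]
    simp [hp0.ne']
  simp only [Pi.mul_apply, e] at h
  refine (ENNReal.rpow_le_rpow h hp0.le).trans_eq ?_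
  rw [ENNReal.mul_rpow_of_nonneg _ _ hp0.le, ← ENNReal.rpow_mul, ← ENNReal.rpow_mul]
  congr 2
  · field_simp
  · field_simp; simp

/-- Young's inequality `L¹ * L^p ⊆ L^p`. -/
lemma eLpNorm_integral_mul_sub_le {p : ℝ} (hp : 1 ≤ p) {k u : X → ℂ} (hk : Measurable k)
    (hu : Measurable u) :
    eLpNorm (fun x => ∫ y, k y * u (x - y) ∂μ) (ENNReal.ofReal p) μ ≤
      (∫⁻ y, ‖k y‖ₑ ∂μ) * eLpNorm u (ENNReal.ofReal p) μ := by
  have hp0 : 0 < p := by linarith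
  rw [eLpNorm_eq_lintegral_rpow_enorm_toReal (by simpa using hp0) (by simp),
    eLpNorm_eq_lintegral_rpow_enorm_toReal (by simpa using hp0) (by simp),
    ENNReal.toReal_ofReal hp0.le]
  have hm : Measurable fun z : X × X => ‖k z.2‖ₑ * ‖u (z.1 - z.2)‖ₑ ^ p := by fun_prop
  have h : ∫⁻ x, ‖∫ y, k y * u (x - y) ∂μ‖ₑ ^ p ∂μ
      ≤ (∫⁻ y, ‖k y‖ₑ ∂μ) ^ p * ∫⁻ x, ‖u x‖ₑ ^ p ∂μ := by
    calc ∫⁻ x, ‖∫ y, k y * u (x - y) ∂μ‖ₑ ^ p ∂μ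
        ≤ ∫⁻ x, (∫⁻ y, ‖k y‖ₑ ∂μ) ^ (p - 1) * ∫⁻ y, ‖k y‖ₑ * ‖u (x - y)‖ₑ ^ p ∂μ ∂μ := by
          refine lintegral_mono fun x => le_trans ?_
            (rpow_lintegral_mul_le hp (U := fun y => ‖u (x - y)‖ₑ) (by fun_prop) (by fun_prop))
          gcongr
          refine (enorm_integral_le_lintegral_enorm _).trans_eq ?_
          simp [enorm_mul]
      _ = (∫⁻ y, ‖k y‖ₑ ∂μ) ^ (p - 1) * ∫⁻ x, ∫⁻ y, ‖k y‖ₑ * ‖u (x - y)‖ₑ ^ p ∂μ ∂μ := by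
          rw [lintegral_const_mul _ hm.lintegral_prod_right']
      _ = (∫⁻ y, ‖k y‖ₑ ∂μ) ^ (p - 1) * ∫⁻ y, ∫⁻ x, ‖k y‖ₑ * ‖u (x - y)‖ₑ ^ p ∂μ ∂μ := by
          rw [lintegral_lintegral_swap hm.aemeasurable]
      _ = (∫⁻ y, ‖k y‖ₑ ∂μ) ^ (p - 1) * ((∫⁻ y, ‖k y‖ₑ ∂μ) * ∫⁻ x, ‖u x‖ₑ ^ p ∂μ) := by
          congr 1
          rw [← lintegral_mul_const _ (by fun_prop)]
          refine lintegral_congr fun y => ?_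
          rw [lintegral_const_mul _ (by fun_prop), lintegral_sub_right_eq_self (fun x => ‖u x‖ₑ ^ p)]
      _ = _ := by
          rw [← mul_assoc]
          congr 1
          nth_rewrite 2 [← ENNReal.rpow_one (∫⁻ y, ‖k y‖ₑ ∂μ)]
          rw [← ENNReal.rpow_add_of_nonneg _ _ (by linarith) (by norm_num)]
          ring_nf
  refine (ENNReal.rpow_le_rpow h (by positivity)).trans_eq ?_
  rw [ENNReal.mul_rpow_of_nonneg _ _ (by positivity), ← ENNReal.rpow_mul]
  simp [hp0.ne']

end Young

/-! ### Square function bound for sums of frequency-localised functions -/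

lemma measurable_powField (s : ℝ) : Measurable (powField s) := by
  unfold powField; fun_prop

lemma integrable_conj_powField_mul {X : Type*} [MeasurableSpace X] {μ : Measure X} {p : ℝ} (hp : 2 ≤ p)
    {S u : X → ℂ}
    (hS : MemLp S (ENNReal.ofReal p) μ) (hu : MemLp u (ENNReal.ofReal p) μ) :
    Integrable (fun x => starRingEnd ℂ (powField (p - 2) (S x)) * u x) μ := by
  refine (integrable_rpow_mul_mul hp hS hS hu).mono' ?_ (.of_forall fun x => ?_)
  · exact (RCLike.continuous_conj.comp_aestronglyMeasurable
      ((measurable_powField _).comp_aemeasurable hS.1.aemeasurable).aestronglyMeasurable).mul hu.1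
  · rw [norm_mul, RCLike.norm_conj, norm_powField]

section SquareFunction
variable {X : Type*} [NormedAddCommGroup X] [MeasurableSpace X] [BorelSpace X] {μ : Measure X}
  [μ.IsAddRightInvariant]

lemma lpNorm_comp_add_right {p : ℝ≥0∞} {f : X → ℂ} (hf : AEStronglyMeasurable f μ) (y : X) :
    lpNorm (fun x => f (x + y)) p μ = lpNorm f p μ := by
  have hp := measurePreserving_add_right μ y
  rw [← toReal_eLpNorm hf, ← eLpNorm_comp_measurePreserving hf hp,
    toReal_eLpNorm (hf.comp_measurePreserving hp)]
  rfl

lemma memLp_comp_add_right {p : ℝ≥0∞} {f : X → ℂ} (hf : MemLp f p μ) (y : X) :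
    MemLp (fun x => f (x + y)) p μ :=
  hf.comp_measurePreserving (measurePreserving_add_right μ y)

lemma memLp_comp_sub_right {p : ℝ≥0∞} {f : X → ℂ} (hf : MemLp f p μ) (y : X) :
    MemLp (fun x => f (x - y)) p μ := by
  simpa [sub_eq_add_neg] using memLp_comp_add_right hf (-y)

lemma lpNorm_comp_sub_right {p : ℝ≥0∞} {f : X → ℂ} (hf : AEStronglyMeasurable f μ) (y : X) :
    lpNorm (fun x => f (x - y)) p μ = lpNorm f p μ := by
  simpa [sub_eq_add_neg] using lpNorm_comp_add_right hf (-y)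

variable [SecondCountableTopology X] [SFinite μ] {p : ℝ}

/-- Since `u = k * u`, the translation difference can be put on the kernel, and Young's inequality
applies. Boundedness of `u` only serves to make the convolution integrals converge. -/
lemma lpNorm_translate_sub_le [μ.IsNegInvariant] (hp : 1 ≤ p) {k u : X → ℂ} (hk : Measurable k)
    (hki : Integrable k μ)
    (hu : Measurable u) (hub : ∃ B, ∀ x, ‖u x‖ ≤ B) (huL : MemLp u (ENNReal.ofReal p) μ)
    (hrep : ∀ x, u x = ∫ y, k y * u (x - y) ∂μ) {h : X} {A : ℝ}
    (hA : ∫ y, ‖k (y + h) - k y‖ ∂μ ≤ A) :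
    lpNorm (fun x => u (x + h) - u x) (ENNReal.ofReal p) μ
      ≤ A * lpNorm u (ENNReal.ofReal p) μ := by
  obtain ⟨B, hB⟩ := hub
  have hkh : Integrable (fun y => k (y + h)) μ := hki.comp_add_right h
  have hint : ∀ (κ : X → ℂ), Integrable κ μ → ∀ x, Integrable (fun y => κ y * u (x - y)) μ :=
    fun κ hκ x => hκ.mul_bdd (c := B) (hu.comp (measurable_const.sub measurable_id)).aestronglyMeasurable
      (.of_forall fun y => hB _)
  have hfun : (fun x => u (x + h) - u x) = fun x => ∫ y, (k (y + h) - k y) * u (x - y) ∂μ := by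
    funext x
    rw [hrep (x + h), ← integral_add_right_eq_self (fun y => k y * u (x + h - y)) h]
    conv_lhs => rw [hrep x]
    rw [← integral_sub]
    · refine integral_congr_ae (.of_forall fun y => ?_)
      simp only [add_sub_add_right_eq_sub]
      ring
    · simpa using hint _ hkh x
    · exact hint _ hki x
  have hmeas : Measurable fun x => u (x + h) - u x := by fun_prop
  have hbd := eLpNorm_integral_mul_sub_le (μ := μ) hp (k := fun y => k (y + h) - k y) (u := u)
    (by fun_prop) hu
  rw [← hfun] at hbd
  have hfin : ∫⁻ y, ‖k (y + h) - k y‖ₑ ∂μ = ENNReal.ofReal (∫ y, ‖k (y + h) - k y‖ ∂μ) :=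
    (ofReal_integral_norm_eq_lintegral_enorm (hkh.sub hki)).symm
  rw [← toReal_eLpNorm hmeas.aestronglyMeasurable, ← toReal_eLpNorm hu.aestronglyMeasurable]
  refine (ENNReal.toReal_mono ?_ hbd).trans ?_
  · rw [hfin]; exact ENNReal.mul_ne_top (by simp) huL.2.ne
  · rw [hfin, ENNReal.toReal_mul, ENNReal.toReal_ofReal (integral_nonneg fun y => norm_nonneg _)]
    gcongr

/-- Almost orthogonality of a high-frequency `u` and a nonlinear function of a low-frequency `S`.
The convolution with `k` is transferred from `u` to `|S|^(p-2) S`; because `k` has mean zero only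
the increments of the latter over shifts `y` matter, and these are of size `L ‖y‖`. The first moment
of `k` then supplies the small factor. -/
lemma norm_integral_conj_powField_mul_le (hp : 2 ≤ p) {k S u : X → ℂ} (hk : Measurable k)
    (hki : Integrable k μ) (hk0 : ∫ y, k y ∂μ = 0) (hkm : Integrable (fun y => ‖k y‖ * ‖y‖) μ)
    (hS : Measurable S) (hSL : MemLp S (ENNReal.ofReal p) μ)
    (hu : Measurable u) (huL : MemLp u (ENNReal.ofReal p) μ)
    (hrep : ∀ x, u x = ∫ y, k y * u (x - y) ∂μ) {L A : ℝ} (hL : 0 ≤ L)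
    (hSy : ∀ y, lpNorm (fun x => S (x + y) - S x) (ENNReal.ofReal p) μ ≤ L * ‖y‖)
    (hA : ∫ y, ‖k y‖ * ‖y‖ ∂μ ≤ A) :
    ‖∫ x, starRingEnd ℂ (powField (p - 2) (S x)) * u x ∂μ‖ ≤
      2 * p * lpNorm S (ENNReal.ofReal p) μ ^ (p - 2) * L * lpNorm u (ENNReal.ofReal p) μ * A := by
  set N := fun f : X → ℂ => lpNorm f (ENNReal.ofReal p) μ with hN
  set m : X → ℂ := fun x => starRingEnd ℂ (powField (p - 2) (S x)) with hm
  have hmm : Measurable m := RCLike.continuous_conj.measurable.comp ((measurable_powField _).comp hS)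
  have hmn : ∀ x, ‖m x‖ = ‖S x‖ ^ (p - 2) * ‖S x‖ := fun x => by
    rw [hm]; simp only; rw [RCLike.norm_conj, norm_powField]
  have hFm : Measurable fun z : X × X => k z.2 * (m z.1 * u (z.1 - z.2)) := by fun_prop
  have hFint : Integrable (fun z : X × X => k z.2 * (m z.1 * u (z.1 - z.2))) (μ.prod μ) := by
    rw [integrable_prod_iff' hFm.aestronglyMeasurable]
    refine ⟨.of_forall fun y => ?_, ?_⟩
    · exact (integrable_conj_powField_mul hp hSL (memLp_comp_sub_right huL y)).const_mul (k y)
    · refine (hki.norm.mul_const (N S ^ (p - 2) * N S * N u)).mono'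
        (hFm.stronglyMeasurable.norm.integral_prod_left').aestronglyMeasurable
        (.of_forall fun y => ?_)
      rw [Real.norm_of_nonneg (integral_nonneg fun x => norm_nonneg _)]
      simp only [norm_mul, integral_const_mul, hmn]
      gcongr
      refine (integral_rpow_mul_mul_le hp hSL hSL (memLp_comp_sub_right huL y)).trans_eq ?_
      rw [lpNorm_comp_sub_right huL.1]
  -- Fubini and the shift `x ↦ x + y` move the convolution from `u` to `m`.
  have h1 : ∫ x, m x * u x ∂μ = ∫ y, k y * ∫ x, m (x + y) * u x ∂μ ∂μ := by
    calc ∫ x, m x * u x ∂μ = ∫ x, ∫ y, k y * (m x * u (x - y)) ∂μ ∂μ := by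
          refine integral_congr_ae (.of_forall fun x => ?_)
          simp only
          conv_lhs => rw [hrep x]
          rw [← integral_const_mul]
          refine integral_congr_ae (.of_forall fun y => ?_)
          simp only; ring
      _ = ∫ y, ∫ x, k y * (m x * u (x - y)) ∂μ ∂μ := integral_integral_swap hFint
      _ = _ := by
          refine integral_congr_ae (.of_forall fun y => ?_)
          simp only
          rw [integral_const_mul, ← integral_add_right_eq_self (fun x => m x * u (x - y)) y]
          simp
  have hdiff : ∀ y, ‖(∫ x, m (x + y) * u x ∂μ) - ∫ x, m x * u x ∂μ‖
      ≤ 2 * p * N S ^ (p - 2) * L * N u * ‖y‖ := by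
    intro y
    have hSy' := memLp_comp_add_right hSL y
    have hD : MemLp (fun x => S (x + y) - S x) (ENNReal.ofReal p) μ := hSy'.sub hSL
    rw [← integral_sub (integrable_conj_powField_mul hp hSy' huL)
      (integrable_conj_powField_mul hp hSL huL)]
    have i1 := integrable_rpow_mul_mul hp hSy' hD huL
    have i2 := integrable_rpow_mul_mul hp hSL hD huL
    calc _ ≤ ∫ x, p * (‖S (x + y)‖ ^ (p - 2) * ‖S (x + y) - S x‖ * ‖u x‖
              + ‖S x‖ ^ (p - 2) * ‖S (x + y) - S x‖ * ‖u x‖) ∂μ := by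
          refine norm_integral_le_of_norm_le ((i1.add i2).const_mul p) (.of_forall fun x => ?_)
          rw [← sub_mul, norm_mul, ← map_sub, RCLike.norm_conj]
          have := norm_powField_sub_le (s := p - 2) (by linarith) (S (x + y)) (S x)
          rw [sub_add_cancel] at this
          refine (mul_le_mul_of_nonneg_right this (norm_nonneg _)).trans_eq ?_
          ring
      _ ≤ p * (N S ^ (p - 2) * (L * ‖y‖) * N u + N S ^ (p - 2) * (L * ‖y‖) * N u) := by
          rw [integral_const_mul, integral_add i1 i2]
          gcongr
          · refine (integral_rpow_mul_mul_le hp hSy' hD huL).trans ?_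
            rw [lpNorm_comp_add_right hSL.1]
            gcongr
            exacts [lpNorm_nonneg, Real.rpow_nonneg lpNorm_nonneg _, hSy y]
          · refine (integral_rpow_mul_mul_le hp hSL hD huL).trans ?_
            gcongr
            exacts [lpNorm_nonneg, Real.rpow_nonneg lpNorm_nonneg _, hSy y]
      _ = _ := by ring
  have hΦ : Integrable (fun y => k y * ∫ x, m (x + y) * u x ∂μ) μ := by
    have hsw := hFint.integral_prod_right
    refine hsw.congr (.of_forall fun y => ?_)
    simp only
    rw [integral_const_mul, ← integral_add_right_eq_self (fun x => m x * u (x - y)) y]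
    simp
  -- The mean-zero condition allows the value at shift `0` to be subtracted.
  have h2 : ∫ x, m x * u x ∂μ
      = ∫ y, k y * ((∫ x, m (x + y) * u x ∂μ) - ∫ x, m x * u x ∂μ) ∂μ := by
    simp only [mul_sub]
    rw [integral_sub hΦ (hki.mul_const _), integral_mul_const, hk0, zero_mul, sub_zero, ← h1]
  rw [h2]
  calc _ ≤ ∫ y, (2 * p * N S ^ (p - 2) * L * N u) * (‖k y‖ * ‖y‖) ∂μ := by
        refine norm_integral_le_of_norm_le (hkm.const_mul _) (.of_forall fun y => ?_)
        rw [norm_mul]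
        refine (mul_le_mul_of_nonneg_left (hdiff y) (norm_nonneg _)).trans_eq ?_
        ring
    _ ≤ _ := by
        rw [integral_const_mul]
        have : 0 ≤ N S ^ (p - 2) := Real.rpow_nonneg lpNorm_nonneg _
        have : 0 ≤ N u := lpNorm_nonneg
        gcongr

lemma sum_filter_lt_zpow_le {lam : ℝ} (hlam : 1 < lam) (s : Finset ℤ) (j : ℤ) :
    ∑ k ∈ s with k < j, lam ^ (k - j) ≤ (1 - lam⁻¹)⁻¹ := by
  have h0 : 0 < lam := by linarith
  rw [← tsum_geometric_of_lt_one (by positivity) (inv_lt_one_of_one_lt₀ hlam)]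
  have hs := summable_geometric_of_lt_one (by positivity : 0 ≤ lam⁻¹) (inv_lt_one_of_one_lt₀ hlam)
  have hinj : Set.InjOn (fun k : ℤ => (j - k).toNat) (s.filter (· < j) : Finset ℤ) := by
    intro a ha b hb hab
    simp only [Finset.coe_filter, Set.mem_ofPred_eq] at ha hb hab
    omega
  calc _ = ∑ n ∈ (s.filter (· < j)).image (fun k : ℤ => (j - k).toNat), lam⁻¹ ^ n := by
        rw [Finset.sum_image hinj]
        refine Finset.sum_congr rfl fun k hk => ?_
        simp only [Finset.mem_filter] at hk
        rw [inv_pow, ← zpow_natCast, ← zpow_neg]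
        congr 1
        omega
    _ ≤ _ := hs.sum_le_tsum _ fun n _ => by positivity

lemma sum_filter_gt_zpow_le {lam : ℝ} (hlam : 1 < lam) (s : Finset ℤ) (k : ℤ) :
    ∑ j ∈ s with k < j, lam ^ (k - j) ≤ (1 - lam⁻¹)⁻¹ := by
  have h := sum_filter_lt_zpow_le hlam (s.image (fun j => -j)) (-k)
  refine le_trans (le_of_eq ?_) h
  rw [Finset.sum_filter, Finset.sum_filter, Finset.sum_image (fun a _ b _ hab => neg_injective hab)]
  refine Finset.sum_congr rfl fun j _ => ?_
  simp only [neg_lt_neg_iff]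
  congr 2
  ring

/-- Schur's test: after `2 a_k a_j ≤ a_k² + a_j²`, the row sums and the column sums of `lam ^ (k -
j)` over `k < j` are both geometric. -/
lemma sum_sum_zpow_mul_le {lam : ℝ} (hlam : 1 < lam) (s : Finset ℤ) (a : ℤ → ℝ) :
    ∑ j ∈ s, ∑ k ∈ s with k < j, lam ^ (k - j) * a k * a j
      ≤ (1 - lam⁻¹)⁻¹ * ∑ j ∈ s, a j ^ 2 := by
  have h0 : 0 < lam := by linarith
  have hle : ∑ j ∈ s, ∑ k ∈ s with k < j, lam ^ (k - j) * a k * a j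
      ≤ ∑ j ∈ s, ∑ k ∈ s with k < j, (lam ^ (k - j) * a k ^ 2 / 2 + lam ^ (k - j) * a j ^ 2 / 2) := by
    refine Finset.sum_le_sum fun j _ => Finset.sum_le_sum fun k _ => ?_
    have : 0 < lam ^ (k - j) := zpow_pos h0 _
    nlinarith [sq_nonneg (a k - a j), mul_nonneg this.le (sq_nonneg (a k - a j))]
  refine hle.trans ?_
  simp only [Finset.sum_add_distrib]
  have h1 : ∑ j ∈ s, ∑ k ∈ s with k < j, lam ^ (k - j) * a j ^ 2 / 2
      ≤ (1 - lam⁻¹)⁻¹ * (∑ j ∈ s, a j ^ 2) / 2 := by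
    rw [Finset.mul_sum, Finset.sum_div]
    refine Finset.sum_le_sum fun j _ => ?_
    rw [← Finset.sum_div, ← Finset.sum_mul]
    gcongr
    exact sum_filter_lt_zpow_le hlam s j
  have h2 : ∑ j ∈ s, ∑ k ∈ s with k < j, lam ^ (k - j) * a k ^ 2 / 2
      ≤ (1 - lam⁻¹)⁻¹ * (∑ j ∈ s, a j ^ 2) / 2 := by
    have hc : ∑ j ∈ s, ∑ k ∈ s with k < j, lam ^ (k - j) * a k ^ 2 / 2
        = ∑ k ∈ s, ∑ j ∈ s with k < j, lam ^ (k - j) * a k ^ 2 / 2 := by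
      simp only [Finset.sum_filter]
      rw [Finset.sum_comm]
    rw [hc, Finset.mul_sum, Finset.sum_div]
    refine Finset.sum_le_sum fun k _ => ?_
    rw [← Finset.sum_div, ← Finset.sum_mul]
    gcongr
    exact sum_filter_gt_zpow_le hlam s k
  linarith

/-- A family of reproducing kernels at the frequencies `lam ^ j`. -/
structure IsReproducingFamily (μ : Measure X) (lam A : ℝ) (K : ℤ → X → ℂ) : Prop where
  measurable : ∀ j, Measurable (K j)
  integrable : ∀ j, Integrable (K j) μ
  integral_eq_zero : ∀ j, ∫ y, K j y ∂μ = 0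
  integrable_mul_norm : ∀ j, Integrable (fun y => ‖K j y‖ * ‖y‖) μ
  integral_mul_norm_le : ∀ j, ∫ y, ‖K j y‖ * ‖y‖ ∂μ ≤ A * lam ^ (-j)
  integral_translate_sub_le : ∀ j h, ∫ y, ‖K j (y + h) - K j y‖ ∂μ ≤ A * lam ^ j * ‖h‖

/-- The Besov embedding `B⁰_{p,2} ⊆ L^p` for `2 ≤ p`, for finite sums. -/
theorem lpNorm_sum_sq_le [μ.IsNegInvariant] (hp : 2 ≤ p) {lam A : ℝ} (hlam : 1 < lam) (hA : 0 ≤ A)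
    {K : ℤ → X → ℂ} (hK : IsReproducingFamily μ lam A K) {u : ℤ → X → ℂ}
    (hu : ∀ j, Measurable (u j)) (hub : ∀ j, ∃ B, ∀ x, ‖u j x‖ ≤ B)
    (huL : ∀ j, MemLp (u j) (ENNReal.ofReal p) μ)
    (hrep : ∀ j x, u j x = ∫ y, K j y * u j (x - y) ∂μ) (s : Finset ℤ) :
    lpNorm (fun x => ∑ j ∈ s, u j x) (ENNReal.ofReal p) μ ^ 2 ≤
      (2 * p ^ 2 * A ^ 2 * (1 - lam⁻¹)⁻¹ + 2 * p ^ 2)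
        * ∑ j ∈ s, lpNorm (u j) (ENNReal.ofReal p) μ ^ 2 := by
  have hlam0 : 0 < lam := by linarith
  set S : Finset ℤ → X → ℂ := fun t x => ∑ j ∈ t, u j x with hS
  set a : ℤ → ℝ := fun j => lpNorm (u j) (ENNReal.ofReal p) μ with ha
  have ha0 : ∀ j, 0 ≤ a j := fun j => lpNorm_nonneg
  have hSm : ∀ t, Measurable (S t) := fun t => Finset.measurable_fun_sum t fun j _ => hu j
  have hSL : ∀ t, MemLp (S t) (ENNReal.ofReal p) μ := fun t => memLp_finsetSum t fun j _ => huL j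
  -- All partial sums met in the induction are indexed by subsets of `s`. Bounding each of them by
  -- the largest such norm `M`, and running the induction up to the maximiser `tm`, lets `M ^ (p -
  -- 2)` be cancelled at the end.
  obtain ⟨tm, htm, hmax⟩ := Finset.exists_max_image s.powerset
    (fun t => lpNorm (S t) (ENNReal.ofReal p) μ) ⟨∅, by simp⟩
  set M := lpNorm (S tm) (ENNReal.ofReal p) μ with hM
  have hM0 : 0 ≤ M := lpNorm_nonneg
  have htrans : ∀ t y, lpNorm (fun x => S t (x + y) - S t x) (ENNReal.ofReal p) μ
      ≤ (∑ k ∈ t, A * lam ^ k * a k) * ‖y‖ := by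
    intro t y
    have e : (fun x => S t (x + y) - S t x) = ∑ k ∈ t, fun x => u k (x + y) - u k x := by
      funext x; simp [hS]
    rw [e]
    refine (lpNorm_sum_le (fun k _ => (memLp_comp_add_right (huL k) y).sub (huL k))
      (by simpa using by linarith)).trans ?_
    rw [Finset.sum_mul]
    refine Finset.sum_le_sum fun k _ => ?_
    refine (lpNorm_translate_sub_le (by linarith) (hK.measurable k) (hK.integrable k) (hu k)
      (hub k) (huL k) (hrep k) (hK.integral_translate_sub_le k y)).trans_eq ?_
    ring
  -- Induction by inserting a new maximum, so that `u j` always has higher frequency than `S t`. The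
  -- increments of `S t` cost `A * lam ^ k` per summand and the moment of `K j` gives `A * lam ^
  -- (-j)`; together they produce `lam ^ (k - j)`.
  have hstep : ∀ t ⊆ s, (∫ x, ‖S t x‖ ^ p ∂μ) ≤
      ∑ j ∈ t, (2 * p ^ 2 * A ^ 2 * M ^ (p - 2) * ∑ k ∈ t with k < j, lam ^ (k - j) * a k * a j)
        + ∑ j ∈ t, 2 * p ^ 2 * M ^ (p - 2) * a j ^ 2 := by
    intro t
    induction t using Finset.induction_on_max with
    | empty => intro _; simp [hS, Real.zero_rpow (by linarith : p ≠ 0)]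
    | insert j t hj ih =>
      intro hts
      have hjt : j ∉ t := fun h => lt_irrefl _ (hj j h)
      have hts' : t ⊆ s := (Finset.subset_insert j t).trans hts
      specialize ih hts'
      have hadd : ∀ x, S (insert j t) x = S t x + u j x := fun x => by
        simp [hS, Finset.sum_insert hjt, add_comm]
      have hMt : lpNorm (S t) (ENNReal.ofReal p) μ ≤ M := hmax t (by simpa using hts')
      have hMt' : lpNorm (S (insert j t)) (ENNReal.ofReal p) μ ≤ M := hmax _ (by simpa using hts)
      have i1 := integrable_rpow_mul_mul hp (hSL (insert j t)) (huL j) (huL j)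
      have i2 := integrable_rpow_mul_mul hp (hSL t) (huL j) (huL j)
      have i3 := integrable_conj_powField_mul hp (hSL t) (huL j)
      have i4 : Integrable (fun x => ‖S t x‖ ^ p) μ := by
        simpa only [rpow_sub_two_mul_sq (norm_nonneg _) hp] using
          integrable_rpow_mul_mul hp (hSL t) (hSL t) (hSL t)
      have i5 : Integrable (fun x => ‖S (insert j t) x‖ ^ p) μ := by
        simpa only [rpow_sub_two_mul_sq (norm_nonneg _) hp] using
          integrable_rpow_mul_mul hp (hSL (insert j t)) (hSL (insert j t)) (hSL (insert j t))
      have b1 : (∫ x, ‖S (insert j t) x‖ ^ p ∂μ) ≤ (∫ x, ‖S t x‖ ^ p ∂μ)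
          + p * (∫ x, starRingEnd ℂ (powField (p - 2) (S t x)) * u j x ∂μ).re
          + p * p * ((∫ x, ‖S (insert j t) x‖ ^ (p - 2) * ‖u j x‖ * ‖u j x‖ ∂μ)
            + ∫ x, ‖S t x‖ ^ (p - 2) * ‖u j x‖ * ‖u j x‖ ∂μ) := by
        have hre : (∫ x, starRingEnd ℂ (powField (p - 2) (S t x)) * u j x ∂μ).re
            = ∫ x, (starRingEnd ℂ (powField (p - 2) (S t x)) * u j x).re ∂μ :=
          (integral_re i3).symm
        have i6 : Integrable
            (fun x => (starRingEnd ℂ (powField (p - 2) (S t x)) * u j x).re) μ := i3.re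
        have i7 : Integrable (fun x => ‖S t x‖ ^ p
            + p * (starRingEnd ℂ (powField (p - 2) (S t x)) * u j x).re) μ :=
          i4.add (i6.const_mul p)
        have i8 : Integrable (fun x => p * p * (‖S (insert j t) x‖ ^ (p - 2) * ‖u j x‖ * ‖u j x‖
            + ‖S t x‖ ^ (p - 2) * ‖u j x‖ * ‖u j x‖)) μ := (i1.add i2).const_mul _
        rw [hre, ← integral_add i1 i2, ← integral_const_mul, ← integral_const_mul,
          ← integral_add i4 (i6.const_mul p), ← integral_add i7 i8]
        refine integral_mono i5 (i7.add i8) fun x => ?_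
        have := norm_add_rpow_le hp (S t x) (u j x)
        simp only [hadd]
        exact this
      have b2 : (∫ x, starRingEnd ℂ (powField (p - 2) (S t x)) * u j x ∂μ).re
          ≤ 2 * p * M ^ (p - 2) * (∑ k ∈ t, A * lam ^ k * a k) * a j * (A * lam ^ (-j)) := by
        refine (Complex.re_le_norm _).trans ?_
        have hL : 0 ≤ ∑ k ∈ t, A * lam ^ k * a k :=
          Finset.sum_nonneg fun k _ => mul_nonneg (by positivity) (ha0 k)
        refine (norm_integral_conj_powField_mul_le hp (hK.measurable j) (hK.integrable j)
          (hK.integral_eq_zero j) (hK.integrable_mul_norm j) (hSm t) (hSL t) (hu j) (huL j)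
          (hrep j) hL (htrans t) (hK.integral_mul_norm_le j)).trans ?_
        have := ha0 j
        have hr : lpNorm (S t) (ENNReal.ofReal p) μ ^ (p - 2) ≤ M ^ (p - 2) :=
          Real.rpow_le_rpow lpNorm_nonneg hMt (by linarith)
        gcongr
      have hM2 : (0 : ℝ) ≤ M ^ (p - 2) := Real.rpow_nonneg hM0 _
      have b3 : ∀ t', lpNorm (S t') (ENNReal.ofReal p) μ ≤ M →
          ∫ x, ‖S t' x‖ ^ (p - 2) * ‖u j x‖ * ‖u j x‖ ∂μ ≤ M ^ (p - 2) * a j ^ 2 := by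
        intro t' ht'
        refine (integral_rpow_mul_mul_le hp (hSL t') (huL j) (huL j)).trans ?_
        rw [mul_assoc, ← sq]
        gcongr
        exact lpNorm_nonneg
      have c1 := b3 _ hMt'
      have c2 := b3 _ hMt
      have hfilt : (insert j t).filter (· < j) = t := by
        ext k; simp only [Finset.mem_filter, Finset.mem_insert]
        constructor
        · rintro ⟨rfl | h, h'⟩
          · exact absurd h' (lt_irrefl _)
          · exact h
        · exact fun h => ⟨Or.inr h, hj k h⟩
      have hfilt' : ∀ i ∈ t, (insert j t).filter (· < i) = t.filter (· < i) := by
        intro i hi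
        rw [Finset.filter_insert, if_neg (not_lt.2 (hj i hi).le)]
      rw [Finset.sum_insert hjt, Finset.sum_insert hjt, hfilt]
      have e1 : ∑ i ∈ t, 2 * p ^ 2 * A ^ 2 * M ^ (p - 2) *
            ∑ k ∈ insert j t with k < i, lam ^ (k - i) * a k * a i
          = ∑ i ∈ t, 2 * p ^ 2 * A ^ 2 * M ^ (p - 2) *
            ∑ k ∈ t with k < i, lam ^ (k - i) * a k * a i :=
        Finset.sum_congr rfl fun i hi => by rw [hfilt' i hi]
      rw [e1]
      have e2 : 2 * p ^ 2 * A ^ 2 * M ^ (p - 2) * ∑ k ∈ t, lam ^ (k - j) * a k * a j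
          = p * (2 * p * M ^ (p - 2) * (∑ k ∈ t, A * lam ^ k * a k) * a j * (A * lam ^ (-j))) := by
        simp only [Finset.mul_sum, Finset.sum_mul]
        refine Finset.sum_congr rfl fun k _ => ?_
        rw [sub_eq_add_neg k j, zpow_add₀ hlam0.ne']
        ring
      rw [e2]
      have b2' := mul_le_mul_of_nonneg_left b2 (by linarith : 0 ≤ p)
      have hpp : 0 ≤ p * p := by positivity
      nlinarith [mul_le_mul_of_nonneg_left c1 hpp, mul_le_mul_of_nonneg_left c2 hpp]
  have htm' : tm ⊆ s := by simpa using htm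
  have hG : 0 ≤ (1 - lam⁻¹)⁻¹ := inv_nonneg.2 (sub_nonneg.2 (inv_le_one_of_one_le₀ hlam.le))
  set Q := ∑ j ∈ s, a j ^ 2 with hQ
  have hQt : ∑ j ∈ tm, a j ^ 2 ≤ Q :=
    Finset.sum_le_sum_of_subset_of_nonneg htm' fun _ _ _ => sq_nonneg _
  have hfinal : M ^ p ≤ (2 * p ^ 2 * A ^ 2 * (1 - lam⁻¹)⁻¹ + 2 * p ^ 2) * Q * M ^ (p - 2) := by
    rw [hM, ← integral_norm_rpow_eq_lpNorm_rpow hp (hSL tm)]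
    refine (hstep tm htm').trans ?_
    rw [← hM, ← Finset.mul_sum, ← Finset.mul_sum]
    have h1 := sum_sum_zpow_mul_le hlam tm a
    have hM2 : (0 : ℝ) ≤ M ^ (p - 2) := Real.rpow_nonneg hM0 _
    have h2 : ∑ j ∈ tm, ∑ k ∈ tm with k < j, lam ^ (k - j) * a k * a j ≤ (1 - lam⁻¹)⁻¹ * Q :=
      h1.trans (by gcongr)
    calc _ ≤ 2 * p ^ 2 * A ^ 2 * M ^ (p - 2) * ((1 - lam⁻¹)⁻¹ * Q)
          + 2 * p ^ 2 * M ^ (p - 2) * Q := by gcongr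
      _ = _ := by ring
  have hMs : lpNorm (S s) (ENNReal.ofReal p) μ ≤ M := hmax s (by simp)
  have hsq : M ^ 2 ≤ (2 * p ^ 2 * A ^ 2 * (1 - lam⁻¹)⁻¹ + 2 * p ^ 2) * Q := by
    -- Cancelling `M ^ (p - 2)` requires `M ≠ 0`.
    rcases eq_or_lt_of_le hM0 with h | h
    · rw [← h]
      have : 0 ≤ Q := Finset.sum_nonneg fun _ _ => sq_nonneg _
      rw [zero_pow two_ne_zero]
      exact mul_nonneg (add_nonneg (mul_nonneg (by positivity) hG) (by positivity)) this
    · have hpos : 0 < M ^ (p - 2) := Real.rpow_pos_of_pos h _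
      rw [← rpow_sub_two_mul_sq hM0 hp, mul_assoc, ← sq, mul_comm] at hfinal
      exact le_of_mul_le_mul_right hfinal hpos
  exact (pow_le_pow_left₀ lpNorm_nonneg hMs 2).trans hsq

end SquareFunction

section

open FourierTransform

/-! ### The Fourier transform of Schwartz functions on space-time -/

section Haar
variable {V : Type*} [NormedAddCommGroup V] [NormedSpace ℝ V] [FiniteDimensional ℝ V]
  [MeasurableSpace V] [BorelSpace V] (μ : Measure V) [μ.IsAddHaarMeasure]

lemma lintegral_comp_smul_eq (f : V → ℝ≥0∞) {R : ℝ} (hR : R ≠ 0) :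
    ∫⁻ x, f (R • x) ∂μ = ENNReal.ofReal |(R ^ Module.finrank ℝ V)⁻¹| * ∫⁻ x, f x ∂μ := by
  have h := lintegral_map_equiv (μ := μ) f (Homeomorph.smulOfNeZero R hR).toMeasurableEquiv
  have e : Measure.map (Homeomorph.smulOfNeZero R hR).toMeasurableEquiv μ
      = ENNReal.ofReal |(R ^ Module.finrank ℝ V)⁻¹| • μ := Measure.map_addHaar_smul μ hR
  rw [e, lintegral_smul_measure] at h
  exact h.symm

end Haar

lemma eLpNorm_two_fourier {V : Type*} [NormedAddCommGroup V] [InnerProductSpace ℝ V]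
    [FiniteDimensional ℝ V] [MeasurableSpace V] [BorelSpace V] (f : SchwartzMap V ℂ) :
    eLpNorm (𝓕 f : SchwartzMap V ℂ) 2 volume = eLpNorm f 2 volume := by
  have h := SchwartzMap.norm_fourier_toL2_eq f
  rw [SchwartzMap.norm_toLp, SchwartzMap.norm_toLp] at h
  exact (ENNReal.toReal_eq_toReal_iff' (SchwartzMap.eLpNorm_lt_top _ _ _).ne
    (SchwartzMap.eLpNorm_lt_top _ _ _).ne).1 h

section SpaceTime
variable {d : ℕ}

instance : (volume : Measure (Space d × ℝ)).IsAddHaarMeasure := by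
  rw [Measure.volume_eq_prod]; infer_instance

lemma finrank_spaceTime : Module.finrank ℝ (Space d × ℝ) = d + 1 := by simp

/-- Space-time with its Euclidean norm. -/
abbrev EuclideanSpaceTime (d : ℕ) := WithLp 2 (Space d × ℝ)

/-- The identity from Euclidean space-time to space-time. -/
def toProd (d : ℕ) : EuclideanSpaceTime d ≃L[ℝ] Space d × ℝ :=
  WithLp.prodContinuousLinearEquiv 2 ℝ (Space d) ℝ

/-- The pairing `x · ξ + t τ`. -/
def pairing (z ζ : Space d × ℝ) : ℝ := inner ℝ z.1 ζ.1 + z.2 * ζ.2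

lemma pairing_comm (z ζ : Space d × ℝ) : pairing z ζ = pairing ζ z := by
  simp [pairing, real_inner_comm, mul_comm]

lemma continuous_pairing : Continuous fun p : (Space d × ℝ) × (Space d × ℝ) => pairing p.1 p.2 := by
  unfold pairing; fun_prop

lemma pairing_smul_left (c : ℝ) (z ζ : Space d × ℝ) : pairing (c • z) ζ = c * pairing z ζ := by
  simp [pairing, inner_smul_left]; ring

lemma pairing_smul_right (c : ℝ) (z ζ : Space d × ℝ) : pairing z (c • ζ) = c * pairing z ζ := by
  rw [pairing_comm, pairing_smul_left, pairing_comm]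

lemma inner_eq_pairing (v w : EuclideanSpaceTime d) :
    inner ℝ v w = pairing (toProd d v) (toProd d w) := by
  simp [pairing, toProd, mul_comm]

lemma measurePreserving_toProd : MeasurePreserving (toProd d) volume volume :=
  WithLp.volume_preserving_ofLp (Space d) ℝ

lemma integral_comp_toProd {F : Type*} [NormedAddCommGroup F] [NormedSpace ℝ F]
    (f : Space d × ℝ → F) : ∫ v, f (toProd d v) = ∫ z, f z :=
  measurePreserving_toProd.integral_comp
    (toProd d).toHomeomorph.measurableEmbedding f

lemma lintegral_comp_toProd (f : Space d × ℝ → ℝ≥0∞) : ∫⁻ v, f (toProd d v) = ∫⁻ z, f z :=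
  measurePreserving_toProd.lintegral_comp_emb
    (toProd d).toHomeomorph.measurableEmbedding f

/-- The map `ζ ↦ ζ / 2π` into Euclidean space-time. -/
def freqScale (d : ℕ) : (Space d × ℝ) ≃L[ℝ] EuclideanSpaceTime d :=
  (ContinuousLinearEquiv.smulLeft (Units.mk0 ((2 * Real.pi)⁻¹ : ℝ) (by positivity))).trans
    (toProd d).symm

lemma toProd_freqScale (ζ : Space d × ℝ) : toProd d (freqScale d ζ) = (2 * Real.pi)⁻¹ • ζ := by
  simp only [freqScale, ContinuousLinearEquiv.trans_apply, ContinuousLinearEquiv.apply_symm_apply]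
  rfl

lemma freqScale_apply (ζ : Space d × ℝ) :
    freqScale d ζ = (toProd d).symm ((2 * Real.pi)⁻¹ • ζ) := rfl

/-- The Fourier transform on Schwartz functions on space-time. -/
def fourierS (d : ℕ) : SchwartzMap (Space d × ℝ) ℂ →L[ℂ] SchwartzMap (Space d × ℝ) ℂ :=
  (SchwartzMap.compCLMOfContinuousLinearEquiv ℂ (freqScale d)).comp
    ((SchwartzMap.fourierTransformCLM ℂ).comp
      (SchwartzMap.compCLMOfContinuousLinearEquiv ℂ (toProd d)))

lemma fourierS_eq (ψ : SchwartzMap (Space d × ℝ) ℂ) (ζ : Space d × ℝ) :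
    fourierS d ψ ζ = (𝓕 (SchwartzMap.compCLMOfContinuousLinearEquiv ℂ (toProd d) ψ) :
      SchwartzMap (EuclideanSpaceTime d) ℂ) (freqScale d ζ) := rfl

/-- Reconciles two conventions: `𝓕` uses an inner product and the phase `2π ⟨v, w⟩`, whereas
space-time carries the supremum norm of a product and the phase here has no `2π`. Hence the detour
through `toProd` and the dilation in `freqScale`. -/
lemma fourierS_apply (ψ : SchwartzMap (Space d × ℝ) ℂ) (ζ : Space d × ℝ) :
    fourierS d ψ ζ = fourierInt ψ ζ := by
  rw [fourierS_eq, SchwartzMap.fourier_coe, Real.fourier_eq', fourierInt,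
    ← integral_comp_toProd]
  refine integral_congr_ae (.of_forall fun v => ?_)
  simp only [inner_eq_pairing, toProd_freqScale, pairing_smul_right,
    SchwartzMap.compCLMOfContinuousLinearEquiv_apply, Function.comp, smul_eq_mul]
  rw [mul_comm]
  congr 2
  change _ = -(Complex.I * ((pairing (toProd d v) ζ : ℝ) : ℂ))
  push_cast
  have : (Real.pi : ℂ) ≠ 0 := by exact_mod_cast Real.pi_ne_zero
  field_simp

lemma coe_fourierS (ψ : SchwartzMap (Space d × ℝ) ℂ) : ⇑(fourierS d ψ) = fourierInt ψ :=
  funext (fourierS_apply ψ)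

/-- The Plancherel constant `(2π)^{d+1}`. -/
def plancherelConst (d : ℕ) : ℝ := (2 * Real.pi) ^ (d + 1)

lemma plancherelConst_pos : 0 < plancherelConst d := by unfold plancherelConst; positivity

lemma abs_inv_inv_pow : |(((2 * Real.pi)⁻¹ : ℝ) ^ (d + 1))⁻¹| = plancherelConst d := by
  rw [inv_pow, inv_inv]
  exact abs_of_pos plancherelConst_pos

lemma lintegral_comp_freqScale (f : EuclideanSpaceTime d → ℝ≥0∞) :
    ∫⁻ ζ, f (freqScale d ζ) = ENNReal.ofReal (plancherelConst d) * ∫⁻ v, f v := by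
  have h := lintegral_comp_smul_eq (volume : Measure (Space d × ℝ))
    (fun z => f ((toProd d).symm z)) (R := (2 * Real.pi)⁻¹) (by positivity)
  rw [finrank_spaceTime, abs_inv_inv_pow, ← lintegral_comp_toProd (fun z => f ((toProd d).symm z))] at h
  simpa only [freqScale_apply, ContinuousLinearEquiv.symm_apply_apply] using h

lemma integral_comp_freqScale (f : EuclideanSpaceTime d → ℂ) :
    ∫ ζ, f (freqScale d ζ) = plancherelConst d * ∫ v, f v := by
  have h := Measure.integral_comp_smul (volume : Measure (Space d × ℝ))
    (fun z => f ((toProd d).symm z)) (2 * Real.pi)⁻¹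
  rw [finrank_spaceTime, abs_inv_inv_pow, ← integral_comp_toProd (fun z => f ((toProd d).symm z))] at h
  simpa only [freqScale_apply, ContinuousLinearEquiv.symm_apply_apply, Complex.real_smul] using h

lemma eLpNorm_two_eq_lintegral {α : Type*} [MeasurableSpace α] {μ : Measure α} (f : α → ℂ) :
    eLpNorm f 2 μ = (∫⁻ x, ‖f x‖ₑ ^ (2 : ℝ) ∂μ) ^ (1 / 2 : ℝ) := by
  rw [eLpNorm_eq_lintegral_rpow_enorm_toReal (by norm_num) (by norm_num)]
  simp

/-- Plancherel's theorem for Schwartz functions on space-time. -/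
lemma eLpNorm_fourierInt (ψ : SchwartzMap (Space d × ℝ) ℂ) :
    eLpNorm (fourierInt ψ) 2 volume
      = ENNReal.ofReal (plancherelConst d) ^ (1 / 2 : ℝ) * eLpNorm ψ 2 volume := by
  have h := eLpNorm_two_fourier (SchwartzMap.compCLMOfContinuousLinearEquiv ℂ (toProd d) ψ)
  rw [eLpNorm_two_eq_lintegral, eLpNorm_two_eq_lintegral] at h
  rw [← coe_fourierS, eLpNorm_two_eq_lintegral, eLpNorm_two_eq_lintegral]
  simp only [fourierS_eq]
  rw [lintegral_comp_freqScale fun v => ‖(𝓕 (SchwartzMap.compCLMOfContinuousLinearEquiv ℂ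
    (toProd d) ψ) : SchwartzMap (EuclideanSpaceTime d) ℂ) v‖ₑ ^ (2 : ℝ), ENNReal.mul_rpow_of_nonneg _ _ (by norm_num), h]
  congr 2
  exact lintegral_comp_toProd (fun z => ‖ψ z‖ₑ ^ (2 : ℝ))

/-- Fourier inversion for Schwartz functions on space-time. -/
lemma integral_fourierInt_mul_exp (ψ : SchwartzMap (Space d × ℝ) ℂ) (z : Space d × ℝ) :
    ∫ ζ, fourierInt ψ ζ * Complex.exp (Complex.I * (pairing z ζ : ℝ))
      = plancherelConst d * ψ z := by
  set f := SchwartzMap.compCLMOfContinuousLinearEquiv ℂ (toProd d) ψ with hf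
  have hinv : (𝓕⁻ (𝓕 f) : SchwartzMap (EuclideanSpaceTime d) ℂ) ((toProd d).symm z) = ψ z := by
    rw [FourierTransform.fourierInv_fourier_eq]
    simp [hf]
  rw [← hinv, SchwartzMap.fourierInv_coe, Real.fourierInv_eq', ← integral_comp_freqScale]
  refine integral_congr_ae (.of_forall fun ζ => ?_)
  simp only [← coe_fourierS, fourierS_eq, inner_eq_pairing, toProd_freqScale, pairing_smul_left,
    ContinuousLinearEquiv.apply_symm_apply, smul_eq_mul]
  rw [mul_comm]
  congr 2
  rw [pairing_comm]
  push_cast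
  have : (Real.pi : ℂ) ≠ 0 := by exact_mod_cast Real.pi_ne_zero
  field_simp

/-- Used for uniqueness: a tempered function is only tested against Fourier transforms of Schwartz
functions, and these are all Schwartz functions. -/
lemma fourierS_surjective : Function.Surjective (fourierS d) := by
  intro ψ
  refine ⟨SchwartzMap.compCLMOfContinuousLinearEquiv ℂ (toProd d).symm
    (𝓕⁻ (SchwartzMap.compCLMOfContinuousLinearEquiv ℂ (freqScale d).symm ψ)), ?_⟩
  ext ζ
  rw [fourierS_eq]
  have : SchwartzMap.compCLMOfContinuousLinearEquiv ℂ (toProd d)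
      (SchwartzMap.compCLMOfContinuousLinearEquiv ℂ (toProd d).symm
        (𝓕⁻ (SchwartzMap.compCLMOfContinuousLinearEquiv ℂ (freqScale d).symm ψ)))
      = 𝓕⁻ (SchwartzMap.compCLMOfContinuousLinearEquiv ℂ (freqScale d).symm ψ) := by
    ext v; simp
  rw [this, FourierTransform.fourier_fourierInv_eq]
  simp

/-! ### Tempered functions -/

lemma SchwartzMap.exists_norm_le {E F : Type*} [NormedAddCommGroup E] [NormedSpace ℝ E]
    [NormedAddCommGroup F] [NormedSpace ℝ F] (ψ : SchwartzMap E F) (N : ℕ) :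
    ∃ C, 0 ≤ C ∧ ∀ z, ‖ψ z‖ ≤ C * ((1 + ‖z‖) ^ N)⁻¹ := by
  refine ⟨2 ^ N * ((Finset.Iic (N, 0)).sup fun m => SchwartzMap.seminorm ℝ m.1 m.2) ψ,
    by positivity, fun z => ?_⟩
  have h := SchwartzMap.one_add_le_sup_seminorm_apply (𝕜 := ℝ) (m := (N, 0)) le_rfl le_rfl ψ z
  rw [norm_iteratedFDeriv_zero] at h
  rw [← div_eq_mul_inv, le_div_iff₀ (by positivity), mul_comm]
  exact h

lemma integrable_inv_one_add_pow {N : ℕ} (hN : d + 1 < N) :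
    Integrable fun z : Space d × ℝ => ((1 + ‖z‖) ^ N)⁻¹ := by
  have h := integrable_one_add_norm (E := Space d × ℝ) (μ := volume) (r := N)
    (by rw [finrank_spaceTime]; exact_mod_cast hN)
  refine h.congr (.of_forall fun z => ?_)
  simp [Real.rpow_neg (by positivity : 0 ≤ 1 + ‖z‖)]

lemma continuous_inv_one_add_pow (N : ℕ) :
    Continuous fun z : Space d × ℝ => ((1 + ‖z‖) ^ N)⁻¹ :=
  Continuous.inv₀ (by fun_prop) fun z => by positivity

lemma IsTempered.aestronglyMeasurable {F : Space d × ℝ → ℂ} (hF : IsTempered F) :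
    AEStronglyMeasurable F volume := by
  obtain ⟨N, hN⟩ := hF
  have h := (continuous_const.add continuous_norm).pow N |>.aestronglyMeasurable
    (μ := (volume : Measure (Space d × ℝ))) |>.smul hN.1 (f := fun z => (1 + ‖z‖ : ℝ) ^ N)
  refine h.congr (.of_forall fun z => ?_)
  have : (1 + ‖z‖ : ℝ) ^ N ≠ 0 := by positivity
  simp only [Pi.smul_apply', smul_smul, mul_inv_cancel₀ this, one_smul]

lemma IsTempered.integrable_mul {F : Space d × ℝ → ℂ} (hF : IsTempered F)
    (ψ : SchwartzMap (Space d × ℝ) ℂ) : Integrable fun z => F z * ψ z := by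
  have hm := hF.aestronglyMeasurable
  obtain ⟨N, hN⟩ := hF
  obtain ⟨C, hC, hψ⟩ := SchwartzMap.exists_norm_le ψ N
  refine (hN.norm.const_mul C).mono' (hm.mul ψ.continuous.aestronglyMeasurable)
    (.of_forall fun z => ?_)
  rw [norm_mul, norm_smul, Real.norm_of_nonneg (by positivity)]
  calc ‖F z‖ * ‖ψ z‖ ≤ ‖F z‖ * (C * ((1 + ‖z‖) ^ N)⁻¹) := by gcongr; exact hψ z
    _ = _ := by ring

lemma IsTempered.congr {F G : Space d × ℝ → ℂ} (hF : IsTempered F) (h : F =ᵐ[volume] G) :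
    IsTempered G := by
  obtain ⟨N, hN⟩ := hF
  exact ⟨N, hN.congr (h.mono fun z hz => by simp only [hz])⟩

lemma IsTempered.sub {F G : Space d × ℝ → ℂ} (hF : IsTempered F) (hG : IsTempered G) :
    IsTempered fun z => F z - G z := by
  have hFm := hF.aestronglyMeasurable
  have hGm := hG.aestronglyMeasurable
  obtain ⟨N, hN⟩ := hF
  obtain ⟨M, hM⟩ := hG
  have key : ∀ (H : Space d × ℝ → ℂ) (a b : ℕ), AEStronglyMeasurable H volume → a ≤ b →
      Integrable (fun z : Space d × ℝ => (((1 + ‖z‖) ^ a)⁻¹ : ℝ) • H z) →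
      Integrable (fun z : Space d × ℝ => (((1 + ‖z‖) ^ b)⁻¹ : ℝ) • H z) := by
    intro H a b hH hab hi
    refine hi.mono ((continuous_inv_one_add_pow b).aestronglyMeasurable.smul hH)
      (.of_forall fun z => ?_)
    rw [norm_smul, norm_smul, Real.norm_of_nonneg (by positivity),
      Real.norm_of_nonneg (by positivity)]
    gcongr
    linarith [norm_nonneg z]
  refine ⟨max N M, ?_⟩
  simp only [smul_sub]
  exact (key F N _ hFm (le_max_left _ _) hN).sub (key G M _ hGm (le_max_right _ _) hM)

lemma IsTempered.of_integrable {F : Space d × ℝ → ℂ} (hF : Integrable F) : IsTempered F :=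
  ⟨0, by simpa using hF⟩

/-- Cauchy-Schwarz against `(1 + |z|)^(-(d+2))`, which is square integrable because `2 (d + 2) > d +
1`. -/
lemma IsTempered.of_memLp_two {F : Space d × ℝ → ℂ} (hF : MemLp F 2 volume) : IsTempered F := by
  refine ⟨d + 2, ?_⟩
  have hw : MemLp (fun z : Space d × ℝ => ((1 + ‖z‖) ^ (d + 2))⁻¹) 2 volume := by
    rw [memLp_two_iff_integrable_sq (continuous_inv_one_add_pow _).aestronglyMeasurable]
    refine (integrable_inv_one_add_pow (d := d) (N := (d + 2) * 2) (by omega)).congr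
      (.of_forall fun z => ?_)
    simp [pow_mul]
  exact memLp_one_iff_integrable.1 (hF.smul hw)

lemma IsTempered.locallyIntegrable {F : Space d × ℝ → ℂ} (hF : IsTempered F) :
    LocallyIntegrable F volume := by
  obtain ⟨N, hN⟩ := hF
  refine locallyIntegrable_iff.2 fun k hk => ?_
  have h := hN.integrableOn (s := k) |>.continuousOn_smul
    (f := fun z : Space d × ℝ => (1 + ‖z‖ : ℝ) ^ N) (by fun_prop) hk
  refine h.congr_fun (fun z _ => ?_) hk.measurableSet
  have : (1 + ‖z‖ : ℝ) ^ N ≠ 0 := by positivity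
  simp only [smul_smul, mul_inv_cancel₀ this, one_smul]

/-- A tempered function that vanishes as a tempered distribution vanishes almost everywhere. -/
lemma IsTempered.ae_eq_zero {F : Space d × ℝ → ℂ} (hF : IsTempered F)
    (h : ∀ ψ : SchwartzMap (Space d × ℝ) ℂ, ∫ z, F z * ψ z = 0) : F =ᵐ[volume] 0 := by
  refine ae_eq_zero_of_integral_contDiff_smul_eq_zero hF.locallyIntegrable fun g hg hgs => ?_
  have hgs' : HasCompactSupport fun z => (g z : ℂ) := hgs.comp_left (g := fun x : ℝ => (x : ℂ)) rfl
  rw [← h (hgs'.toSchwartzMap (Complex.ofRealCLM.contDiff.comp hg))]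
  refine integral_congr_ae (.of_forall fun z => ?_)
  change g z • F z = F z * (g z : ℂ)
  rw [mul_comm, Complex.real_smul]

lemma IsTempered.ae_eq {F G : Space d × ℝ → ℂ} (hF : IsTempered F) (hG : IsTempered G)
    (h : ∀ ψ : SchwartzMap (Space d × ℝ) ℂ, ∫ z, F z * ψ z = ∫ z, G z * ψ z) :
    F =ᵐ[volume] G := by
  have := (hF.sub hG).ae_eq_zero fun ψ => by
    simp only [sub_mul]
    rw [integral_sub (hF.integrable_mul ψ) (hG.integrable_mul ψ), h, sub_self]
  filter_upwards [this] with z hz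
  simpa [sub_eq_zero] using hz

lemma IsFourierTransform.ae_unique_right {F G G' : Space d × ℝ → ℂ} (h : IsFourierTransform F G)
    (h' : IsFourierTransform F G') : G =ᵐ[volume] G' :=
  h.2.1.ae_eq h'.2.1 fun ψ => by rw [← h.2.2, ← h'.2.2]

lemma IsFourierTransform.ae_unique_left {F F' G : Space d × ℝ → ℂ} (h : IsFourierTransform F G)
    (h' : IsFourierTransform F' G) : F =ᵐ[volume] F' :=
  h.1.ae_eq h'.1 fun ψ => by
    obtain ⟨χ, rfl⟩ := fourierS_surjective ψ
    rw [coe_fourierS, h.2.2, h'.2.2]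

lemma IsFourierTransform.congr_right {F G G' : Space d × ℝ → ℂ} (h : IsFourierTransform F G)
    (hG : G =ᵐ[volume] G') : IsFourierTransform F G' :=
  ⟨h.1, h.2.1.congr hG, fun ψ => (h.2.2 ψ).trans
    (integral_congr_ae (hG.mono fun z hz => by simp only [hz]))⟩

/-- The inverse Fourier transform of an integrable function. -/
def invFourierInt (G : Space d × ℝ → ℂ) (z : Space d × ℝ) : ℂ :=
  (plancherelConst d : ℂ)⁻¹ * ∫ ζ, G ζ * Complex.exp (Complex.I * (pairing z ζ : ℝ))

lemma norm_exp_I_mul_ofReal (x : ℝ) : ‖Complex.exp (Complex.I * (x : ℂ))‖ = 1 := by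
  rw [mul_comm, Complex.norm_exp_ofReal_mul_I]

lemma norm_invFourierInt_le (G : Space d × ℝ → ℂ) (z : Space d × ℝ) :
    ‖invFourierInt G z‖ ≤ (plancherelConst d)⁻¹ * ∫ ζ, ‖G ζ‖ := by
  rw [invFourierInt, norm_mul, norm_inv, Complex.norm_real, Real.norm_of_nonneg plancherelConst_pos.le]
  gcongr
  · exact (inv_pos.2 plancherelConst_pos).le
  · refine (norm_integral_le_integral_norm _).trans_eq ?_
    simp only [norm_mul, norm_exp_I_mul_ofReal, mul_one]

lemma continuous_invFourierInt {G : Space d × ℝ → ℂ} (hG : Integrable G) :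
    Continuous (invFourierInt G) := by
  unfold invFourierInt
  refine continuous_const.mul ?_
  refine continuous_of_dominated (bound := fun ζ => ‖G ζ‖) (fun z => ?_) (fun z => ?_) hG.norm ?_
  · refine hG.1.mul (Continuous.aestronglyMeasurable ?_)
    have := (continuous_pairing (d := d)).comp (Continuous.prodMk_right z)
    exact Complex.continuous_exp.comp
      (continuous_const.mul (Complex.continuous_ofReal.comp this))
  · exact .of_forall fun ζ => by rw [norm_mul, norm_exp_I_mul_ofReal, mul_one]
  · refine .of_forall fun ζ => ?_
    have := (continuous_pairing (d := d)).comp (Continuous.prodMk_left ζ)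
    exact continuous_const.mul (Complex.continuous_exp.comp
      (continuous_const.mul (Complex.continuous_ofReal.comp this)))

lemma isTempered_of_bounded {F : Space d × ℝ → ℂ} (hF : AEStronglyMeasurable F volume) {C : ℝ}
    (hC : ∀ z, ‖F z‖ ≤ C) : IsTempered F :=
  ⟨d + 2, (integrable_inv_one_add_pow (by omega)).smul_bdd C hF (.of_forall hC)⟩

/-- Fubini moves the exponential onto the Schwartz function, where pointwise inversion is available;
no integrability of `invFourierInt G` is involved. -/
lemma isFourierTransform_invFourierInt {G : Space d × ℝ → ℂ} (hG : Integrable G) :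
    IsFourierTransform (invFourierInt G) G := by
  refine ⟨isTempered_of_bounded (continuous_invFourierInt hG).aestronglyMeasurable
    (norm_invFourierInt_le G), .of_integrable hG, fun ψ => ?_⟩
  have hc : (plancherelConst d : ℂ) ≠ 0 := by exact_mod_cast plancherelConst_pos.ne'
  have hψ : Integrable (fourierInt ψ) := by rw [← coe_fourierS]; exact (fourierS d ψ).integrable
  have hswap : Integrable (fun p : (Space d × ℝ) × (Space d × ℝ) =>
      (G p.2 * Complex.exp (Complex.I * (pairing p.1 p.2 : ℝ))) * fourierInt ψ p.1)
      (volume.prod volume) := by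
    refine ((hψ.mul_prod hG).bdd_mul (c := 1)
      (f := fun p : (Space d × ℝ) × (Space d × ℝ) =>
        Complex.exp (Complex.I * (pairing p.1 p.2 : ℝ)))
      (Continuous.aestronglyMeasurable ?_) (.of_forall fun p => ?_)).congr (.of_forall fun p => ?_)
    · exact Complex.continuous_exp.comp
        (continuous_const.mul (Complex.continuous_ofReal.comp continuous_pairing))
    · rw [norm_exp_I_mul_ofReal]
    · simp only; ring
  calc ∫ z, invFourierInt G z * fourierInt ψ z
      = (plancherelConst d : ℂ)⁻¹ * ∫ z, ∫ ζ,
          (G ζ * Complex.exp (Complex.I * (pairing z ζ : ℝ))) * fourierInt ψ z := by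
        rw [← integral_const_mul]
        refine integral_congr_ae (.of_forall fun z => ?_)
        simp only [invFourierInt, integral_mul_const]
        ring
    _ = (plancherelConst d : ℂ)⁻¹ * ∫ ζ, ∫ z,
          (G ζ * Complex.exp (Complex.I * (pairing z ζ : ℝ))) * fourierInt ψ z := by
        rw [integral_integral_swap hswap]
    _ = (plancherelConst d : ℂ)⁻¹ * ∫ ζ, plancherelConst d * (G ζ * ψ ζ) := by
        congr 1
        refine integral_congr_ae (.of_forall fun ζ => ?_)
        have := integral_fourierInt_mul_exp ψ ζ
        simp only [pairing_comm _ ζ]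
        simp only [mul_assoc, integral_const_mul]
        rw [mul_left_comm, ← this]
        congr 1
        refine integral_congr_ae (.of_forall fun z => ?_)
        simp only; ring
    _ = _ := by rw [integral_const_mul, inv_mul_cancel_left₀ hc]

/-! ### Dilations and the Fourier transform -/

lemma fourierInt_comp_smul (ψ : Space d × ℝ → ℂ) {δ : ℝ} (hδ : 0 < δ) (ζ : Space d × ℝ) :
    fourierInt (fun z => ψ (δ • z)) ζ = ((δ ^ (d + 1))⁻¹ : ℝ) • fourierInt ψ (δ⁻¹ • ζ) := by
  have h := Measure.integral_comp_smul (volume : Measure (Space d × ℝ))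
    (fun z => ψ z * Complex.exp (-(Complex.I * ((pairing z (δ⁻¹ • ζ) : ℝ) : ℂ)))) δ
  rw [finrank_spaceTime, abs_of_pos (by positivity)] at h
  refine Eq.trans ?_ h
  refine integral_congr_ae (.of_forall fun z => ?_)
  simp only [pairing_smul_left, pairing_smul_right, inv_mul_cancel_left₀ hδ.ne']
  rfl

lemma IsTempered.comp_smul {F : Space d × ℝ → ℂ} (hF : IsTempered F) {δ : ℝ} (hδ : 0 < δ) :
    IsTempered fun z => F (δ • z) := by
  have hm := hF.aestronglyMeasurable
  obtain ⟨N, hN⟩ := hF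
  refine ⟨N, ?_⟩
  have h := (integrable_comp_smul_iff volume (fun z : Space d × ℝ => (((1 + ‖z‖) ^ N)⁻¹ : ℝ) • F z)
    hδ.ne').2 hN
  have hm' : AEStronglyMeasurable (fun z => F (δ • z)) volume :=
    hm.comp_quasiMeasurePreserving
      ⟨(measurable_const_smul δ), by
        rw [Measure.map_addHaar_smul volume hδ.ne']
        exact Measure.smul_absolutelyContinuous⟩
  -- The constant comes from `1 + δ |z| ≤ (1 + δ)(1 + |z|)`.
  refine (h.norm.const_mul ((1 + δ) ^ N)).mono'
    ((continuous_inv_one_add_pow N).aestronglyMeasurable.smul hm') (.of_forall fun z => ?_)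
  rw [norm_smul, norm_smul, ← mul_assoc, norm_smul, Real.norm_of_nonneg (by positivity),
    Real.norm_of_nonneg (by positivity), Real.norm_of_nonneg hδ.le]
  gcongr
  rw [← inv_inv ((1 + δ) ^ N), ← mul_inv]
  gcongr
  rw [inv_mul_le_iff₀ (by positivity), ← mul_pow]
  gcongr
  nlinarith [norm_nonneg z]

/-- Behaviour of the Fourier transform under dilations. -/
lemma IsFourierTransform.comp_smul {F G : Space d × ℝ → ℂ} (h : IsFourierTransform F G) {δ : ℝ}
    (hδ : 0 < δ) :
    IsFourierTransform (fun z => F (δ • z)) fun ζ => ((δ ^ (d + 1))⁻¹ : ℝ) • G (δ⁻¹ • ζ) := by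
  have hT : IsTempered fun ζ => ((δ ^ (d + 1))⁻¹ : ℝ) • G (δ⁻¹ • ζ) := by
    obtain ⟨N, hN⟩ := h.2.1.comp_smul (inv_pos.2 hδ)
    refine ⟨N, (hN.smul ((δ ^ (d + 1))⁻¹ : ℝ)).congr (.of_forall fun z => ?_)⟩
    simp only [Pi.smul_apply]
    exact smul_comm _ _ _
  refine ⟨h.1.comp_smul hδ, hT, fun ψ => ?_⟩
  have h1 := h.2.2 (SchwartzMap.compCLMOfContinuousLinearEquiv ℂ
    (ContinuousLinearEquiv.smulLeft (Units.mk0 δ hδ.ne')) ψ)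
  have e : ⇑(SchwartzMap.compCLMOfContinuousLinearEquiv ℂ
    (ContinuousLinearEquiv.smulLeft (Units.mk0 δ hδ.ne')) ψ) = fun z : Space d × ℝ => ψ (δ • z) := rfl
  rw [e] at h1
  simp only [fourierInt_comp_smul (⇑ψ) hδ] at h1
  have h2 := Measure.integral_comp_smul (volume : Measure (Space d × ℝ))
    (fun z => F (δ • z) * fourierInt ψ z) δ⁻¹
  have h3 := Measure.integral_comp_smul (volume : Measure (Space d × ℝ))
    (fun z => G (δ⁻¹ • z) * ψ z) δ
  simp only [smul_smul, mul_inv_cancel₀ hδ.ne', inv_mul_cancel₀ hδ.ne', one_smul, finrank_spaceTime,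
    inv_pow, inv_inv] at h2 h3
  rw [abs_of_pos (by positivity)] at h2 h3
  simp only [mul_smul_comm, integral_smul, smul_mul_assoc] at h1 ⊢
  rw [h2, h3, inv_smul_smul₀ (by positivity)] at h1
  exact h1

end SpaceTime

end

/-! ### Representation of functionals and Plancherel's theorem -/

section Riesz
variable {α : Type*} [MeasurableSpace α] {ν : Measure α}

lemma enorm_integral_mul_le {f g : α → ℂ} (hf : AEStronglyMeasurable f ν)
    (hg : AEStronglyMeasurable g ν) :
    ‖∫ a, f a * g a ∂ν‖ₑ ≤ eLpNorm f 2 ν * eLpNorm g 2 ν := by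
  refine (enorm_integral_le_lintegral_enorm _).trans ?_
  rw [eLpNorm_two_eq_lintegral, eLpNorm_two_eq_lintegral]
  simp only [enorm_mul]
  exact ENNReal.lintegral_mul_le_Lp_mul_Lq ν Real.HolderConjugate.two_two hf.enorm hg.enorm

/-- If a linear functional is dominated by the `L²` norm of a linear map `A`, then it is given by
integration of `A` against an `L²` function. -/
lemma exists_memLp_two_representing {X : Type*} [AddCommGroup X] [Module ℂ X]
    (A : X →ₗ[ℂ] (α → ℂ)) (hA : ∀ x, MemLp (A x) 2 ν) (l : X →ₗ[ℂ] ℂ) (M : ℝ≥0)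
    (h : ∀ x, ‖l x‖ₑ ≤ M * eLpNorm (A x) 2 ν) :
    ∃ y : α → ℂ, MemLp y 2 ν ∧ eLpNorm y 2 ν ≤ M ∧ ∀ x, l x = ∫ a, y a * A x a ∂ν := by
  let T : X →ₗ[ℂ] Lp ℂ 2 ν :=
    { toFun := fun x => (hA x).toLp (A x)
      map_add' := fun x y => by
        rw [← MemLp.toLp_add]; congr 1; exact map_add A x y
      map_smul' := fun c x => by
        rw [RingHom.id_apply, ← MemLp.toLp_const_smul]; congr 1; exact map_smul A c x }
  have hT : ∀ x, ‖l x‖ ≤ M * ‖T x‖ := fun x => by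
    have hx : ‖T x‖ = (eLpNorm (A x) 2 ν).toReal := Lp.norm_toLp _ (hA x)
    rw [hx, ← toReal_enorm, ← ENNReal.coe_toReal, ← ENNReal.toReal_mul]
    exact ENNReal.toReal_mono (ENNReal.mul_ne_top (by simp) (hA x).2.ne) (h x)
  -- The domination makes `l` factor through the image of `A` in `L²`, on which it is bounded by
  -- `M`.
  have hker : LinearMap.ker T ≤ LinearMap.ker l := fun x hx => by
    have := hT x
    rw [LinearMap.mem_ker.1 hx, norm_zero, mul_zero] at this
    simpa using this
  let f : LinearMap.range T →ₗ[ℂ] ℂ :=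
    ((LinearMap.ker T).liftQ l hker).comp T.quotKerEquivRange.symm.toLinearMap
  have hf : ∀ x, f ⟨T x, LinearMap.mem_range_self T x⟩ = l x := fun x => by
    have : T.quotKerEquivRange.symm ⟨T x, LinearMap.mem_range_self T x⟩
        = (LinearMap.ker T).mkQ x := by
      rw [LinearEquiv.symm_apply_eq]; rfl
    simp only [f, LinearMap.comp_apply, LinearEquiv.coe_coe, this]
    exact Submodule.liftQ_apply _ _ _
  let fc : StrongDual ℂ (LinearMap.range T) := f.mkContinuous M fun v => by
    obtain ⟨_, x, rfl⟩ := v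
    rw [hf]
    exact hT x
  -- The range of `T` need be neither closed nor dense, so Hahn-Banach extends the functional with
  -- the same norm before Riesz is applied. The conjugate of the Riesz vector turns the sesquilinear
  -- inner product into the bilinear pairing.
  obtain ⟨g, hg, hgn⟩ := exists_extension_norm_eq _ fc
  have hgM : ‖g‖ ≤ M := hgn.trans_le (LinearMap.mkContinuous_norm_le _ M.2 _)
  let y0 := (InnerProductSpace.toDual ℂ (Lp ℂ 2 ν)).symm g
  have hy0 : MemLp (fun a => starRingEnd ℂ (y0 a)) 2 ν := (Lp.memLp y0).star
  refine ⟨fun a => starRingEnd ℂ (y0 a), hy0, ?_, fun x => ?_⟩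
  · have h1 : eLpNorm (fun a => starRingEnd ℂ (y0 a)) 2 ν = eLpNorm y0 2 ν :=
      eLpNorm_congr_norm_ae (.of_forall fun a => RCLike.norm_conj _)
    have h2 : ‖y0‖ ≤ M := by simpa [y0] using hgM
    rw [h1, ← Lp.enorm_def, ← ofReal_norm, ← ENNReal.ofReal_coe_nnreal]
    exact ENNReal.ofReal_le_ofReal h2
  · rw [← hf x]
    have h1 : g (T x) = f ⟨T x, LinearMap.mem_range_self T x⟩ :=
      hg ⟨T x, LinearMap.mem_range_self T x⟩
    rw [← h1, ← InnerProductSpace.toDual_symm_apply, L2.inner_def]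
    refine integral_congr_ae ?_
    filter_upwards [(hA x).coeFn_toLp] with a ha
    have ha' : (T x : α → ℂ) a = A x a := ha
    rw [ha', RCLike.inner_apply, mul_comm]

end Riesz

section Plancherel
variable {d : ℕ}

/-- The square root of the Plancherel constant. -/
def fourierBound (d : ℕ) : ℝ≥0 := (plancherelConst d).toNNReal ^ (1 / 2 : ℝ)

lemma fourierBound_pos : 0 < fourierBound d :=
  NNReal.rpow_pos (Real.toNNReal_pos.2 plancherelConst_pos)

lemma eLpNorm_fourierInt_eq (ψ : SchwartzMap (Space d × ℝ) ℂ) :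
    eLpNorm (fourierInt ψ) 2 volume = fourierBound d * eLpNorm ψ 2 volume := by
  rw [eLpNorm_fourierInt, fourierBound, ENNReal.coe_rpow_of_nonneg _ (by norm_num)]
  rfl

/-- A Schwartz function as a function. -/
def schwartzCoe (d : ℕ) : SchwartzMap (Space d × ℝ) ℂ →ₗ[ℂ] (Space d × ℝ → ℂ) where
  toFun ψ := ψ
  map_add' _ _ := rfl
  map_smul' _ _ := rfl

/-- The pairing of a tempered function with Schwartz functions. -/
def IsTempered.toLinearMap {F : Space d × ℝ → ℂ} (hF : IsTempered F) :
    SchwartzMap (Space d × ℝ) ℂ →ₗ[ℂ] ℂ where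
  toFun ψ := ∫ z, F z * ψ z
  map_add' ψ χ := by
    simp only [add_apply, mul_add]
    exact integral_add (hF.integrable_mul ψ) (hF.integrable_mul χ)
  map_smul' c ψ := by
    simp only [smul_apply, smul_eq_mul, mul_left_comm _ c, integral_const_mul,
      RingHom.id_apply]

/-- Every `L²` function on space-time has an `L²` Fourier transform. -/
lemma exists_isFourierTransform {g : Space d × ℝ → ℂ} (hg : MemLp g 2 volume) :
    ∃ G, MemLp G 2 volume ∧ eLpNorm G 2 volume ≤ fourierBound d * eLpNorm g 2 volume ∧
      IsFourierTransform g G := by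
  have hT := IsTempered.of_memLp_two hg
  obtain ⟨G, hG, hGn, hrep⟩ := exists_memLp_two_representing (ν := volume) (schwartzCoe d)
    (fun ψ => ψ.memLp 2 volume) (hT.toLinearMap ∘ₗ (fourierS d).toLinearMap)
    (fourierBound d * (eLpNorm g 2 volume).toNNReal) fun ψ => by
      refine (enorm_integral_mul_le hg.1 (fourierS d ψ).continuous.aestronglyMeasurable).trans_eq ?_
      have : eLpNorm (fourierS d ψ) 2 volume = fourierBound d * eLpNorm ψ 2 volume := by
        rw [coe_fourierS, eLpNorm_fourierInt_eq]
      erw [this]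
      rw [ENNReal.coe_mul, ENNReal.coe_toNNReal hg.2.ne, ← mul_assoc, mul_comm (eLpNorm g 2 volume)]
      rfl
  refine ⟨G, hG, ?_, hT, .of_memLp_two hG, fun ψ => ?_⟩
  · rwa [ENNReal.coe_mul, ENNReal.coe_toNNReal hg.2.ne] at hGn
  · rw [← coe_fourierS]; exact hrep ψ

/-- Every `L²` function on space-time is the Fourier transform of an `L²` function. -/
lemma exists_isFourierTransform_symm {G : Space d × ℝ → ℂ} (hG : MemLp G 2 volume) :
    ∃ g, MemLp g 2 volume ∧ eLpNorm g 2 volume ≤ (fourierBound d)⁻¹ * eLpNorm G 2 volume ∧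
      IsFourierTransform g G := by
  have hT := IsTempered.of_memLp_two hG
  have hne : (fourierBound d : ℝ≥0∞) ≠ 0 := by exact_mod_cast fourierBound_pos.ne'
  -- Here the dominating map is the Fourier transform itself: Plancherel makes `ψ ↦ ∫ G ψ` bounded
  -- by the `L²` norm of the transform of `ψ`, and the representing function is the inverse
  -- transform of `G`.
  obtain ⟨g, hg, hgn, hrep⟩ := exists_memLp_two_representing (ν := volume)
    (schwartzCoe d ∘ₗ (fourierS d).toLinearMap)
    (fun ψ => SchwartzMap.memLp (fourierS d ψ) 2 volume) hT.toLinearMap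
    ((fourierBound d)⁻¹ * (eLpNorm G 2 volume).toNNReal) fun ψ => by
      refine (enorm_integral_mul_le hG.1 ψ.continuous.aestronglyMeasurable).trans_eq ?_
      have : eLpNorm ((schwartzCoe d ∘ₗ (fourierS d).toLinearMap) ψ) 2 volume
          = fourierBound d * eLpNorm ψ 2 volume := by
        rw [← eLpNorm_fourierInt_eq, ← coe_fourierS]; rfl
      rw [this, ENNReal.coe_mul, ENNReal.coe_toNNReal hG.2.ne, ENNReal.coe_inv fourierBound_pos.ne',
        mul_assoc, mul_left_comm _ (fourierBound d : ℝ≥0∞), ← mul_assoc,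
        ENNReal.inv_mul_cancel hne (by simp), one_mul]
  refine ⟨g, hg, ?_, .of_memLp_two hg, hT, fun ψ => ?_⟩
  · rwa [ENNReal.coe_mul, ENNReal.coe_toNNReal hG.2.ne] at hgn
  · rw [← coe_fourierS]; exact (hrep ψ).symm

end Plancherel

section

open scoped Pointwise

/-! ### One-dimensional marginals of the velocity measures -/

section Slicing
variable {n : ℕ}

lemma lintegral_space_eq_pi (f : (Fin n → ℝ) → ℝ≥0∞) :
    ∫⁻ x : Space n, f (WithLp.ofLp x) = ∫⁻ x : Fin n → ℝ, f x :=
  (PiLp.volume_preserving_ofLp (Fin n)).lintegral_comp_emb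
    (MeasurableEquiv.toLp 2 (Fin n → ℝ)).symm.measurableEmbedding f

/-- Integration over hyperplanes orthogonal to a unit vector. -/
lemma lintegral_norm_sq_inner {F : ℝ × ℝ → ℝ≥0∞} (hF : Measurable F) {ω : Space (n + 1)}
    (hω : ‖ω‖ = 1) :
    ∫⁻ x : Space (n + 1), F (‖x‖ ^ 2, inner ℝ x ω)
      = ∫⁻ s : ℝ, ∫⁻ y : Space n, F (s ^ 2 + ‖y‖ ^ 2, s) := by
  -- Rotation invariance: complete `ω` to an orthonormal basis with `ω` in position `0`, so that
  -- `inner x ω` becomes the zeroth coordinate.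
  obtain ⟨b, hb⟩ := Orthonormal.exists_orthonormalBasis_extension_of_card_eq (𝕜 := ℝ)
    (E := Space (n + 1)) (ι := Fin (n + 1)) (by simp) (v := fun _ => ω) (s := {0})
    ⟨fun _ => hω, fun i j hij => absurd (Subtype.ext (i.2.trans j.2.symm)) hij⟩
  have hb0 : b 0 = ω := hb 0 rfl
  have h1 : ∫⁻ x : Space (n + 1), F (‖x‖ ^ 2, inner ℝ x ω)
      = ∫⁻ x : Space (n + 1), F (‖x‖ ^ 2, x 0) := by
    rw [← b.measurePreserving_repr.lintegral_comp_emb b.repr.toHomeomorph.measurableEmbedding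
      fun x => F (‖x‖ ^ 2, x 0)]
    refine lintegral_congr fun x => ?_
    rw [b.repr.norm_map, b.repr_apply_apply, hb0, real_inner_comm]
  have h2 : ∫⁻ x : Space (n + 1), F (‖x‖ ^ 2, x 0)
      = ∫⁻ x : Fin (n + 1) → ℝ, F (∑ i, x i ^ 2, x 0) := by
    rw [← lintegral_space_eq_pi]
    refine lintegral_congr fun x => ?_
    rw [EuclideanSpace.real_norm_sq_eq]
  rw [h1, h2, ← (volume_preserving_piFinSuccAbove (fun _ : Fin (n + 1) => ℝ) 0).symm.lintegral_comp_emb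
    (MeasurableEquiv.piFinSuccAbove (fun _ : Fin (n + 1) => ℝ) 0).symm.measurableEmbedding]
  have h3 : ∀ p : ℝ × (Fin n → ℝ),
      F (∑ i, ((MeasurableEquiv.piFinSuccAbove (fun _ : Fin (n + 1) => ℝ) 0).symm p) i ^ 2,
        ((MeasurableEquiv.piFinSuccAbove (fun _ : Fin (n + 1) => ℝ) 0).symm p) 0)
      = F (p.1 ^ 2 + ∑ i, p.2 i ^ 2, p.1) := fun p => by
    simp [Fin.sum_univ_succ, MeasurableEquiv.piFinSuccAbove]
  simp only [h3]
  rw [Measure.volume_eq_prod, lintegral_prod _ (by fun_prop)]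
  refine lintegral_congr fun s => ?_
  rw [← lintegral_space_eq_pi fun x => F (s ^ 2 + ∑ i, x i ^ 2, s)]
  refine lintegral_congr fun x => ?_
  rw [EuclideanSpace.real_norm_sq_eq]

lemma lintegral_eq_mul_lintegral_comp_smul (f : Space n → ℝ≥0∞) {R : ℝ} (hR : 0 < R) :
    ∫⁻ y, f y = ENNReal.ofReal (R ^ n) * ∫⁻ y, f (R • y) := by
  rw [lintegral_comp_smul_eq volume f hR.ne', ← mul_assoc, ← ENNReal.ofReal_mul (by positivity)]
  simp [abs_of_pos hR, hR.ne']

end Slicing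

lemma measurable_posPow (a : ℝ) : Measurable fun x => posPow x a := by
  unfold posPow
  exact Measurable.ite measurableSet_Ioi (by fun_prop) measurable_const

lemma posPow_nonneg (x a : ℝ) : 0 ≤ posPow x a := by
  unfold posPow; split_ifs with h
  · exact Real.rpow_nonneg h.le _
  · exact le_rfl

lemma posPow_of_pos {x : ℝ} (h : 0 < x) (a : ℝ) : posPow x a = x ^ a := if_pos h
lemma posPow_of_nonpos {x : ℝ} (h : x ≤ 0) (a : ℝ) : posPow x a = 0 := if_neg (not_lt.2 h)

/-- The density of the velocity measure for `κ > -1`. -/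
def ballDensity (κ R : ℝ) : ℝ≥0∞ :=
  if R ≤ 1 then ENNReal.ofReal ((Real.Gamma (1 + κ))⁻¹ * (1 - R) ^ κ) else 0

lemma measurable_ballDensity (κ : ℝ) : Measurable (ballDensity κ) :=
  Measurable.ite measurableSet_Iic (by fun_prop) measurable_const

lemma velocityMeasure_eq {d : ℕ} {κ : ℝ} (hκ : κ ≠ -1) :
    velocityMeasure d κ = volume.withDensity fun v => ballDensity κ (‖v‖ ^ 2) := by
  rw [velocityMeasure, if_neg hκ]
  congr 1
  funext v
  simp only [ballDensity, sq_le_one_iff₀ (norm_nonneg v)]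

/-- The mass of the velocity measure for `κ > -1`. -/
lemma lintegral_ballDensity_lt_top {n : ℕ} (hn : n ≠ 0) {κ : ℝ} (hκ : -1 < κ) (hκ0 : κ ≤ 0) :
    ∫⁻ y : Space n, ballDensity κ (‖y‖ ^ 2) < ∞ := by
  have : NeZero n := ⟨hn⟩
  -- In polar coordinates the integrand is `r^(n-1) (1 - r)^κ (1 + r)^κ`; for `κ ≤ 0` the last
  -- factor is at most `1`, and `(1 - r)^κ` is integrable since `κ > -1`.
  have hrad : IntegrableOn (fun x : Space n => (fun r : ℝ => (1 - r ^ 2) ^ κ) ‖x‖)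
      (Metric.ball 0 1) volume := by
    refine (integrableOn_fun_norm_addHaar (volume : Measure (Space n))
      (f := fun r : ℝ => (1 - r ^ 2) ^ κ)).2 ?_
    have h0 : IntegrableOn (fun y : ℝ => (1 - y) ^ κ) (Set.Ioo 0 1) := by
      have := (intervalIntegral.intervalIntegrable_rpow' (a := 0) (b := 1) hκ).comp_sub_left 1
      simp only [sub_zero, sub_self] at this
      have := this.symm
      rw [intervalIntegrable_iff_integrableOn_Ioo_of_le zero_le_one] at this
      exact this
    refine Integrable.mono' h0 (by fun_prop) ?_
    filter_upwards [ae_restrict_mem measurableSet_Ioo] with y hy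
    have hy1 : 0 < 1 - y := by linarith [hy.2]
    have e : 1 - y ^ 2 = (1 - y) * (1 + y) := by ring
    rw [norm_smul, norm_pow, Real.norm_of_nonneg hy.1.le, e,
      Real.mul_rpow hy1.le (by linarith [hy.1]), Real.norm_of_nonneg (by
        have := hy.1; positivity)]
    have h1 : y ^ (Module.finrank ℝ (Space n) - 1) ≤ 1 := pow_le_one₀ hy.1.le hy.2.le
    have h2 : (1 + y) ^ κ ≤ 1 := Real.rpow_le_one_of_one_le_of_nonpos (by linarith [hy.1]) hκ0
    have h3 : 0 ≤ (1 - y) ^ κ := by positivity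
    have h4 : 0 ≤ (1 + y) ^ κ := by have := hy.1; positivity
    have h5 : 0 ≤ y ^ (Module.finrank ℝ (Space n) - 1) := pow_nonneg hy.1.le _
    calc _ ≤ 1 * ((1 - y) ^ κ * 1) := by gcongr
      _ = _ := by ring
  have hfin := (hrad.const_mul (Real.Gamma (1 + κ))⁻¹).lintegral_lt_top
  refine lt_of_le_of_lt ?_ hfin
  -- The density lives on the closed ball and the integrability is known on the open one; they
  -- differ by the null unit sphere.
  have hsph : ∀ᵐ y : Space n, ‖y‖ ≠ 1 := by
    have := Measure.addHaar_sphere (volume : Measure (Space n)) 0 1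
    rw [← compl_mem_ae_iff] at this
    filter_upwards [this] with y hy
    simpa using hy
  rw [← lintegral_indicator Metric.isOpen_ball.measurableSet]
  refine lintegral_mono_ae ?_
  filter_upwards [hsph] with y hy
  unfold ballDensity
  split_ifs with h
  · have hy1 : ‖y‖ < 1 :=
      lt_of_le_of_ne ((sq_le_one_iff₀ (norm_nonneg y)).1 h) hy
    rw [Set.indicator_of_mem (by simpa using hy1)]
  · exact zero_le

lemma lintegral_ballDensity_pos {n : ℕ} {κ : ℝ} (hκ : -1 < κ) :
    0 < ∫⁻ y : Space n, ballDensity κ (‖y‖ ^ 2) := by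
  have hb := measurable_ballDensity κ
  rw [lintegral_pos_iff_support (by fun_prop)]
  refine lt_of_lt_of_le (Metric.measure_ball_pos volume (0 : Space n) one_pos) (measure_mono ?_)
  intro y hy
  have hy1 : ‖y‖ ^ 2 < 1 := by
    rw [sq_lt_one_iff₀ (norm_nonneg y)]; simpa using hy
  rw [Function.mem_support, ballDensity, if_pos hy1.le]
  have : 0 < Real.Gamma (1 + κ) := Real.Gamma_pos_of_pos (by linarith)
  have h2 : 0 < 1 - ‖y‖ ^ 2 := by linarith
  exact (ENNReal.ofReal_pos.2 (by positivity)).ne'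

lemma ae_abs_ne_one : ∀ᵐ s : ℝ, 1 - s ^ 2 ≠ 0 := by
  have : ({1, -1} : Set ℝ).Countable := by simp
  filter_upwards [this.ae_notMem volume] with s hs h
  apply hs
  have : (1 - s) * (1 + s) = 0 := by linarith
  rcases mul_eq_zero.1 this with h | h
  · left; linarith
  · right; simp only [Set.mem_singleton_iff]; linarith

/-- On the slice at height `s` the density is a power of `(1 - s²) - |y|²`. Rescaling `y` by `√(1 -
s²)` pulls out `(1 - s²)^κ` from the density and `(1 - s²)^(n/2)` from the volume, leaving the mass
of the same density in dimension `n`. -/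
lemma lintegral_inner_velocityMeasure_of_gt {n : ℕ} {κ : ℝ} (hκ : -1 < κ)
    {ω : Space (n + 1)} (hω : ‖ω‖ = 1) {g : ℝ → ℝ≥0∞} (hg : Measurable g) :
    ∫⁻ v, g (inner ℝ v ω) ∂(velocityMeasure (n + 1) κ)
      = (∫⁻ y : Space n, ballDensity κ (‖y‖ ^ 2))
        * ∫⁻ s, g s * ENNReal.ofReal (posPow (1 - s ^ 2) (κ + n / 2)) := by
  have hb := measurable_ballDensity κ
  rw [velocityMeasure_eq hκ.ne', lintegral_withDensity_eq_lintegral_mul _ (by fun_prop) (by fun_prop)]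
  have h := lintegral_norm_sq_inner (F := fun p => ballDensity κ p.1 * g p.2) (by fun_prop) hω
  refine Eq.trans h ?_
  rw [← lintegral_const_mul _ (by have := measurable_posPow (κ + n / 2); fun_prop)]
  refine lintegral_congr_ae ?_
  filter_upwards [ae_abs_ne_one] with s hs
  rw [lintegral_mul_const _ (by fun_prop)]
  rcases lt_or_gt_of_ne hs with h0 | h0
  · rw [posPow_of_nonpos h0.le]
    have : ∀ y : Space n, ballDensity κ (s ^ 2 + ‖y‖ ^ 2) = 0 := fun y => by
      rw [ballDensity, if_neg]
      nlinarith [sq_nonneg ‖y‖]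
    simp [this]
  · rw [posPow_of_pos h0]
    have hR : 0 < Real.sqrt (1 - s ^ 2) := Real.sqrt_pos.2 h0
    rw [lintegral_eq_mul_lintegral_comp_smul _ hR]
    have hsc : ∀ y : Space n, ballDensity κ (s ^ 2 + ‖Real.sqrt (1 - s ^ 2) • y‖ ^ 2)
        = ENNReal.ofReal ((1 - s ^ 2) ^ κ) * ballDensity κ (‖y‖ ^ 2) := fun y => by
      have e : 1 - (s ^ 2 + ‖Real.sqrt (1 - s ^ 2) • y‖ ^ 2) = (1 - s ^ 2) * (1 - ‖y‖ ^ 2) := by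
        rw [norm_smul, Real.norm_of_nonneg hR.le, mul_pow, Real.sq_sqrt h0.le]; ring
      unfold ballDensity
      have hiff : s ^ 2 + ‖Real.sqrt (1 - s ^ 2) • y‖ ^ 2 ≤ 1 ↔ ‖y‖ ^ 2 ≤ 1 := by
        rw [← sub_nonneg, e, mul_nonneg_iff_of_pos_left h0, sub_nonneg]
      simp only [hiff]
      split_ifs with hy
      · rw [e, Real.mul_rpow h0.le (by linarith), ← ENNReal.ofReal_mul (by positivity)]
        congr 1; ring
      · simp
    simp only [hsc]
    rw [lintegral_const_mul _ (by fun_prop)]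
    have hpow : Real.sqrt (1 - s ^ 2) ^ n = (1 - s ^ 2) ^ ((n : ℝ) / 2) := by
      rw [Real.sqrt_eq_rpow, ← Real.rpow_natCast, ← Real.rpow_mul h0.le]
      congr 1; ring
    rw [hpow, ← mul_assoc, ← ENNReal.ofReal_mul (by positivity), ← Real.rpow_add h0, add_comm κ]
    ring

/-- The surface measure is the image of Lebesgue measure on the ball under radial projection. -/
lemma sphereMeasure_eq {d : ℕ} (hd : d ≠ 0) :
    sphereMeasure d = (d : ℝ≥0∞) •
      (volume.restrict (Metric.ball (0 : Space d) 1)).map fun x => ‖x‖⁻¹ • x := by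
  have : NeZero d := ⟨hd⟩
  have hm : Measurable fun x : Space d => ‖x‖⁻¹ • x := by fun_prop
  ext s hs
  rw [sphereMeasure, Measure.map_apply measurable_subtype_coe hs,
    Measure.toSphere_apply' _ (measurable_subtype_coe hs), Measure.smul_apply,
    Measure.map_apply hm hs, Measure.restrict_apply (hm hs), finrank_euclideanSpace_fin, smul_eq_mul]
  congr 1
  refine measure_congr ?_
  have h0 : ∀ᵐ x : Space d, x ≠ 0 := by
    simp [ae_iff, measure_singleton]
  filter_upwards [h0] with x hx
  refine propext ?_
  have hxn : 0 < ‖x‖ := norm_pos_iff.2 hx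
  change x ∈ Set.Ioo (0 : ℝ) 1 • (Subtype.val '' (Subtype.val ⁻¹' s : Set (Metric.sphere (0 : Space d) 1)))
    ↔ x ∈ (fun x => ‖x‖⁻¹ • x) ⁻¹' s ∩ Metric.ball 0 1
  rw [Set.mem_smul]
  constructor
  · rintro ⟨r, hr, _, ⟨y, hy, rfl⟩, rfl⟩
    have hy1 : ‖(y : Space d)‖ = 1 := by simp
    have hr1 : ‖r • (y : Space d)‖ = r := by
      rw [norm_smul, hy1, mul_one, Real.norm_of_nonneg hr.1.le]
    refine ⟨?_, by simpa [hr1] using hr.2⟩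
    rw [Set.mem_preimage, hr1, inv_smul_smul₀ hr.1.ne']
    exact hy
  · rintro ⟨hxs, hxb⟩
    refine ⟨‖x‖, ⟨hxn, by simpa using hxb⟩, ‖x‖⁻¹ • x, ⟨⟨‖x‖⁻¹ • x, ?_⟩, hxs, rfl⟩,
      smul_inv_smul₀ hxn.ne' x⟩
    simp [norm_smul, hxn.ne']

lemma hasDerivAt_div_sqrt (p : ℝ) :
    HasDerivAt (fun p : ℝ => p / Real.sqrt (1 + p ^ 2)) ((1 + p ^ 2) ^ (-(3 : ℝ) / 2)) p := by
  have h0 : 0 < 1 + p ^ 2 := by positivity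
  have hs : 0 < Real.sqrt (1 + p ^ 2) := Real.sqrt_pos.2 h0
  have h1 : HasDerivAt (fun p : ℝ => 1 + p ^ 2) (2 * p) p := by
    simpa using (hasDerivAt_pow 2 p).const_add 1
  have h2 := (hasDerivAt_id p).div (h1.sqrt h0.ne') hs.ne'
  refine h2.congr_deriv ?_
  have e : (1 + p ^ 2) ^ (-(3 : ℝ) / 2) = (Real.sqrt (1 + p ^ 2) ^ 3)⁻¹ := by
    rw [Real.sqrt_eq_rpow, ← Real.rpow_natCast _ 3, ← Real.rpow_mul h0.le, ← Real.rpow_neg h0.le]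
    congr 1; norm_num
  rw [e]
  simp only [id]
  have hsq : Real.sqrt (1 + p ^ 2) ^ 2 = 1 + p ^ 2 := Real.sq_sqrt h0.le
  field_simp
  rw [hsq]; ring

/-- The substitution `s = p / √(1 + p²)`: `p` is the slope of a ray and `s` the height at which it
meets the unit sphere. -/
lemma lintegral_div_sqrt (G : ℝ → ℝ≥0∞) :
    ∫⁻ s in Set.Ioo (-1) 1, G s
      = ∫⁻ p : ℝ, ENNReal.ofReal ((1 + p ^ 2) ^ (-(3 : ℝ) / 2)) * G (p / Real.sqrt (1 + p ^ 2)) := by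
  have himg : (fun p : ℝ => p / Real.sqrt (1 + p ^ 2)) '' Set.univ = Set.Ioo (-1) 1 := by
    ext s
    simp only [Set.image_univ, Set.mem_range, Set.mem_Ioo]
    constructor
    · rintro ⟨p, rfl⟩
      have h0 : 0 < 1 + p ^ 2 := by positivity
      have hs : 0 < Real.sqrt (1 + p ^ 2) := Real.sqrt_pos.2 h0
      have habs : |p| < Real.sqrt (1 + p ^ 2) := by
        rw [← Real.sqrt_sq_eq_abs]
        exact Real.sqrt_lt_sqrt (sq_nonneg p) (by linarith)
      rw [← abs_lt, abs_div, abs_of_pos hs, div_lt_one hs]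
      exact habs
    · rintro ⟨h1, h2⟩
      have h0 : 0 < 1 - s ^ 2 := by nlinarith
      have hs : 0 < Real.sqrt (1 - s ^ 2) := Real.sqrt_pos.2 h0
      refine ⟨s / Real.sqrt (1 - s ^ 2), ?_⟩
      have e : 1 + (s / Real.sqrt (1 - s ^ 2)) ^ 2 = (Real.sqrt (1 - s ^ 2) ^ 2)⁻¹ := by
        rw [div_pow, Real.sq_sqrt h0.le]; field_simp; ring
      rw [e, Real.sqrt_inv, Real.sqrt_sq hs.le]
      field_simp
  have hmono : StrictMono fun p : ℝ => p / Real.sqrt (1 + p ^ 2) :=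
    strictMono_of_deriv_pos fun p => by
      rw [(hasDerivAt_div_sqrt p).deriv]
      positivity
  rw [← himg, lintegral_image_eq_lintegral_abs_deriv_mul MeasurableSet.univ
    (fun p _ => (hasDerivAt_div_sqrt p).hasDerivWithinAt) hmono.injective.injOn]
  rw [Measure.restrict_univ]
  refine lintegral_congr fun p => ?_
  rw [abs_of_nonneg (by positivity)]

lemma lintegral_real_eq_mul_comp_mul (f : ℝ → ℝ≥0∞) {R : ℝ} (hR : 0 < R) :
    ∫⁻ s, f s = ENNReal.ofReal R * ∫⁻ p, f (R * p) := by
  have h := lintegral_comp_smul_eq (volume : Measure ℝ) f hR.ne'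
  simp only [smul_eq_mul, Module.finrank_self, pow_one] at h
  rw [h, ← mul_assoc, ← ENNReal.ofReal_mul hR.le, abs_of_pos (by positivity), mul_inv_cancel₀ hR.ne']
  simp

/-- Write `x = s ω + y` and substitute `s = |y| p`: the projected height `p / √(1 + p²)` then no
longer depends on `y`. Integrating `|y|` over the ball of radius `(1 + p²)^(-1/2)` gives `(1 +
p²)^(-(n+1)/2)`, which is the Jacobian `(1 + p²)^(-3/2)` of `lintegral_div_sqrt` times `(1 - s²)^(-1
+ n/2)`. -/
lemma lintegral_ball_radial {n : ℕ} (hn : n ≠ 0) {ω : Space (n + 1)} (hω : ‖ω‖ = 1)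
    {g : ℝ → ℝ≥0∞} (hg : Measurable g) :
    ∫⁻ x in Metric.ball (0 : Space (n + 1)) 1, g (inner ℝ (‖x‖⁻¹ • x) ω)
      = (∫⁻ y in Metric.ball (0 : Space n) 1, ‖y‖ₑ)
        * ∫⁻ s, g s * ENNReal.ofReal (posPow (1 - s ^ 2) (-1 + n / 2)) := by
  have : NeZero n := ⟨hn⟩
  set ind : ℝ → ℝ≥0∞ := Set.indicator (Set.Iio 1) 1 with hind
  have hindm : Measurable ind := measurable_one.indicator measurableSet_Iio
  have hball : ∀ m (x : Space m), ind (‖x‖ ^ 2) = Set.indicator (Metric.ball 0 1) 1 x := by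
    intro m x
    simp only [hind, Set.indicator, Set.mem_Iio, sq_lt_one_iff₀ (norm_nonneg x), mem_ball_zero_iff]
    rfl
  have h1 : ∫⁻ x in Metric.ball (0 : Space (n + 1)) 1, g (inner ℝ (‖x‖⁻¹ • x) ω)
      = ∫⁻ x : Space (n + 1), ind (‖x‖ ^ 2) * g ((Real.sqrt (‖x‖ ^ 2))⁻¹ * inner ℝ x ω) := by
    rw [← lintegral_indicator Metric.isOpen_ball.measurableSet]
    refine lintegral_congr fun x => ?_
    rw [hball, Real.sqrt_sq (norm_nonneg x)]
    simp only [Set.indicator, real_inner_smul_left]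
    split_ifs <;> simp
  have h2 := lintegral_norm_sq_inner (n := n)
    (F := fun p => ind p.1 * g ((Real.sqrt p.1)⁻¹ * p.2)) (by fun_prop) hω
  rw [h1, h2, lintegral_lintegral_swap (by fun_prop)]
  have hne : ∀ᵐ y : Space n, y ≠ 0 := by simp [ae_iff, measure_singleton]
  have h3 : ∫⁻ y : Space n, ∫⁻ s : ℝ, ind (s ^ 2 + ‖y‖ ^ 2) * g ((Real.sqrt (s ^ 2 + ‖y‖ ^ 2))⁻¹ * s)
      = ∫⁻ y : Space n, ∫⁻ p : ℝ, ‖y‖ₑ * ind ((1 + p ^ 2) * ‖y‖ ^ 2) * g (p / Real.sqrt (1 + p ^ 2)) := by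
    refine lintegral_congr_ae ?_
    filter_upwards [hne] with y hy
    have hyn : 0 < ‖y‖ := norm_pos_iff.2 hy
    rw [lintegral_real_eq_mul_comp_mul _ hyn, ofReal_norm, ← lintegral_const_mul _ (by fun_prop)]
    refine lintegral_congr fun p => ?_
    have e : (‖y‖ * p) ^ 2 + ‖y‖ ^ 2 = (1 + p ^ 2) * ‖y‖ ^ 2 := by ring
    rw [e, Real.sqrt_mul (by positivity), Real.sqrt_sq hyn.le, mul_assoc]
    congr 3
    field_simp
  rw [h3, lintegral_lintegral_swap (by fun_prop)]
  have h4 : ∀ p : ℝ, ∫⁻ y : Space n, ‖y‖ₑ * ind ((1 + p ^ 2) * ‖y‖ ^ 2) * g (p / Real.sqrt (1 + p ^ 2))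
      = (∫⁻ y in Metric.ball (0 : Space n) 1, ‖y‖ₑ) *
        (ENNReal.ofReal ((1 + p ^ 2) ^ (-(3 : ℝ) / 2)) *
          (g (p / Real.sqrt (1 + p ^ 2)) *
            ENNReal.ofReal (posPow (1 - (p / Real.sqrt (1 + p ^ 2)) ^ 2) (-1 + n / 2)))) := by
    intro p
    have h0 : 0 < 1 + p ^ 2 := by positivity
    have hs : 0 < Real.sqrt (1 + p ^ 2) := Real.sqrt_pos.2 h0
    rw [lintegral_mul_const _ (by fun_prop), lintegral_eq_mul_lintegral_comp_smul _ (inv_pos.2 hs)]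
    have hsc : ∀ y : Space n, ‖(Real.sqrt (1 + p ^ 2))⁻¹ • y‖ₑ *
        ind ((1 + p ^ 2) * ‖(Real.sqrt (1 + p ^ 2))⁻¹ • y‖ ^ 2)
        = ENNReal.ofReal ((Real.sqrt (1 + p ^ 2))⁻¹) * Set.indicator (Metric.ball 0 1) (fun y => ‖y‖ₑ) y := by
      intro y
      have e : (1 + p ^ 2) * ‖(Real.sqrt (1 + p ^ 2))⁻¹ • y‖ ^ 2 = ‖y‖ ^ 2 := by
        rw [norm_smul, mul_pow, norm_inv, inv_pow, Real.norm_of_nonneg hs.le, Real.sq_sqrt h0.le]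
        field_simp
      rw [e, hball, enorm_smul, mul_assoc, Real.enorm_of_nonneg (inv_pos.2 hs).le]
      congr 1
      simp only [Set.indicator]
      split_ifs <;> simp
    simp only [hsc]
    rw [lintegral_const_mul _ (measurable_enorm.indicator Metric.isOpen_ball.measurableSet),
      lintegral_indicator Metric.isOpen_ball.measurableSet]
    have e1 : 1 - (p / Real.sqrt (1 + p ^ 2)) ^ 2 = (1 + p ^ 2)⁻¹ := by
      rw [div_pow, Real.sq_sqrt h0.le]; field_simp; ring
    rw [e1, posPow_of_pos (inv_pos.2 h0)]
    have e2 : (Real.sqrt (1 + p ^ 2))⁻¹ ^ n * (Real.sqrt (1 + p ^ 2))⁻¹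
        = (1 + p ^ 2) ^ (-(3 : ℝ) / 2) * ((1 + p ^ 2)⁻¹) ^ (-1 + (n : ℝ) / 2) := by
      rw [← pow_succ, Real.sqrt_eq_rpow, ← Real.rpow_neg h0.le, ← Real.rpow_natCast,
        ← Real.rpow_mul h0.le, Real.inv_rpow h0.le, ← Real.rpow_neg h0.le, ← Real.rpow_add h0]
      congr 1; push_cast; ring
    rw [← mul_assoc, ← ENNReal.ofReal_mul (by positivity), e2, ENNReal.ofReal_mul (by positivity)]
    ring
  simp only [h4]
  have hpm := measurable_posPow (-1 + (n : ℝ) / 2)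
  rw [lintegral_const_mul _ (by fun_prop)]
  congr 1
  rw [← lintegral_div_sqrt fun s => g s * ENNReal.ofReal (posPow (1 - s ^ 2) (-1 + (n : ℝ) / 2)),
    ← lintegral_indicator measurableSet_Ioo]
  refine lintegral_congr fun s => ?_
  simp only [Set.indicator]
  split_ifs with h
  · rfl
  · rw [posPow_of_nonpos]
    · simp
    · rw [Set.mem_Ioo, ← abs_lt, not_lt] at h
      nlinarith [sq_abs s]

instance isFiniteMeasure_velocityMeasure (d : ℕ) [NeZero d] (κ : ℝ) [hκ : Fact (-1 ≤ κ ∧ κ ≤ 0)] :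
    IsFiniteMeasure (velocityMeasure d κ) := by
  by_cases h : κ = -1
  · rw [velocityMeasure, if_pos h, sphereMeasure_eq (NeZero.ne d)]
    refine ⟨?_⟩
    rw [Measure.smul_apply, Measure.smul_apply, Measure.map_apply (by fun_prop) MeasurableSet.univ]
    simp only [Set.preimage_univ, Measure.restrict_apply_univ, smul_eq_mul]
    exact ENNReal.mul_lt_top (by simp) (ENNReal.mul_lt_top (by simp) measure_ball_lt_top)
  · rw [velocityMeasure_eq h]
    exact isFiniteMeasure_withDensity (lintegral_ballDensity_lt_top (NeZero.ne d)
      (lt_of_le_of_ne hκ.out.1 (Ne.symm h)) hκ.out.2).ne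

/-- The sphere and the ball densities have marginals given by a single formula, with a constant
independent of `ω`; from here on the marginal of the endpoint `κ = -1` needs no separate treatment.
-/
lemma exists_lintegral_inner_velocityMeasure {d : ℕ} (hd : 2 ≤ d) {κ : ℝ} (hκ : -1 ≤ κ)
    (hκ0 : κ ≤ 0) :
    ∃ c : ℝ, 0 < c ∧ ∀ ω : Space d, ‖ω‖ = 1 → ∀ g : ℝ → ℝ≥0∞, Measurable g →
      ∫⁻ v, g (inner ℝ v ω) ∂(velocityMeasure d κ)
        = ENNReal.ofReal c * ∫⁻ s, g s * ENNReal.ofReal (posPow (1 - s ^ 2) (κ + (d - 1) / 2)) := by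
  obtain ⟨n, rfl⟩ : ∃ n, d = n + 1 := ⟨d - 1, by omega⟩
  have hn : n ≠ 0 := by omega
  have : NeZero n := ⟨hn⟩
  have hcast : ((n + 1 : ℕ) : ℝ) - 1 = n := by push_cast; ring
  rw [hcast]
  by_cases h : κ = -1
  · set c := ∫⁻ y in Metric.ball (0 : Space n) 1, ‖y‖ₑ with hc
    have hcfin : c ≠ ∞ := by
      refine ((setLIntegral_mono (g := fun _ => 1) measurable_const fun y hy => ?_).trans_lt ?_).ne
      · rw [← ofReal_norm, ENNReal.ofReal_le_one]
        exact (by simpa using hy : ‖y‖ < 1).le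
      · simpa using measure_ball_lt_top
    have hcpos : c ≠ 0 := by
      rw [hc, ← lintegral_indicator Metric.isOpen_ball.measurableSet, Ne, lintegral_eq_zero_iff
        (measurable_enorm.indicator Metric.isOpen_ball.measurableSet)]
      intro h0
      have hpos := Metric.measure_ball_pos volume (0 : Space n) one_pos
      have hne : ∀ᵐ y : Space n, y ≠ 0 := by simp [ae_iff, measure_singleton]
      have : ∀ᵐ y : Space n, y ∉ Metric.ball (0 : Space n) 1 := by
        filter_upwards [h0, hne] with y hy hy0 hyb
        rw [Set.indicator_of_mem hyb] at hy
        simp [hy0] at hy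
      rw [← compl_mem_ae_iff.1 (show (Metric.ball (0 : Space n) 1)ᶜ ∈ ae volume from this)] at hpos
      exact lt_irrefl _ hpos
    -- The factor `2⁻¹` is the normalisation of the velocity measure at `κ = -1`, and `n + 1` is the
    -- dimension factor in `sphereMeasure_eq`.
    refine ⟨(2⁻¹ * (n + 1) * c).toReal, ?_, fun ω hω g hg => ?_⟩
    · refine ENNReal.toReal_pos (mul_ne_zero (mul_ne_zero (by simp) (by simp)) hcpos) ?_
      exact ENNReal.mul_ne_top (ENNReal.mul_ne_top (by simp) (by finiteness)) hcfin
    · rw [ENNReal.ofReal_toReal (ENNReal.mul_ne_top (ENNReal.mul_ne_top (by simp) (by finiteness)) hcfin),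
        velocityMeasure, if_pos h, sphereMeasure_eq (by omega), lintegral_smul_measure,
        lintegral_smul_measure, lintegral_map (by fun_prop) (by fun_prop),
        lintegral_ball_radial hn hω hg, h]
      simp only [smul_eq_mul]
      push_cast
      ring
  · have hκ1 : -1 < κ := lt_of_le_of_ne hκ (Ne.symm h)
    have hfin := lintegral_ballDensity_lt_top hn hκ1 hκ0
    refine ⟨(∫⁻ y : Space n, ballDensity κ (‖y‖ ^ 2)).toReal,
      ENNReal.toReal_pos (lintegral_ballDensity_pos hκ1).ne' hfin.ne, fun ω hω g hg => ?_⟩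
    rw [ENNReal.ofReal_toReal hfin.ne, lintegral_inner_velocityMeasure_of_gt hκ1 hω hg]

/-- The density on space-time of the joint law of `(ξ, -v · ξ)`, up to a constant. -/
def coneWeight (d : ℕ) (κ : ℝ) (ζ : Space d × ℝ) : ℝ :=
  ‖ζ.1‖⁻¹ * posPow (1 - ζ.2 ^ 2 / ‖ζ.1‖ ^ 2) (κ + (d - 1) / 2)

lemma measurable_coneWeight (d : ℕ) (κ : ℝ) : Measurable (coneWeight d κ) := by
  have := measurable_posPow (κ + (d - 1) / 2)
  unfold coneWeight
  fun_prop

lemma coneWeight_nonneg (d : ℕ) (κ : ℝ) (ζ : Space d × ℝ) : 0 ≤ coneWeight d κ ζ :=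
  mul_nonneg (by positivity) (posPow_nonneg _ _)

/-- For fixed `ξ ≠ 0` take the marginal in the direction `-ξ / |ξ|` and substitute `τ = |ξ| s`; the
Jacobian is the factor `|ξ|⁻¹` of the weight. -/
lemma exists_lintegral_coneWeight {d : ℕ} (hd : 2 ≤ d) {κ : ℝ} (hκ : -1 ≤ κ) (hκ0 : κ ≤ 0) :
    ∃ c : ℝ, 0 < c ∧ ∀ h : Space d × ℝ → ℝ≥0∞, Measurable h →
      ∫⁻ ξ : Space d, ∫⁻ v, h (ξ, -inner ℝ v ξ) ∂(velocityMeasure d κ)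
        = ENNReal.ofReal c * ∫⁻ ζ, h ζ * ENNReal.ofReal (coneWeight d κ ζ) := by
  obtain ⟨c, hc, H⟩ := exists_lintegral_inner_velocityMeasure hd hκ hκ0
  refine ⟨c, hc, fun h hh => ?_⟩
  have hw := measurable_coneWeight d κ
  have hp := measurable_posPow (κ + ((d : ℝ) - 1) / 2)
  rw [Measure.volume_eq_prod, lintegral_prod _ (by fun_prop), ← lintegral_const_mul _
    (Measurable.lintegral_prod_right' (f := fun ζ : Space d × ℝ => h ζ * ENNReal.ofReal (coneWeight d κ ζ))
      (by fun_prop))]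
  have : NeZero d := ⟨by omega⟩
  have hne : ∀ᵐ ξ : Space d, ξ ≠ 0 := by simp [ae_iff, measure_singleton]
  refine lintegral_congr_ae ?_
  filter_upwards [hne] with ξ hξ
  have hξn : 0 < ‖ξ‖ := norm_pos_iff.2 hξ
  have h1 := H (-(‖ξ‖⁻¹ • ξ)) (by rw [norm_neg, norm_smul, norm_inv, norm_norm, inv_mul_cancel₀ hξn.ne'])
    (fun s => h (ξ, ‖ξ‖ * s)) (by fun_prop)
  have e1 : ∀ v : Space d, ‖ξ‖ * inner ℝ v (-(‖ξ‖⁻¹ • ξ)) = -inner ℝ v ξ := fun v => by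
    rw [inner_neg_right, real_inner_smul_right]; field_simp
  simp only [e1] at h1
  rw [h1]
  congr 1
  rw [lintegral_real_eq_mul_comp_mul (fun τ => h (ξ, τ) * ENNReal.ofReal (coneWeight d κ (ξ, τ))) hξn,
    ← lintegral_const_mul _ (by fun_prop)]
  refine lintegral_congr fun s => ?_
  rw [mul_left_comm, ← ENNReal.ofReal_mul hξn.le]
  congr 2
  unfold coneWeight
  simp only
  rw [mul_inv_cancel_left₀ hξn.ne', mul_pow, mul_div_cancel_left₀ _ (by positivity)]

end

section

open FourierTransform

/-! ### The Fourier transform of velocity averages -/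

lemma velocityMeasure_ae_norm_le {d : ℕ} (hd : d ≠ 0) (κ : ℝ) :
    ∀ᵐ v ∂(velocityMeasure d κ), ‖v‖ ≤ 1 := by
  by_cases h : κ = -1
  · rw [velocityMeasure, if_pos h, sphereMeasure_eq hd]
    refine Measure.ae_smul_measure (Measure.ae_smul_measure ?_ _) _
    rw [ae_map_iff (by fun_prop) (measurableSet_le measurable_norm measurable_const)]
    refine .of_forall fun x => ?_
    rw [norm_smul, norm_inv, norm_norm]
    exact inv_mul_le_one
  · rw [velocityMeasure_eq h, ae_withDensity_iff (by have := measurable_ballDensity κ; fun_prop)]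
    refine .of_forall fun x hx => ?_
    by_contra hc
    apply hx
    rw [ballDensity, if_neg]
    rwa [sq_le_one_iff₀ (norm_nonneg x)]

section Shear
variable {d : ℕ}

/-- The change of variables `((x, t), v) ↦ ((x - t v, v), t)`. -/
def transport (p : (Space d × ℝ) × Space d) : (Space d × Space d) × ℝ :=
  ((p.1.1 - p.1.2 • p.2, p.2), p.1.2)

lemma continuous_transport : Continuous (transport (d := d)) := by
  unfold transport; fun_prop

lemma measurePreserving_transport (μ : Measure (Space d)) [SFinite μ] :
    MeasurePreserving (transport (d := d)) ((volume : Measure (Space d × ℝ)).prod μ)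
      (((volume : Measure (Space d)).prod μ).prod volume) := by
  refine ⟨continuous_transport.measurable, Measure.ext_of_lintegral _ fun F hF => ?_⟩
  have hm : Measurable fun p : (Space d × ℝ) × Space d => F (transport p) :=
    hF.comp continuous_transport.measurable
  rw [lintegral_map hF continuous_transport.measurable, lintegral_prod_symm _ hm.aemeasurable,
    lintegral_prod_symm _ hF.aemeasurable]
  have h1 : ∀ v, ∫⁻ z : Space d × ℝ, F (transport (z, v)) = ∫⁻ t : ℝ, ∫⁻ x : Space d, F ((x, v), t) := by
    intro v
    have hv : Measurable fun z : Space d × ℝ => F (transport (z, v)) :=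
      hm.comp (measurable_id.prodMk measurable_const)
    rw [Measure.volume_eq_prod, lintegral_prod_symm _ hv.aemeasurable]
    refine lintegral_congr fun t => ?_
    exact lintegral_sub_right_eq_self (fun x => F ((x, v), t)) (t • v)
  have h2 : ∀ t, ∫⁻ y, F (y, t) ∂((volume : Measure (Space d)).prod μ)
      = ∫⁻ v, ∫⁻ x : Space d, F ((x, v), t) ∂volume ∂μ := fun t =>
    lintegral_prod_symm _ (by fun_prop)
  simp only [h1, h2]
  refine lintegral_lintegral_swap ?_
  have : Measurable fun q : (Space d × ℝ) × Space d => F ((q.2, q.1.1), q.1.2) := by fun_prop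
  exact (this.lintegral_prod_right').aemeasurable

lemma transport_injective : Function.Injective (transport (d := d)) := by
  rintro ⟨⟨x, t⟩, v⟩ ⟨⟨x', t'⟩, v'⟩ h
  simp only [transport, Prod.mk.injEq] at h
  obtain ⟨⟨h1, rfl⟩, rfl⟩ := h
  simpa using h1

lemma measurableEmbedding_transport : MeasurableEmbedding (transport (d := d)) :=
  continuous_transport.measurable.measurableEmbedding transport_injective

lemma one_add_norm_le_two_mul {y v : Space d} (hv : ‖v‖ ≤ 1) (t : ℝ) :
    1 + ‖y‖ ≤ 2 * (1 + ‖((y + t • v, t) : Space d × ℝ)‖) := by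
  have h1 : ‖y + t • v‖ ≤ ‖((y + t • v, t) : Space d × ℝ)‖ := norm_fst_le (y + t • v, t)
  have h2 : ‖t‖ ≤ ‖((y + t • v, t) : Space d × ℝ)‖ := norm_snd_le (y + t • v, t)
  have h3 : ‖y‖ ≤ ‖y + t • v‖ + ‖t‖ := by
    calc ‖y‖ = ‖(y + t • v) - t • v‖ := by simp
      _ ≤ ‖y + t • v‖ + ‖t • v‖ := norm_sub_le _ _
      _ ≤ _ := by
        gcongr
        rw [norm_smul]
        exact mul_le_of_le_one_right (norm_nonneg _) hv
  linarith

lemma one_add_abs_le (y v : Space d) (t : ℝ) :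
    1 + ‖t‖ ≤ 1 + ‖((y + t • v, t) : Space d × ℝ)‖ := by
  gcongr; exact norm_snd_le (y + t • v, t)

/-- For `|v| ≤ 1` a point on the ray controls both `|y|` and `|t|`. Of the `M + 2` powers of decay,
`M` are spent on `y` and two on `t`, which suffices for integrability in time. -/
lemma inv_one_add_pow_le {y v : Space d} (hv : ‖v‖ ≤ 1) (t : ℝ) (M : ℕ) :
    ((1 + ‖((y + t • v, t) : Space d × ℝ)‖) ^ (M + 2))⁻¹
      ≤ 2 ^ M * ((1 + ‖y‖) ^ M)⁻¹ * ((1 + ‖t‖) ^ 2)⁻¹ := by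
  have h1 := one_add_norm_le_two_mul (y := y) hv t
  have h2 := one_add_abs_le y v t
  set Z := 1 + ‖((y + t • v, t) : Space d × ℝ)‖ with hZ
  have hZ0 : 0 < Z := by positivity
  rw [show (2 : ℝ) ^ M * ((1 + ‖y‖) ^ M)⁻¹ = (((1 + ‖y‖) / 2) ^ M)⁻¹ by
    rw [div_pow, inv_div]; rfl, ← mul_inv, pow_add]
  gcongr
  linarith

lemma integrable_inv_one_add_sq : Integrable fun t : ℝ => ((1 + ‖t‖) ^ 2)⁻¹ := by
  have h := integrable_one_add_norm (E := ℝ) (μ := volume) (r := 2) (by simp)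
  refine h.congr (.of_forall fun t => ?_)
  simp only
  rw [Real.rpow_neg (by positivity), Real.rpow_two]

variable {μ : Measure (Space d)} [IsFiniteMeasure μ]

lemma integrable_inv_one_add_pow_space {N : ℕ} (hN : d < N) :
    Integrable fun y : Space d => ((1 + ‖y‖) ^ N)⁻¹ := by
  have h := integrable_one_add_norm (E := Space d) (μ := volume) (r := N) (by simpa using hN)
  refine h.congr (.of_forall fun z => ?_)
  simp [Real.rpow_neg (by positivity : 0 ≤ 1 + ‖z‖)]

/-- Cauchy-Schwarz; the weight does not decay in the velocity, and is square integrable because `μ`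
is finite. -/
lemma integrable_mul_inv_one_add_pow {f : Space d × Space d → ℂ}
    (hf : MemLp f 2 ((volume : Measure (Space d)).prod μ)) :
    Integrable (fun p => ‖f p‖ * ((1 + ‖p.1‖) ^ (d + 1))⁻¹) ((volume : Measure (Space d)).prod μ) := by
  have hc : Continuous fun p : Space d × Space d => ((1 + ‖p.1‖) ^ (d + 1))⁻¹ :=
    Continuous.inv₀ (by fun_prop) fun z => by positivity
  have hw : MemLp (fun p : Space d × Space d => ((1 + ‖p.1‖) ^ (d + 1))⁻¹) 2
      ((volume : Measure (Space d)).prod μ) := by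
    rw [memLp_two_iff_integrable_sq hc.aestronglyMeasurable]
    have := (integrable_inv_one_add_pow_space (d := d) (N := (d + 1) * 2) (by omega)).mul_prod
      (integrable_const (μ := μ) (1 : ℝ))
    refine this.congr (.of_forall fun p => ?_)
    simp [pow_mul]
  exact memLp_one_iff_integrable.1 (hw.smul hf.norm)

lemma integrable_transported (hμ : ∀ᵐ v ∂μ, ‖v‖ ≤ 1) {f : Space d × Space d → ℂ}
    (hf : MemLp f 2 ((volume : Measure (Space d)).prod μ)) {h : Space d × ℝ → ℂ}
    (hh : Continuous h) {C : ℝ} (hC : 0 ≤ C)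
    (hhC : ∀ z, ‖h z‖ ≤ C * ((1 + ‖z‖) ^ (d + 1 + 2))⁻¹) :
    Integrable (fun q : (Space d × Space d) × ℝ => f q.1 * h (q.1.1 + q.2 • q.1.2, q.2))
      (((volume : Measure (Space d)).prod μ).prod volume) := by
  have hdom := ((integrable_mul_inv_one_add_pow hf).mul_prod integrable_inv_one_add_sq).const_mul
    (C * 2 ^ (d + 1))
  refine hdom.mono' ?_ ?_
  · exact hf.1.comp_fst.mul (Continuous.aestronglyMeasurable (by fun_prop))
  · have hv : ∀ᵐ q ∂(((volume : Measure (Space d)).prod μ).prod (volume : Measure ℝ)), ‖q.1.2‖ ≤ 1 :=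
      Measure.quasiMeasurePreserving_fst.ae (Measure.quasiMeasurePreserving_snd.ae hμ)
    filter_upwards [hv] with q hq
    rw [norm_mul]
    calc _ ≤ ‖f q.1‖ * (C * (2 ^ (d + 1) * ((1 + ‖q.1.1‖) ^ (d + 1))⁻¹ * ((1 + ‖q.2‖) ^ 2)⁻¹)) := by
          gcongr
          refine (hhC _).trans ?_
          gcongr
          exact inv_one_add_pow_le hq q.2 (d + 1)
      _ = _ := by ring

lemma integrable_average_mul (hμ : ∀ᵐ v ∂μ, ‖v‖ ≤ 1) {f : Space d × Space d → ℂ}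
    (hf : MemLp f 2 ((volume : Measure (Space d)).prod μ)) {h : Space d × ℝ → ℂ}
    (hh : Continuous h) {C : ℝ} (hC : 0 ≤ C)
    (hhC : ∀ z, ‖h z‖ ≤ C * ((1 + ‖z‖) ^ (d + 1 + 2))⁻¹) :
    Integrable (fun p : (Space d × ℝ) × Space d => f (p.1.1 - p.1.2 • p.2, p.2) * h p.1)
      ((volume : Measure (Space d × ℝ)).prod μ) := by
  have := (measurePreserving_transport μ).integrable_comp_emb measurableEmbedding_transport |>.2
    (integrable_transported hμ hf hh hC hhC)
  refine this.congr (.of_forall fun p => ?_)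
  simp [transport]

/-- The average of `f` over velocities distributed according to `μ`. -/
def averageOf (μ : Measure (Space d)) (f : Space d × Space d → ℂ) (z : Space d × ℝ) : ℂ :=
  ∫ v, f (z.1 - z.2 • v, v) ∂μ

/-- The dual transport operator: integration along the line with velocity `v` through `y`. -/
def rayIntegral (h : Space d × ℝ → ℂ) (p : Space d × Space d) : ℂ :=
  ∫ t : ℝ, h (p.1 + t • p.2, t)

/-- The ray integral is the adjoint of averaging: Fubini combined with the measure-preserving change
of variables `transport`. -/
lemma integral_average_mul (hμ : ∀ᵐ v ∂μ, ‖v‖ ≤ 1) {f : Space d × Space d → ℂ}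
    (hf : MemLp f 2 ((volume : Measure (Space d)).prod μ)) {h : Space d × ℝ → ℂ}
    (hh : Continuous h) {C : ℝ} (hC : 0 ≤ C)
    (hhC : ∀ z, ‖h z‖ ≤ C * ((1 + ‖z‖) ^ (d + 1 + 2))⁻¹) :
    ∫ z, averageOf μ f z * h z
      = ∫ p, f p * rayIntegral h p ∂((volume : Measure (Space d)).prod μ) := by
  have h1 := integral_prod _ (integrable_average_mul hμ hf hh hC hhC)
  have h2 := integral_prod _ (integrable_transported hμ hf hh hC hhC)
  simp only [integral_mul_const, integral_const_mul] at h1 h2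
  have h3 := (measurePreserving_transport μ).integral_comp measurableEmbedding_transport
    (fun q : (Space d × Space d) × ℝ => f q.1 * h (q.1.1 + q.2 • q.1.2, q.2))
  refine h1.symm.trans (Eq.trans ?_ h2)
  rw [← h3]
  refine integral_congr_ae (.of_forall fun p => ?_)
  simp [transport]

lemma isTempered_averageOf (hμ : ∀ᵐ v ∂μ, ‖v‖ ≤ 1) {f : Space d × Space d → ℂ}
    (hf : MemLp f 2 ((volume : Measure (Space d)).prod μ)) : IsTempered (averageOf μ f) := by
  have h := integrable_average_mul hμ hf (C := 1)
    (h := fun z => ((((1 + ‖z‖) ^ (d + 1 + 2))⁻¹ : ℝ) : ℂ))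
    (Complex.continuous_ofReal.comp (continuous_inv_one_add_pow _)) zero_le_one (fun z => by
      rw [Complex.norm_real, Real.norm_of_nonneg (by positivity), one_mul])
  refine ⟨d + 1 + 2, h.integral_prod_left.congr (.of_forall fun z => ?_)⟩
  simp only [integral_mul_const]
  rw [Complex.real_smul, mul_comm]
  rfl

/-! ### The ray transform of Fourier transforms -/

lemma norm_fourierInt_le (ψ : SchwartzMap (Space d × ℝ) ℂ) (N : ℕ) :
    ∃ C, 0 ≤ C ∧ ∀ z, ‖fourierInt ψ z‖ ≤ C * ((1 + ‖z‖) ^ N)⁻¹ := by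
  rw [← coe_fourierS]; exact SchwartzMap.exists_norm_le _ N

lemma continuous_fourierInt (ψ : SchwartzMap (Space d × ℝ) ℂ) : Continuous (fourierInt ψ) := by
  rw [← coe_fourierS]; exact (fourierS d ψ).continuous

lemma integrable_ray (ψ : SchwartzMap (Space d × ℝ) ℂ) (y v : Space d) :
    Integrable fun t : ℝ => fourierInt ψ (y + t • v, t) := by
  obtain ⟨C, hC, h⟩ := norm_fourierInt_le ψ 2
  refine (integrable_inv_one_add_sq.const_mul C).mono' ?_ (.of_forall fun t => ?_)
  · exact ((continuous_fourierInt ψ).comp (by fun_prop)).aestronglyMeasurable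
  · refine (h _).trans ?_
    gcongr
    exact norm_snd_le (y + t • v, t)

/-- The shear `(ξ, τ) ↦ (ξ, τ - v · ξ)`. -/
def shear (v : Space d) : (Space d × ℝ) ≃L[ℝ] Space d × ℝ :=
  ContinuousLinearEquiv.equivOfInverse
    ((ContinuousLinearMap.fst ℝ (Space d) ℝ).prod
      (ContinuousLinearMap.snd ℝ (Space d) ℝ - (innerSL ℝ v).comp (ContinuousLinearMap.fst ℝ (Space d) ℝ)))
    ((ContinuousLinearMap.fst ℝ (Space d) ℝ).prod
      (ContinuousLinearMap.snd ℝ (Space d) ℝ + (innerSL ℝ v).comp (ContinuousLinearMap.fst ℝ (Space d) ℝ)))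
    (fun x => by simp) (fun x => by simp)

lemma shear_apply (v : Space d) (z : Space d × ℝ) : shear v z = (z.1, z.2 - inner ℝ v z.1) := rfl

lemma lintegral_comp_shear (v : Space d) {F : Space d × ℝ → ℝ≥0∞} (hF : Measurable F) :
    ∫⁻ z, F (shear v z) = ∫⁻ z, F z := by
  have hm : Measurable fun z => F (shear v z) := hF.comp (shear v).continuous.measurable
  rw [Measure.volume_eq_prod, lintegral_prod _ hm.aemeasurable, lintegral_prod _ hF.aemeasurable]
  refine lintegral_congr fun x => ?_
  exact lintegral_sub_right_eq_self (fun t => F (x, t)) (inner ℝ v x)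

lemma measurePreserving_shear (v : Space d) : MeasurePreserving (shear v) volume volume := by
  refine ⟨(shear v).continuous.measurable, Measure.ext_of_lintegral _ fun F hF => ?_⟩
  rw [lintegral_map hF (shear v).continuous.measurable, lintegral_comp_shear v hF]

/-- The adjoint of the frequency shear straightens rays of velocity `v` to rays of velocity `0`,
which reduces the ray integral to integration in time alone. -/
lemma fourierInt_comp_shear (ψ : Space d × ℝ → ℂ) (v y : Space d) (t : ℝ) :
    fourierInt (fun z => ψ (shear v z)) (y, t) = fourierInt ψ (y + t • v, t) := by
  have h := (measurePreserving_shear v).integral_comp (shear v).toHomeomorph.measurableEmbedding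
    fun z => ψ z * Complex.exp (-(Complex.I *
      ((inner ℝ z.1 (y + t • v) + z.2 * t : ℝ) : ℂ)))
  refine Eq.trans ?_ h
  refine integral_congr_ae (.of_forall fun z => ?_)
  simp only [shear_apply]
  congr 4
  rw [inner_add_right, real_inner_smul_right, real_inner_comm v]
  ring_nf

/-- Restriction of a Schwartz function to the hyperplane `τ = -v · ξ`. -/
def hyperplaneRestrict (v : Space d) : SchwartzMap (Space d × ℝ) ℂ →L[ℂ] SchwartzMap (Space d) ℂ :=
  SchwartzMap.compCLM ℂ
    (g := ((ContinuousLinearMap.id ℝ (Space d)).prod (-(innerSL ℝ v))))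
    (ContinuousLinearMap.hasTemperateGrowth _)
    ⟨1, 1, fun x => by
      have : ‖x‖ ≤ ‖((ContinuousLinearMap.id ℝ (Space d)).prod (-(innerSL ℝ v))) x‖ :=
        norm_fst_le (((ContinuousLinearMap.id ℝ (Space d)).prod (-(innerSL ℝ v))) x)
      simp only [pow_one, one_mul]
      linarith⟩

lemma hyperplaneRestrict_apply (v : Space d) (ψ : SchwartzMap (Space d × ℝ) ℂ) (ξ : Space d) :
    hyperplaneRestrict v ψ ξ = ψ (ξ, -inner ℝ v ξ) := rfl

/-- Integrating a transform over time is one-dimensional Fourier inversion evaluated at `τ = 0`,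
applied to `h`, the partial transform of `χ` in `ξ` at the fixed point `y`. The `2π` comes from the
normalisation of `𝓕`. -/
lemma integral_fourierInt_time (χ : SchwartzMap (Space d × ℝ) ℂ) (y : Space d) :
    ∫ t : ℝ, fourierInt χ (y, t)
      = 2 * Real.pi * (𝓕 (fun ξ : Space d => χ (ξ, 0)) ((2 * Real.pi)⁻¹ • y)) := by
  set e : Space d → ℂ := fun ξ => Complex.exp (-(Complex.I * ((inner ℝ ξ y : ℝ) : ℂ))) with he
  have hec : Continuous e := by fun_prop
  have hen : ∀ ξ, ‖e ξ‖ = 1 := fun ξ => by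
    rw [he]; simp only
    rw [← mul_neg, ← Complex.ofReal_neg, norm_exp_I_mul_ofReal]
  set h : ℝ → ℂ := fun τ => ∫ ξ : Space d, χ (ξ, τ) * e ξ with hh
  have hχint : Integrable (fun z : Space d × ℝ => χ z * e z.1) :=
    χ.integrable.mul_bdd (c := 1) (hec.comp continuous_fst).aestronglyMeasurable
      (.of_forall fun z => (hen _).le)
  have hcont : Continuous h := by
    obtain ⟨C, hC, hχ⟩ := SchwartzMap.exists_norm_le χ (d + 1)
    refine continuous_of_dominated (bound := fun ξ => C * ((1 + ‖ξ‖) ^ (d + 1))⁻¹) (fun τ => ?_)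
      (fun τ => .of_forall fun ξ => ?_)
      ((integrable_inv_one_add_pow_space (by omega)).const_mul C) (.of_forall fun ξ => ?_)
    · exact ((χ.continuous.comp (by fun_prop)).mul hec).aestronglyMeasurable
    · rw [norm_mul, hen, mul_one]
      refine (hχ _).trans ?_
      gcongr
      exact norm_fst_le (ξ, τ)
    · exact (χ.continuous.comp (by fun_prop)).mul continuous_const
  have hint : Integrable h := by
    have := hχint
    rw [Measure.volume_eq_prod] at this
    exact this.integral_prod_right
  have hF : ∀ s : ℝ, 𝓕 h s = fourierInt χ (y, 2 * Real.pi * s) := by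
    intro s
    rw [Real.fourier_eq', fourierInt]
    have hint2 : Integrable (fun z : Space d × ℝ => χ z *
        Complex.exp (-(Complex.I * ((inner ℝ z.1 y + z.2 * (2 * Real.pi * s) : ℝ) : ℂ))))
        ((volume : Measure (Space d)).prod volume) := by
      rw [← Measure.volume_eq_prod]
      refine χ.integrable.mul_bdd (c := 1) (Continuous.aestronglyMeasurable (by fun_prop))
        (.of_forall fun z => ?_)
      rw [← mul_neg, ← Complex.ofReal_neg, norm_exp_I_mul_ofReal]
    rw [Measure.volume_eq_prod, integral_prod_symm _ hint2]
    refine integral_congr_ae (.of_forall fun τ => ?_)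
    simp only [hh, smul_eq_mul]
    rw [← integral_const_mul]
    refine integral_congr_ae (.of_forall fun ξ => ?_)
    simp only [he]
    rw [mul_left_comm, ← Complex.exp_add]
    congr 2
    simp
    ring_nf
  have hFint : Integrable (𝓕 h) := by
    have h1 : Integrable fun t : ℝ => fourierInt χ (y, t) := by
      simpa using integrable_ray χ y 0
    have h2 := h1.comp_mul_left' (R := 2 * Real.pi) (by positivity)
    exact h2.congr (.of_forall fun s => (hF s).symm)
  have hinv := congrFun (hcont.fourierInv_fourier_eq hint hFint) 0
  rw [Real.fourierInv_eq'] at hinv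
  simp only [inner_zero_right, mul_zero, Complex.ofReal_zero, zero_mul, Complex.exp_zero, one_smul,
    hF] at hinv
  rw [Measure.integral_comp_mul_left (fun t : ℝ => fourierInt χ (y, t)) (2 * Real.pi)] at hinv
  have hpi : (0 : ℝ) < 2 * Real.pi := by positivity
  rw [abs_of_pos (inv_pos.2 hpi), inv_smul_eq_iff₀ hpi.ne'] at hinv
  rw [hinv, Complex.real_smul, Real.fourier_eq', hh]
  push_cast
  congr 1
  refine integral_congr_ae (.of_forall fun ξ => ?_)
  simp only [he, smul_eq_mul]
  rw [mul_comm, real_inner_smul_right]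
  congr 2
  push_cast
  have : (Real.pi : ℂ) ≠ 0 := by exact_mod_cast Real.pi_ne_zero
  field_simp

lemma rayIntegral_fourierInt (ψ : SchwartzMap (Space d × ℝ) ℂ) (y v : Space d) :
    rayIntegral (fourierInt ψ) (y, v)
      = 2 * Real.pi * (𝓕 (hyperplaneRestrict v ψ) : SchwartzMap (Space d) ℂ) ((2 * Real.pi)⁻¹ • y) := by
  have h := integral_fourierInt_time
    (SchwartzMap.compCLMOfContinuousLinearEquiv ℂ (shear v) ψ) y
  have e : ⇑(SchwartzMap.compCLMOfContinuousLinearEquiv ℂ (shear v) ψ)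
    = fun z : Space d × ℝ => ψ (shear v z) := rfl
  simp only [e, fourierInt_comp_shear] at h
  rw [rayIntegral, SchwartzMap.fourier_coe]
  refine h.trans ?_
  have hfun : (fun ξ => ψ (shear v (ξ, 0))) = ⇑(hyperplaneRestrict v ψ) := by
    funext ξ
    simp [shear_apply, hyperplaneRestrict_apply]
  rw [hfun]

/-- Plancherel on `ℝ^d` for the restriction of `ψ` to the hyperplane. The constant collects `(2π)²`
from the squared factor in `rayIntegral_fourierInt` and `(2π)^d` from the dilation of `y`. -/
lemma lintegral_rayIntegral_fourierInt (ψ : SchwartzMap (Space d × ℝ) ℂ) (v : Space d) :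
    ∫⁻ y, ‖rayIntegral (fourierInt ψ) (y, v)‖ₑ ^ (2 : ℝ)
      = ENNReal.ofReal ((2 * Real.pi) ^ (d + 2)) * ∫⁻ ξ, ‖ψ (ξ, -inner ℝ v ξ)‖ₑ ^ (2 : ℝ) := by
  have hP := eLpNorm_two_fourier (hyperplaneRestrict v ψ)
  rw [eLpNorm_two_eq_lintegral, eLpNorm_two_eq_lintegral] at hP
  replace hP := congrArg (fun x : ℝ≥0∞ => x ^ (2 : ℝ)) hP
  simp only [← ENNReal.rpow_mul] at hP
  norm_num at hP
  have hpi : (0 : ℝ) < 2 * Real.pi := by positivity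
  have h1 : ∀ y, ‖rayIntegral (fourierInt ψ) (y, v)‖ₑ ^ (2 : ℝ) = ENNReal.ofReal ((2 * Real.pi) ^ 2) *
      ‖(𝓕 (hyperplaneRestrict v ψ) : SchwartzMap (Space d) ℂ) ((2 * Real.pi)⁻¹ • y)‖ₑ ^ (2 : ℝ) := by
    intro y
    rw [rayIntegral_fourierInt, enorm_mul, ENNReal.mul_rpow_of_nonneg _ _ (by norm_num)]
    congr 1
    have : (2 * (Real.pi : ℂ)) = ((2 * Real.pi : ℝ) : ℂ) := by push_cast; ring
    rw [this, ← ofReal_norm, Complex.norm_real, Real.norm_of_nonneg hpi.le, ENNReal.rpow_two,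
      ENNReal.ofReal_pow hpi.le]
  simp only [h1]
  have hm : Measurable fun y : Space d => (𝓕 (hyperplaneRestrict v ψ) : SchwartzMap (Space d) ℂ) y :=
    (SchwartzMap.continuous _).measurable
  rw [lintegral_const_mul _ (by fun_prop), lintegral_comp_smul_eq volume
    (fun y => ‖(𝓕 (hyperplaneRestrict v ψ) : SchwartzMap (Space d) ℂ) y‖ₑ ^ (2 : ℝ))
    (R := (2 * Real.pi)⁻¹) (by positivity), ← mul_assoc, ← ENNReal.ofReal_mul (by positivity)]
  congr 1
  · congr 1
    rw [finrank_euclideanSpace_fin, inv_pow, inv_inv, abs_of_pos (by positivity)]; ring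
  · simpa [hyperplaneRestrict_apply] using hP

lemma stronglyMeasurable_rayIntegral {h : Space d × ℝ → ℂ} (hh : Continuous h) :
    StronglyMeasurable (rayIntegral h) := by
  have : Continuous fun q : (Space d × Space d) × ℝ => h (q.1.1 + q.2 • q.1.2, q.2) := by fun_prop
  exact this.stronglyMeasurable.integral_prod_right'

end Shear

end

/-! ### The velocity average on the Fourier side -/

section Factorisation
variable {d : ℕ} {κ : ℝ}

/-- The square root of the weight `coneWeight`. -/
def sqrtWeight (d : ℕ) (κ : ℝ) (ζ : Space d × ℝ) : ℂ := (Real.sqrt (coneWeight d κ ζ) : ℂ)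

lemma measurable_sqrtWeight (d : ℕ) (κ : ℝ) : Measurable (sqrtWeight d κ) :=
  Complex.measurable_ofReal.comp (measurable_coneWeight d κ).sqrt

lemma enorm_sqrtWeight_rpow (ζ : Space d × ℝ) :
    ‖sqrtWeight d κ ζ‖ₑ ^ (2 : ℝ) = ENNReal.ofReal (coneWeight d κ ζ) := by
  rw [sqrtWeight, ← ofReal_norm, Complex.norm_real, Real.norm_of_nonneg (Real.sqrt_nonneg _),
    ENNReal.ofReal_rpow_of_nonneg (Real.sqrt_nonneg _) (by norm_num), Real.rpow_two,
    Real.sq_sqrt (coneWeight_nonneg _ _ _)]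

/-- The weight may be singular on the light cone and at `ξ = 0`. Its integrability is read off from
`exists_lintegral_coneWeight` backwards: it becomes an integral over `ξ` and `v` of a function
decaying in `ξ`, against a finite velocity measure. -/
lemma memLp_sqrtWeight_mul (hd : 2 ≤ d) (hκ : -1 ≤ κ) (hκ0 : κ ≤ 0) :
    MemLp (fun ζ => sqrtWeight d κ ζ * ((((1 + ‖ζ‖) ^ (d + 1))⁻¹ : ℝ) : ℂ)) 2 volume := by
  have : NeZero d := ⟨by omega⟩
  have : Fact (-1 ≤ κ ∧ κ ≤ 0) := ⟨hκ, hκ0⟩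
  obtain ⟨c, hc, H⟩ := exists_lintegral_coneWeight hd hκ hκ0
  have hm := measurable_sqrtWeight d κ
  refine ⟨(hm.mul (by fun_prop)).aestronglyMeasurable, ?_⟩
  rw [eLpNorm_two_eq_lintegral]
  refine ENNReal.rpow_lt_top_of_nonneg (by norm_num) (ne_of_lt ?_)
  have h1 := H (fun ζ => ENNReal.ofReal (((1 + ‖ζ‖) ^ (d + 1))⁻¹)) (by fun_prop)
  have h2 : ∫⁻ ξ : Space d, ∫⁻ v, ENNReal.ofReal (((1 + ‖(ξ, -inner ℝ v ξ)‖) ^ (d + 1))⁻¹)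
      ∂(velocityMeasure d κ) < ⊤ := by
    calc _ ≤ ∫⁻ ξ : Space d, ∫⁻ _, ENNReal.ofReal (((1 + ‖ξ‖) ^ (d + 1))⁻¹) ∂(velocityMeasure d κ) := by
          gcongr with ξ v
          exact norm_fst_le (ξ, -inner ℝ v ξ)
      _ = (∫⁻ ξ : Space d, ENNReal.ofReal (((1 + ‖ξ‖) ^ (d + 1))⁻¹)) * velocityMeasure d κ Set.univ := by
          simp only [lintegral_const]
          rw [lintegral_mul_const _ (by fun_prop)]
      _ < ⊤ := by
          refine ENNReal.mul_lt_top ?_ (measure_lt_top _ _)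
          have := (integrable_inv_one_add_pow_space (d := d) (N := d + 1) (by omega)).lintegral_lt_top
          exact this
  rw [h1] at h2
  have h3 : ∫⁻ ζ : Space d × ℝ, ENNReal.ofReal (((1 + ‖ζ‖) ^ (d + 1))⁻¹) *
      ENNReal.ofReal (coneWeight d κ ζ) < ⊤ := by
    by_contra hcon
    rw [not_lt_top_iff.1 hcon, ENNReal.mul_top (by simpa using hc)] at h2
    exact absurd h2 (lt_irrefl _)
  refine lt_of_le_of_lt (lintegral_mono fun ζ => ?_) h3
  rw [enorm_mul, ENNReal.mul_rpow_of_nonneg _ _ (by norm_num), enorm_sqrtWeight_rpow, mul_comm]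
  gcongr
  rw [← ofReal_norm, Complex.norm_real, Real.norm_of_nonneg (by positivity),
    ENNReal.ofReal_rpow_of_nonneg (by positivity) (by norm_num), Real.rpow_two]
  -- The square of the decay factor is bounded by its first power, which already suffices.
  refine ENNReal.ofReal_le_ofReal (pow_le_of_le_one (by positivity) ?_ (by norm_num))
  exact inv_le_one_of_one_le₀ (one_le_pow₀ (by linarith [norm_nonneg ζ]))

lemma memLp_sqrtWeight_mul_schwartz (hd : 2 ≤ d) (hκ : -1 ≤ κ) (hκ0 : κ ≤ 0)
    (ψ : SchwartzMap (Space d × ℝ) ℂ) : MemLp (fun ζ => sqrtWeight d κ ζ * ψ ζ) 2 volume := by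
  obtain ⟨C, hC, hψ⟩ := SchwartzMap.exists_norm_le ψ (d + 1)
  refine (memLp_sqrtWeight_mul hd hκ hκ0).of_le_mul (c := C)
    ((measurable_sqrtWeight d κ).aestronglyMeasurable.mul ψ.continuous.aestronglyMeasurable)
    (.of_forall fun ζ => ?_)
  rw [norm_mul, norm_mul, Complex.norm_real, Real.norm_of_nonneg (r := ((1 + ‖ζ‖) ^ (d + 1))⁻¹) (by positivity),
    mul_left_comm]
  gcongr
  exact hψ ζ

lemma isTempered_sqrtWeight_mul (hd : 2 ≤ d) (hκ : -1 ≤ κ) (hκ0 : κ ≤ 0) {G : Space d × ℝ → ℂ}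
    (hG : MemLp G 2 volume) : IsTempered fun ζ => sqrtWeight d κ ζ * G ζ := by
  refine ⟨d + 1, ?_⟩
  have := (memLp_sqrtWeight_mul hd hκ hκ0).integrable_mul hG
  refine this.congr (.of_forall fun ζ => ?_)
  simp only [Complex.real_smul, Pi.mul_apply]
  ring

/-- The `L²` norm of the ray transform of a Fourier transform. -/
lemma exists_eLpNorm_rayIntegral (hd : 2 ≤ d) (hκ : -1 ≤ κ) (hκ0 : κ ≤ 0) :
    ∃ B : ℝ≥0, 0 < B ∧ ∀ ψ : SchwartzMap (Space d × ℝ) ℂ,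
      eLpNorm (rayIntegral (fourierInt ψ)) 2 (volume.prod (velocityMeasure d κ))
        = B * eLpNorm (fun ζ => sqrtWeight d κ ζ * ψ ζ) 2 volume := by
  have : NeZero d := ⟨by omega⟩
  have : Fact (-1 ≤ κ ∧ κ ≤ 0) := ⟨hκ, hκ0⟩
  obtain ⟨c, hc, H⟩ := exists_lintegral_coneWeight hd hκ hκ0
  have hb : 0 < (2 * Real.pi) ^ (d + 2) * c := by positivity
  refine ⟨((2 * Real.pi) ^ (d + 2) * c).toNNReal ^ (1 / 2 : ℝ),
    NNReal.rpow_pos (Real.toNNReal_pos.2 hb), fun ψ => ?_⟩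
  rw [eLpNorm_two_eq_lintegral, eLpNorm_two_eq_lintegral,
    ENNReal.coe_rpow_of_nonneg _ (by norm_num), ← ENNReal.mul_rpow_of_nonneg _ _ (by norm_num)]
  congr 1
  have hR := (stronglyMeasurable_rayIntegral (continuous_fourierInt ψ)).measurable
  have hψ : Measurable ψ := ψ.continuous.measurable
  rw [lintegral_prod_symm _ (by fun_prop)]
  simp only [lintegral_rayIntegral_fourierInt]
  rw [lintegral_const_mul' _ _ ENNReal.ofReal_ne_top, lintegral_lintegral_swap
    (Measurable.aemeasurable (by fun_prop)), H (fun ζ => ‖ψ ζ‖ₑ ^ (2 : ℝ)) (by fun_prop), ← mul_assoc,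
    ← ENNReal.ofReal_mul (by positivity)]
  congr 1
  refine lintegral_congr fun ζ => ?_
  rw [enorm_mul, ENNReal.mul_rpow_of_nonneg _ _ (by norm_num), enorm_sqrtWeight_rpow, mul_comm]

/-- The ray transform of the Fourier transform of a Schwartz function. -/
def rayFourier (d : ℕ) : SchwartzMap (Space d × ℝ) ℂ →ₗ[ℂ] (Space d × Space d → ℂ) where
  toFun ψ := rayIntegral (fourierInt ψ)
  map_add' ψ χ := by
    funext p
    have e : fourierInt (ψ + χ : SchwartzMap (Space d × ℝ) ℂ) = fun z => fourierInt ψ z + fourierInt χ z := by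
      simp only [← coe_fourierS, map_add]; rfl
    simp only [rayIntegral, e, Pi.add_apply]
    exact integral_add (integrable_ray ψ p.1 p.2) (integrable_ray χ p.1 p.2)
  map_smul' c ψ := by
    funext p
    have e : fourierInt (c • ψ : SchwartzMap (Space d × ℝ) ℂ) = fun z => c * fourierInt ψ z := by
      simp only [← coe_fourierS, map_smul]; rfl
    simp only [rayIntegral, e, Pi.smul_apply, RingHom.id_apply, smul_eq_mul, integral_const_mul]

/-- The multiplication operator by `sqrtWeight` on Schwartz functions. -/
def sqrtWeightMul (d : ℕ) (κ : ℝ) : SchwartzMap (Space d × ℝ) ℂ →ₗ[ℂ] (Space d × ℝ → ℂ) where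
  toFun ψ ζ := sqrtWeight d κ ζ * ψ ζ
  map_add' ψ χ := by funext ζ; simp [mul_add]
  map_smul' c ψ := by funext ζ; simp [mul_left_comm]

lemma integral_velocityAverage_mul_fourierInt (hd : 2 ≤ d) (hκ : -1 ≤ κ) (hκ0 : κ ≤ 0)
    {f : Space d × Space d → ℂ} (hf : MemLp f 2 (volume.prod (velocityMeasure d κ)))
    (ψ : SchwartzMap (Space d × ℝ) ℂ) :
    ∫ z, velocityAverage d κ f z * fourierInt ψ z
      = ∫ p, f p * rayFourier d ψ p ∂(volume.prod (velocityMeasure d κ)) := by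
  have : NeZero d := ⟨by omega⟩
  have : Fact (-1 ≤ κ ∧ κ ≤ 0) := ⟨hκ, hκ0⟩
  obtain ⟨C, hC, h⟩ := norm_fourierInt_le ψ (d + 1 + 2)
  exact integral_average_mul (velocityMeasure_ae_norm_le (by omega) κ) hf (continuous_fourierInt ψ) hC h

lemma isTempered_velocityAverage (hd : 2 ≤ d) (hκ : -1 ≤ κ) (hκ0 : κ ≤ 0)
    {f : Space d × Space d → ℂ} (hf : MemLp f 2 (volume.prod (velocityMeasure d κ))) :
    IsTempered (velocityAverage d κ f) := by
  have : NeZero d := ⟨by omega⟩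
  have : Fact (-1 ≤ κ ∧ κ ≤ 0) := ⟨hκ, hκ0⟩
  exact isTempered_averageOf (velocityMeasure_ae_norm_le (by omega) κ) hf

/-- Up to the multiplier `sqrtWeight`, the velocity average is an isomorphism onto `L²` on the
Fourier side. -/
theorem exists_factorisation (hd : 2 ≤ d) (hκ : -1 ≤ κ) (hκ0 : κ ≤ 0) :
    ∃ B : ℝ≥0, 0 < B ∧
      (∀ f, MemLp f 2 (volume.prod (velocityMeasure d κ)) → ∃ G, MemLp G 2 volume ∧
        eLpNorm G 2 volume ≤ B * eLpNorm f 2 (volume.prod (velocityMeasure d κ)) ∧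
        IsFourierTransform (velocityAverage d κ f) fun ζ => sqrtWeight d κ ζ * G ζ) ∧
      (∀ G, MemLp G 2 volume → ∃ f, MemLp f 2 (volume.prod (velocityMeasure d κ)) ∧
        eLpNorm f 2 (volume.prod (velocityMeasure d κ)) ≤ (B⁻¹ : ℝ≥0) * eLpNorm G 2 volume ∧
        IsFourierTransform (velocityAverage d κ f) fun ζ => sqrtWeight d κ ζ * G ζ) := by
  have : NeZero d := ⟨by omega⟩
  have : Fact (-1 ≤ κ ∧ κ ≤ 0) := ⟨hκ, hκ0⟩
  obtain ⟨B, hB, hBψ⟩ := exists_eLpNorm_rayIntegral hd hκ hκ0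
  have hray : ∀ ψ, AEStronglyMeasurable (rayFourier d ψ) (volume.prod (velocityMeasure d κ)) :=
    fun ψ => (stronglyMeasurable_rayIntegral (continuous_fourierInt ψ)).aestronglyMeasurable
  have hrayN : ∀ ψ, eLpNorm (rayFourier d ψ) 2 (volume.prod (velocityMeasure d κ))
      = B * eLpNorm (sqrtWeightMul d κ ψ) 2 volume := hBψ
  have hsq : ∀ ψ, MemLp (sqrtWeightMul d κ ψ) 2 volume :=
    fun ψ => memLp_sqrtWeight_mul_schwartz hd hκ hκ0 ψ
  have hBne : (B : ℝ≥0∞) ≠ 0 := by exact_mod_cast hB.ne'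
  refine ⟨B, hB, fun f hf => ?_, fun G hG => ?_⟩
  · have hT := isTempered_velocityAverage hd hκ hκ0 hf
    -- The pairing of the average with the transform of `ψ` is dominated by the norm of the ray
    -- integral, hence by the `L²` norm of the root weight times `ψ`; the representing function is
    -- `G`.
    obtain ⟨G, hG, hGn, hrep⟩ := exists_memLp_two_representing (ν := volume) (sqrtWeightMul d κ) hsq
      (hT.toLinearMap ∘ₗ (fourierS d).toLinearMap)
      (B * (eLpNorm f 2 (volume.prod (velocityMeasure d κ))).toNNReal) fun ψ => by
        have e : (hT.toLinearMap ∘ₗ (fourierS d).toLinearMap) ψ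
            = ∫ p, f p * rayFourier d ψ p ∂(volume.prod (velocityMeasure d κ)) := by
          rw [← integral_velocityAverage_mul_fourierInt hd hκ hκ0 hf, ← coe_fourierS]; rfl
        rw [e]
        refine (enorm_integral_mul_le hf.1 (hray ψ)).trans_eq ?_
        rw [hrayN, ENNReal.coe_mul, ENNReal.coe_toNNReal hf.2.ne]
        ring
    refine ⟨G, hG, ?_, hT, isTempered_sqrtWeight_mul hd hκ hκ0 hG, fun ψ => ?_⟩
    · rwa [ENNReal.coe_mul, ENNReal.coe_toNNReal hf.2.ne] at hGn
    · rw [← coe_fourierS]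
      refine (hrep ψ).trans (integral_congr_ae (.of_forall fun ζ => ?_))
      simp only [sqrtWeightMul, LinearMap.coe_mk, AddHom.coe_mk]
      ring
  · have hT := isTempered_sqrtWeight_mul hd hκ hκ0 hG
    have e : ∀ ψ, hT.toLinearMap ψ = ∫ ζ, G ζ * sqrtWeightMul d κ ψ ζ := fun ψ => by
      refine integral_congr_ae (.of_forall fun ζ => ?_)
      simp only [sqrtWeightMul, LinearMap.coe_mk, AddHom.coe_mk]
      ring
    -- The converse uses that the norm identity for the ray integral is an equality: the same
    -- pairing is now dominated by the ray integral, with constant `B⁻¹`, and the representing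
    -- function is the datum `f`.
    obtain ⟨f, hf, hfn, hrep⟩ := exists_memLp_two_representing (ν := volume.prod (velocityMeasure d κ))
      (rayFourier d) (fun ψ => ⟨hray ψ, by
        rw [hrayN]; exact ENNReal.mul_lt_top ENNReal.coe_lt_top (hsq ψ).2⟩) hT.toLinearMap
      (B⁻¹ * (eLpNorm G 2 volume).toNNReal) fun ψ => by
        rw [e]
        refine (enorm_integral_mul_le hG.1 (hsq ψ).1).trans_eq ?_
        rw [hrayN, ENNReal.coe_mul, ENNReal.coe_toNNReal hG.2.ne, ENNReal.coe_inv hB.ne', mul_assoc,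
          mul_left_comm _ (B : ℝ≥0∞), ← mul_assoc, ENNReal.inv_mul_cancel hBne (by simp), one_mul]
    refine ⟨f, hf, ?_, isTempered_velocityAverage hd hκ hκ0 hf, hT, fun ψ => ?_⟩
    · rwa [ENNReal.coe_mul, ENNReal.coe_toNNReal hG.2.ne] at hfn
    · rw [integral_velocityAverage_mul_fourierInt hd hκ hκ0 hf]
      exact (hrep ψ).symm

end Factorisation

/-! ### Mixed norms -/

section MixedNorm
variable {d : ℕ} {q r : ℝ}

/-- The `L^r` norm in space at a given time. -/
def sliceNorm (r : ℝ) (u : Space d × ℝ → ℂ) (t : ℝ) : ℝ≥0∞ :=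
  eLpNorm (fun x : Space d => u (x, t)) (ENNReal.ofReal r) volume

lemma sliceNorm_eq (hr : 0 < r) (u : Space d × ℝ → ℂ) (t : ℝ) :
    sliceNorm r u t = (∫⁻ x, ‖u (x, t)‖ₑ ^ r) ^ (1 / r) := by
  rw [sliceNorm, eLpNorm_eq_lintegral_rpow_enorm_toReal (by simpa using hr) (by simp),
    ENNReal.toReal_ofReal hr.le]

lemma mixedNorm_eq (hq : 0 < q) (u : Space d × ℝ → ℂ) :
    mixedNorm q r u = (∫⁻ t, sliceNorm r u t ^ q) ^ (1 / q) := by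
  rw [mixedNorm, eLpNorm_eq_lintegral_rpow_enorm_toReal (by simpa using hq) (by simp),
    ENNReal.toReal_ofReal hq.le]
  rfl

lemma measurable_sliceNorm (hr : 0 < r) {u : Space d × ℝ → ℂ} (hu : Measurable u) :
    Measurable (sliceNorm r u) := by
  have : Measurable fun t => ∫⁻ x, ‖u (x, t)‖ₑ ^ r :=
    Measurable.lintegral_prod_left' (f := fun z : Space d × ℝ => ‖u z‖ₑ ^ r) (by fun_prop)
  rw [show sliceNorm r u = _ from funext fun t => sliceNorm_eq hr u t]
  fun_prop

lemma ae_slice {P : Space d × ℝ → Prop} (h : ∀ᵐ z, P z) : ∀ᵐ t : ℝ, ∀ᵐ x : Space d, P (x, t) := by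
  have h1 : ∀ᵐ z ∂((volume : Measure ℝ).prod (volume : Measure (Space d))), P z.swap :=
    Measure.measurePreserving_swap.quasiMeasurePreserving.ae h
  exact Measure.ae_ae_of_ae_prod h1

lemma sliceNorm_congr_ae {u v : Space d × ℝ → ℂ} (h : u =ᵐ[volume] v) :
    sliceNorm r u =ᵐ[volume] sliceNorm r v :=
  (ae_slice h).mono fun _ ht => eLpNorm_congr_ae ht

lemma mixedNorm_congr_ae {u v : Space d × ℝ → ℂ} (h : u =ᵐ[volume] v) :
    mixedNorm q r u = mixedNorm q r v :=
  eLpNorm_congr_ae (sliceNorm_congr_ae h)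

lemma sliceNorm_const_mul (c : ℂ) (u : Space d × ℝ → ℂ) (t : ℝ) :
    sliceNorm r (fun z => c * u z) t = ‖c‖ₑ * sliceNorm r u t :=
  eLpNorm_const_smul c (fun x => u (x, t)) _ _

lemma mixedNorm_const_mul (hq : 0 < q) (c : ℂ) (u : Space d × ℝ → ℂ) :
    mixedNorm q r (fun z => c * u z) = ‖c‖ₑ * mixedNorm q r u := by
  rw [mixedNorm_eq hq, mixedNorm_eq hq]
  simp only [sliceNorm_const_mul, ENNReal.mul_rpow_of_nonneg _ _ hq.le]
  rw [lintegral_const_mul' _ _ (by finiteness), ENNReal.mul_rpow_of_nonneg _ _ (by positivity),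
    ← ENNReal.rpow_mul, mul_one_div_cancel hq.ne', ENNReal.rpow_one]

lemma sliceNorm_comp_smul (hr : 0 < r) (u : Space d × ℝ → ℂ) {δ : ℝ} (hδ : 0 < δ) (t : ℝ) :
    sliceNorm r (fun z => u (δ • z)) t = ENNReal.ofReal (δ ^ (-(d / r))) * sliceNorm r u (δ * t) := by
  rw [sliceNorm_eq hr, sliceNorm_eq hr]
  have h := lintegral_comp_smul_eq (volume : Measure (Space d)) (fun x => ‖u (x, δ * t)‖ₑ ^ r) hδ.ne'
  have e : ∀ x : Space d, δ • (x, t) = (δ • x, δ * t) := fun x => rfl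
  simp only [e, h]
  rw [ENNReal.mul_rpow_of_nonneg _ _ (by positivity), finrank_euclideanSpace_fin,
    abs_of_pos (by positivity), ENNReal.ofReal_rpow_of_pos (by positivity)]
  congr 2
  rw [← Real.rpow_natCast, ← Real.rpow_neg hδ.le, ← Real.rpow_mul hδ.le]
  congr 1
  ring

lemma mixedNorm_comp_smul (hq : 0 < q) (hr : 0 < r) (u : Space d × ℝ → ℂ) {δ : ℝ} (hδ : 0 < δ) :
    mixedNorm q r (fun z => u (δ • z))
      = ENNReal.ofReal (δ ^ (-(d / r + 1 / q))) * mixedNorm q r u := by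
  rw [mixedNorm_eq hq, mixedNorm_eq hq]
  simp only [sliceNorm_comp_smul hr u hδ, ENNReal.mul_rpow_of_nonneg _ _ hq.le]
  have h := lintegral_comp_smul_eq (volume : Measure ℝ) (fun t => sliceNorm r u t ^ q) hδ.ne'
  simp only [smul_eq_mul, Module.finrank_self, pow_one, abs_of_pos (inv_pos.2 hδ)] at h
  rw [lintegral_const_mul' _ _ (by finiteness), h, ENNReal.mul_rpow_of_nonneg _ _ (by positivity),
    ENNReal.mul_rpow_of_nonneg _ _ (by positivity), ← ENNReal.rpow_mul, mul_one_div_cancel hq.ne',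
    ENNReal.rpow_one, ← mul_assoc, ENNReal.ofReal_rpow_of_pos (by positivity),
    ← ENNReal.ofReal_mul (by positivity)]
  congr 2
  rw [Real.inv_rpow hδ.le, ← Real.rpow_neg hδ.le, ← Real.rpow_add hδ]
  congr 1
  ring

/-- Hölder's inequality against a weight bounded by `1`. -/
lemma lintegral_mul_weight_le {α : Type*} [MeasurableSpace α] {μ : Measure α} {p : ℝ} (hp : 1 < p)
    {g w : α → ℝ≥0∞} (hg : AEMeasurable g μ) (hw : AEMeasurable w μ) (hw1 : ∀ a, w a ≤ 1) :
    ∫⁻ a, g a * w a ∂μ ≤ (∫⁻ a, g a ^ p ∂μ) ^ (1 / p) * (∫⁻ a, w a ∂μ) ^ (1 - 1 / p) := by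
  have hpq := Real.HolderConjugate.conjExponent hp
  refine (ENNReal.lintegral_mul_le_Lp_mul_Lq μ hpq hg hw).trans ?_
  have h1 : 1 / p.conjExponent = 1 - 1 / p := by
    have := hpq.inv_add_inv_eq_one
    simp only [one_div]; linarith
  rw [h1]
  gcongr with a
  · rw [← h1]; exact one_div_nonneg.2 hpq.symm.nonneg
  · calc w a ^ p.conjExponent ≤ w a ^ (1 : ℝ) :=
          ENNReal.rpow_le_rpow_of_exponent_ge (hw1 a) hpq.symm.lt.le
      _ = w a := ENNReal.rpow_one _

/-- The mixed norm controls a weighted `L¹` norm. -/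
lemma exists_lintegral_le_mixedNorm (d : ℕ) (hq : 1 < q) (hr : 1 < r) :
    ∃ C : ℝ≥0, ∀ u : Space d × ℝ → ℂ, AEStronglyMeasurable u volume →
      ∫⁻ z, ‖u z‖ₑ * ENNReal.ofReal (((1 + ‖z‖) ^ (d + 1 + 2))⁻¹) ≤ C * mixedNorm q r u := by
  set a : Space d → ℝ≥0∞ := fun x => ENNReal.ofReal (((1 + ‖x‖) ^ (d + 1))⁻¹) with ha
  set b : ℝ → ℝ≥0∞ := fun t => ENNReal.ofReal (((1 + ‖t‖) ^ 2)⁻¹) with hb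
  have ham : Measurable a := by fun_prop
  have hbm : Measurable b := by fun_prop
  have hle1 : ∀ (y : ℝ) (n : ℕ), 0 ≤ y → ENNReal.ofReal (((1 + y) ^ n)⁻¹) ≤ 1 := fun y n hy => by
    rw [ENNReal.ofReal_le_one]
    exact inv_le_one_of_one_le₀ (one_le_pow₀ (by linarith))
  have ha1 : ∀ x, a x ≤ 1 := fun x => hle1 _ _ (norm_nonneg _)
  have hb1 : ∀ x, b x ≤ 1 := fun x => hle1 _ _ (norm_nonneg _)
  have hai : ∫⁻ x, a x < ⊤ :=
    (integrable_inv_one_add_pow_space (d := d) (N := d + 1) (by omega)).lintegral_lt_top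
  have hbi : ∫⁻ x, b x < ⊤ := integrable_inv_one_add_sq.lintegral_lt_top
  have hr1 : 0 ≤ 1 - 1 / r := by
    rw [sub_nonneg, div_le_one (by linarith)]; exact hr.le
  have hq1 : 0 ≤ 1 - 1 / q := by
    rw [sub_nonneg, div_le_one (by linarith)]; exact hq.le
  set A := (∫⁻ x, a x) ^ (1 - 1 / r) with hA
  set B := (∫⁻ x, b x) ^ (1 - 1 / q) with hB
  have hAt : A ≠ ⊤ := ENNReal.rpow_ne_top_of_nonneg hr1 hai.ne
  have hBt : B ≠ ⊤ := ENNReal.rpow_ne_top_of_nonneg hq1 hbi.ne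
  refine ⟨(A * B).toNNReal, fun u hu => ?_⟩
  rw [ENNReal.coe_toNNReal (ENNReal.mul_ne_top hAt hBt)]
  wlog hum : Measurable u generalizing u
  · have := this (hu.mk u) hu.stronglyMeasurable_mk.aestronglyMeasurable hu.stronglyMeasurable_mk.measurable
    rw [mixedNorm_congr_ae hu.ae_eq_mk]
    refine le_trans (le_of_eq (lintegral_congr_ae ?_)) this
    filter_upwards [hu.ae_eq_mk] with z hz
    rw [hz]
  -- A product weight allows Hölder to be applied first in `x` and then in `t`.
  have hsplit : ∀ z : Space d × ℝ, ENNReal.ofReal (((1 + ‖z‖) ^ (d + 1 + 2))⁻¹) ≤ a z.1 * b z.2 := fun z => by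
    simp only [ha, hb]
    rw [← ENNReal.ofReal_mul (by positivity), pow_add, mul_inv]
    gcongr
    · exact norm_fst_le z
    · exact norm_snd_le z
  calc ∫⁻ z, ‖u z‖ₑ * ENNReal.ofReal (((1 + ‖z‖) ^ (d + 1 + 2))⁻¹)
      ≤ ∫⁻ z : Space d × ℝ, ‖u z‖ₑ * (a z.1 * b z.2) := by
        gcongr with z; exact hsplit z
    _ = ∫⁻ t, (∫⁻ x, ‖u (x, t)‖ₑ * a x) * b t := by
        rw [Measure.volume_eq_prod, lintegral_prod_symm _ (by fun_prop)]
        refine lintegral_congr fun t => ?_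
        rw [← lintegral_mul_const _ (by fun_prop)]
        simp only [mul_assoc]
    _ ≤ ∫⁻ t, (sliceNorm r u t * A) * b t := by
        gcongr with t
        rw [sliceNorm_eq (by linarith)]
        exact lintegral_mul_weight_le hr (by fun_prop) ham.aemeasurable ha1
    _ = A * ∫⁻ t, sliceNorm r u t * b t := by
        rw [← lintegral_const_mul' _ _ hAt]
        refine lintegral_congr fun t => ?_
        ring
    _ ≤ A * (mixedNorm q r u * B) := by
        gcongr
        rw [mixedNorm_eq (by linarith)]
        exact lintegral_mul_weight_le hq (measurable_sliceNorm (by linarith) hum).aemeasurable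
          hbm.aemeasurable hb1
    _ = _ := by ring

/-- Fatou's lemma for mixed norms. -/
lemma mixedNorm_le_of_tendsto (hq : 0 < q) (hr : 0 < r) {u : Space d × ℝ → ℂ}
    {v : ℕ → Space d × ℝ → ℂ} (hv : ∀ n, Measurable (v n))
    (hlim : ∀ᵐ z, Filter.Tendsto (fun n => v n z) Filter.atTop (nhds (u z))) {C : ℝ≥0∞}
    (hC : ∀ n, mixedNorm q r (v n) ≤ C) : mixedNorm q r u ≤ C := by
  have hpow : ∀ (p : ℝ) (hp : 0 < p) (f : ℕ → ℝ≥0∞), Filter.liminf (fun n => f n ^ p) Filter.atTop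
      = (Filter.liminf f Filter.atTop) ^ p := fun p hp f =>
    ((ENNReal.orderIsoRpow p hp).liminf_apply (u := f) (f := Filter.atTop)).symm
  have h1 : ∀ᵐ t, sliceNorm r u t ≤ Filter.liminf (fun n => sliceNorm r (v n) t) Filter.atTop := by
    filter_upwards [ae_slice hlim] with t ht
    exact Lp.eLpNorm_lim_le_liminf_eLpNorm
      (fun n => ((hv n).comp measurable_prodMk_right).aestronglyMeasurable) _ ht
  have hiff : ∀ x y : ℝ≥0∞, x ^ (1 / q) ≤ y ↔ x ≤ y ^ q := fun x y => by
    rw [one_div, ENNReal.rpow_inv_le_iff hq]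
  rw [mixedNorm_eq hq, hiff]
  calc ∫⁻ t, sliceNorm r u t ^ q
      ≤ ∫⁻ t, Filter.liminf (fun n => sliceNorm r (v n) t ^ q) Filter.atTop := by
        refine lintegral_mono_ae (h1.mono fun t ht => ?_)
        rw [hpow q hq]
        gcongr
    _ ≤ Filter.liminf (fun n => ∫⁻ t, sliceNorm r (v n) t ^ q) Filter.atTop :=
        lintegral_liminf_le fun n => (measurable_sliceNorm hr (hv n)).pow_const q
    _ ≤ C ^ q := by
        refine Filter.liminf_le_of_frequently_le' (.of_forall fun n => ?_)
        rw [← hiff, ← mixedNorm_eq hq]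
        exact hC n

/-- Minkowski's inequality for the squares of slice norms. -/
lemma eLpNorm_sq_sum_le (hq : 2 ≤ q) {ι : Type*} (s : Finset ι) {N : ι → ℝ → ℝ≥0∞}
    (hN : ∀ i ∈ s, AEMeasurable (N i)) :
    (∫⁻ t, (∑ i ∈ s, N i t ^ 2) ^ (q / 2)) ^ (2 / q)
      ≤ ∑ i ∈ s, ((∫⁻ t, N i t ^ q) ^ (1 / q)) ^ 2 := by
  classical
  have hq0 : 0 < q := by linarith
  have e1 : ∀ x : ℝ≥0∞, (x ^ 2) ^ (q / 2) = x ^ q := fun x => by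
    rw [← ENNReal.rpow_two, ← ENNReal.rpow_mul]; congr 1; ring
  have e2 : ∀ x : ℝ≥0∞, (x ^ (1 / q)) ^ 2 = x ^ (2 / q) := fun x => by
    rw [← ENNReal.rpow_two, ← ENNReal.rpow_mul]; congr 1; ring
  simp only [e2]
  induction s using Finset.induction_on with
  | empty => simp [ENNReal.zero_rpow_of_pos (show 0 < q / 2 by positivity),
      ENNReal.zero_rpow_of_pos (show 0 < 2 / q by positivity)]
  | insert i s hi ih =>
    simp only [Finset.sum_insert hi]
    -- This is the triangle inequality in `L^(q/2)`, where `q ≥ 2` is needed.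
    have h := ENNReal.lintegral_Lp_add_le (μ := (volume : Measure ℝ)) (p := q / 2)
      (f := fun t => N i t ^ 2) (g := fun t => ∑ j ∈ s, N j t ^ 2)
      ((hN i (Finset.mem_insert_self _ _)).pow_const 2)
      (Finset.aemeasurable_fun_sum s fun j hj => (hN j (Finset.mem_insert_of_mem hj)).pow_const 2)
      (by linarith)
    simp only [one_div_div] at h
    refine h.trans ?_
    simp only [e1]
    gcongr
    exact ih fun j hj => hN j (Finset.mem_insert_of_mem hj)

/-- Square function bound for mixed norms of sums of functions that are frequency-localised in
space at every time. -/
theorem mixedNorm_sum_sq_le (hq : 2 ≤ q) (hr : 2 ≤ r) {lam A : ℝ} (hlam : 1 < lam) (hA : 0 ≤ A)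
    {K : ℤ → Space d → ℂ} (hK : IsReproducingFamily volume lam A K) {u : ℤ → Space d × ℝ → ℂ}
    (hu : ∀ j, Measurable (u j)) (hub : ∀ j, ∃ B, ∀ z, ‖u j z‖ ≤ B)
    (huL : ∀ j, mixedNorm q r (u j) < ⊤)
    (hrep : ∀ j x t, u j (x, t) = ∫ y, K j y * u j (x - y, t)) (s : Finset ℤ) :
    mixedNorm q r (fun z => ∑ j ∈ s, u j z) ^ 2 ≤
      ENNReal.ofReal (2 * r ^ 2 * A ^ 2 * (1 - lam⁻¹)⁻¹ + 2 * r ^ 2)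
        * ∑ j ∈ s, mixedNorm q r (u j) ^ 2 := by
  have hq0 : 0 < q := by linarith
  have hr0 : 0 < r := by linarith
  set C := 2 * r ^ 2 * A ^ 2 * (1 - lam⁻¹)⁻¹ + 2 * r ^ 2 with hC
  have hCpos : 0 ≤ C := by
    have : 0 ≤ (1 - lam⁻¹)⁻¹ := inv_nonneg.2 (sub_nonneg.2 (inv_le_one_of_one_le₀ hlam.le))
    positivity
  have hfin : ∀ᵐ t, ∀ j, sliceNorm r (u j) t < ⊤ := by
    rw [ae_all_iff]
    intro j
    have h := huL j
    rw [mixedNorm_eq hq0, ENNReal.rpow_lt_top_iff_of_pos (by positivity)] at h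
    filter_upwards [ae_lt_top ((measurable_sliceNorm hr0 (hu j)).pow_const q) h.ne] with t ht
    exact (ENNReal.rpow_lt_top_iff_of_pos hq0).1 ht
  -- The kernels act in space only, so the Besov embedding holds at almost every time with the same
  -- constant.
  have hslice : ∀ᵐ t, sliceNorm r (fun z => ∑ j ∈ s, u j z) t ^ 2
      ≤ ENNReal.ofReal C * ∑ j ∈ s, sliceNorm r (u j) t ^ 2 := by
    filter_upwards [hfin] with t ht
    have hm : ∀ j, Measurable fun x => u j (x, t) := fun j => (hu j).comp measurable_prodMk_right
    have hL : ∀ j, MemLp (fun x => u j (x, t)) (ENNReal.ofReal r) volume :=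
      fun j => ⟨(hm j).aestronglyMeasurable, ht j⟩
    have h := lpNorm_sum_sq_le hr hlam hA hK hm (fun j => (hub j).imp fun B hB x => hB _) hL
      (fun j x => hrep j x t) s
    have hS : MemLp (fun x => ∑ j ∈ s, u j (x, t)) (ENNReal.ofReal r) volume :=
      memLp_finsetSum s fun j _ => hL j
    have h' := ENNReal.ofReal_le_ofReal h
    rw [ENNReal.ofReal_pow lpNorm_nonneg, ofReal_lpNorm hS, ENNReal.ofReal_mul hCpos,
      ENNReal.ofReal_sum_of_nonneg fun j _ => by positivity] at h'
    simp only [ENNReal.ofReal_pow lpNorm_nonneg, ofReal_lpNorm (hL _)] at h'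
    exact h'
  have e1 : ∀ x : ℝ≥0∞, x ^ q = (x ^ 2) ^ (q / 2) := fun x => by
    rw [← ENNReal.rpow_two, ← ENNReal.rpow_mul]; congr 1; ring
  have e2 : ∀ x : ℝ≥0∞, (x ^ (1 / q)) ^ 2 = x ^ (2 / q) := fun x => by
    rw [← ENNReal.rpow_two, ← ENNReal.rpow_mul]; congr 1; ring
  calc mixedNorm q r (fun z => ∑ j ∈ s, u j z) ^ 2
      = (∫⁻ t, (sliceNorm r (fun z => ∑ j ∈ s, u j z) t ^ 2) ^ (q / 2)) ^ (2 / q) := by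
        rw [mixedNorm_eq hq0, e2]; simp only [e1]
    _ ≤ (∫⁻ t, (ENNReal.ofReal C * ∑ j ∈ s, sliceNorm r (u j) t ^ 2) ^ (q / 2)) ^ (2 / q) := by
        refine ENNReal.rpow_le_rpow (lintegral_mono_ae (hslice.mono fun t ht => ?_)) (by positivity)
        exact ENNReal.rpow_le_rpow ht (by positivity)
    _ = ENNReal.ofReal C * (∫⁻ t, (∑ j ∈ s, sliceNorm r (u j) t ^ 2) ^ (q / 2)) ^ (2 / q) := by
        simp only [ENNReal.mul_rpow_of_nonneg _ _ (show 0 ≤ q / 2 by positivity)]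
        rw [lintegral_const_mul' _ _ (by finiteness),
          ENNReal.mul_rpow_of_nonneg _ _ (by positivity), ← ENNReal.rpow_mul,
          div_mul_div_cancel₀ (by norm_num), div_self hq0.ne', ENNReal.rpow_one]
    _ ≤ _ := by
        gcongr
        simp only [mixedNorm_eq hq0]
        exact eLpNorm_sq_sum_le hq s fun j _ => (measurable_sliceNorm hr0 (hu j)).aemeasurable

end MixedNorm

section

open FourierTransform

/-! ### Kernels reproducing frequency-localised functions -/

section Kernel
variable {d : ℕ}

/-- For `|h| ≤ 1` use the mean value inequality, with `2 ^ (d + 1)` accounting for `1 + |y| ≤ 2 (1 +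
|z|)` on the unit ball about `y`; for `|h| ≥ 1` the triangle inequality is enough. -/
lemma exists_integral_translate_sub_le (K : SchwartzMap (Space d) ℂ) :
    ∃ A, 0 ≤ A ∧ ∀ h : Space d, ∫ y, ‖K (y + h) - K y‖ ≤ A * ‖h‖ := by
  obtain ⟨C, hC, hK⟩ := SchwartzMap.exists_norm_le (SchwartzMap.fderivCLM ℝ (Space d) ℂ K) (d + 1)
  have hw := integrable_inv_one_add_pow_space (d := d) (N := d + 1) (by omega)
  set W : ℝ := ∫ y : Space d, ((1 + ‖y‖) ^ (d + 1))⁻¹ with hW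
  have hW0 : 0 ≤ W := integral_nonneg fun y => by positivity
  have hK0 : 0 ≤ ∫ y, ‖K y‖ := integral_nonneg fun y => norm_nonneg _
  have hCW : 0 ≤ C * 2 ^ (d + 1) * W := by positivity
  refine ⟨C * 2 ^ (d + 1) * W + 2 * ∫ y, ‖K y‖, by positivity, fun h => ?_⟩
  rcases le_total ‖h‖ 1 with hh | hh
  · have key : ∀ y, ‖K (y + h) - K y‖ ≤ C * 2 ^ (d + 1) * ‖h‖ * ((1 + ‖y‖) ^ (d + 1))⁻¹ := fun y => by
      have hb : ∀ z ∈ Metric.closedBall y 1,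
          ‖fderiv ℝ K z‖ ≤ C * (2 ^ (d + 1) * ((1 + ‖y‖) ^ (d + 1))⁻¹) := fun z hz => by
        have h1 := hK z
        rw [SchwartzMap.fderivCLM_apply] at h1
        refine h1.trans ?_
        gcongr
        rw [← div_eq_mul_inv, inv_le_iff_one_le_mul₀ (by positivity), div_mul_eq_mul_div,
          le_div_iff₀ (by positivity), one_mul, ← mul_pow]
        gcongr
        have : ‖y‖ ≤ ‖y - z‖ + ‖z‖ := by simpa using norm_add_le (y - z) z
        have h2 : ‖y - z‖ ≤ 1 := by rw [← dist_eq_norm, dist_comm]; exact hz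
        linarith [norm_nonneg z]
      have := (convex_closedBall y 1).norm_image_sub_le_of_norm_fderiv_le (𝕜 := ℝ) (f := K)
        (fun z _ => K.differentiableAt) hb (Metric.mem_closedBall_self zero_le_one)
        (y := y + h) (by simpa using hh)
      rw [add_sub_cancel_left] at this
      linarith
    calc ∫ y, ‖K (y + h) - K y‖ ≤ ∫ y, C * 2 ^ (d + 1) * ‖h‖ * ((1 + ‖y‖) ^ (d + 1))⁻¹ :=
          integral_mono_of_nonneg (.of_forall fun y => norm_nonneg _) (hw.const_mul _)
            (.of_forall key)
      _ = C * 2 ^ (d + 1) * W * ‖h‖ := by rw [integral_const_mul]; ring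
      _ ≤ _ := mul_le_mul_of_nonneg_right (le_add_of_nonneg_right (by positivity)) (norm_nonneg h)
  · calc ∫ y, ‖K (y + h) - K y‖ ≤ ∫ y, (‖K (y + h)‖ + ‖K y‖) :=
          integral_mono_of_nonneg (.of_forall fun y => norm_nonneg _)
            ((K.integrable.comp_add_right h).norm.add K.integrable.norm)
            (.of_forall fun y => norm_sub_le _ _)
      _ = 2 * ∫ y, ‖K y‖ := by
          rw [integral_add (K.integrable.comp_add_right h).norm K.integrable.norm,
            integral_add_right_eq_self (fun y => ‖K y‖)]; ring
      _ ≤ (2 * ∫ y, ‖K y‖) * ‖h‖ := le_mul_of_one_le_right (by positivity) hh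
      _ ≤ _ := mul_le_mul_of_nonneg_right (le_add_of_nonneg_left hCW) (norm_nonneg h)

lemma integrable_norm_mul_norm (K : SchwartzMap (Space d) ℂ) :
    Integrable fun y => ‖K y‖ * ‖y‖ := by
  obtain ⟨C, hC, hK⟩ := SchwartzMap.exists_norm_le K (d + 2)
  refine ((integrable_inv_one_add_pow_space (d := d) (N := d + 1) (by omega)).const_mul C).mono'
    (K.continuous.norm.mul continuous_norm).aestronglyMeasurable (.of_forall fun y => ?_)
  rw [Real.norm_of_nonneg (by positivity)]
  calc ‖K y‖ * ‖y‖ ≤ (C * ((1 + ‖y‖) ^ (d + 2))⁻¹) * (1 + ‖y‖) := by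
        gcongr
        · exact hK y
        · linarith
    _ = _ := by
        rw [pow_succ (1 + ‖y‖) (d + 1), mul_inv, mul_assoc, mul_assoc,
          inv_mul_cancel₀ (by positivity), mul_one]

/-- The `L¹`-normalised dilates of a kernel. -/
def dilate (K : Space d → ℂ) (δ : ℝ) (y : Space d) : ℂ := ((δ ^ d : ℝ) : ℂ) * K (δ • y)

lemma integral_dilate_mul {K : Space d → ℂ} {δ : ℝ} (hδ : 0 < δ) (g : Space d → ℂ) :
    ∫ y, dilate K δ y * g (δ • y) = ∫ y, K y * g y := by
  have h := Measure.integral_comp_smul volume (fun y => K y * g y) δ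
  rw [finrank_euclideanSpace_fin, abs_of_pos (by positivity)] at h
  simp only [dilate, mul_assoc, integral_const_mul, h]
  rw [Complex.real_smul, ← mul_assoc, ← Complex.ofReal_mul, mul_inv_cancel₀ (by positivity)]
  simp

lemma norm_dilate (K : Space d → ℂ) {δ : ℝ} (hδ : 0 < δ) (y : Space d) :
    ‖dilate K δ y‖ = δ ^ d * ‖K (δ • y)‖ := by
  rw [dilate, norm_mul, Complex.norm_real, Real.norm_of_nonneg (by positivity)]

/-- Everything follows by scaling from `K` itself; `A` is the sum of its translation constant and
its first moment. -/
lemma exists_isReproducingFamily_dilate (K : SchwartzMap (Space d) ℂ) (hK : ∫ y, K y = 0) {lam : ℝ}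
    (hlam : 1 < lam) :
    ∃ A, 0 ≤ A ∧ IsReproducingFamily volume lam A fun j => dilate K (lam ^ j) := by
  obtain ⟨A, hA, hAK⟩ := exists_integral_translate_sub_le K
  have hB : 0 ≤ ∫ y, ‖K y‖ * ‖y‖ := integral_nonneg fun y => by positivity
  have hpos : ∀ j : ℤ, 0 < lam ^ j := fun j => zpow_pos (by linarith) j
  have hscale : ∀ (δ : ℝ), 0 < δ → ∀ F : Space d → ℝ, δ ^ d * ∫ y, F (δ • y) = ∫ y, F y := fun δ hδ F => by
    rw [Measure.integral_comp_smul volume F δ, finrank_euclideanSpace_fin,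
      abs_of_pos (by positivity), smul_eq_mul, mul_inv_cancel_left₀ (by positivity)]
  refine ⟨A + ∫ y, ‖K y‖ * ‖y‖, by positivity, ⟨fun j => ?_, fun j => ?_, fun j => ?_, fun j => ?_,
    fun j => ?_, fun j h => ?_⟩⟩
  · have : Continuous (dilate K (lam ^ j)) := by unfold dilate; fun_prop
    exact this.measurable
  · exact (K.integrable.comp_smul (hpos j).ne').const_mul _
  · have := integral_dilate_mul (K := K) (hpos j) fun _ => 1
    simpa [hK] using this
  · refine (((integrable_norm_mul_norm K).comp_smul (hpos j).ne').const_mul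
      ((lam ^ j) ^ d * (lam ^ j)⁻¹)).congr (.of_forall fun y => ?_)
    simp only [norm_dilate _ (hpos j), norm_smul, Real.norm_of_nonneg (hpos j).le]
    have := (hpos j).ne'
    field_simp
  · have h1 := hscale _ (hpos j) fun y => ‖K y‖ * ‖y‖
    simp only [norm_smul, Real.norm_of_nonneg (hpos j).le] at h1
    have h2 : ∫ y, ‖dilate K (lam ^ j) y‖ * ‖y‖ = (lam ^ j)⁻¹ * ∫ y, ‖K y‖ * ‖y‖ := by
      rw [← h1, ← integral_const_mul, ← integral_const_mul]
      refine integral_congr_ae (.of_forall fun y => ?_)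
      have := (hpos j).ne'
      simp only [norm_dilate _ (hpos j)]
      field_simp
    rw [h2, zpow_neg, mul_comm]
    have := hpos j
    gcongr
    linarith
  · have h1 := hscale _ (hpos j) fun y => ‖K (y + lam ^ j • h) - K y‖
    have h2 : ∫ y, ‖dilate K (lam ^ j) (y + h) - dilate K (lam ^ j) y‖
        = ∫ y, ‖K (y + lam ^ j • h) - K y‖ := by
      rw [← h1, ← integral_const_mul]
      refine integral_congr_ae (.of_forall fun y => ?_)
      simp only [dilate]
      rw [← mul_sub, norm_mul, Complex.norm_real, Real.norm_of_nonneg (pow_nonneg (hpos j).le d),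
        smul_add]
    rw [h2]
    refine (hAK _).trans ?_
    rw [norm_smul, Real.norm_of_nonneg (hpos j).le, ← mul_assoc]
    have := hpos j
    gcongr
    linarith

/-- A Schwartz kernel of mean zero whose Fourier transform is `1` on an annulus. -/
lemma exists_schwartz_fourier_eq_one (d : ℕ) {a b : ℝ} (ha : 0 < a) (hab : a ≤ b) :
    ∃ K : SchwartzMap (Space d) ℂ, ∫ y, K y = 0 ∧ ∀ ξ : Space d, a ≤ ‖ξ‖ → ‖ξ‖ ≤ b →
      ∫ y, K y * Complex.exp (-(Complex.I * ((inner ℝ y ξ : ℝ) : ℂ))) = 1 := by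
  have hpi : (0 : ℝ) < 2 * Real.pi := by positivity
  set a' := a / (2 * Real.pi) with ha'
  set b' := b / (2 * Real.pi) with hb'
  have ha0 : 0 < a' := by positivity
  have hb0 : 0 < b' := div_pos (by linarith) hpi
  -- In the variable `ξ / 2π`, `f` is `1` up to radius `b'`, while `g` is `1` near the origin and
  -- `0` beyond `a' / 2`. So `f - g` vanishes at `0`, which is the mean-zero condition, and equals
  -- `1` on the annulus.
  let f : ContDiffBump (0 : Space d) := ⟨b', 2 * b', hb0, by linarith⟩
  let g : ContDiffBump (0 : Space d) := ⟨a' / 3, a' / 2, by positivity, by linarith⟩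
  let χ : SchwartzMap (Space d) ℂ :=
    (f.hasCompactSupport.comp_left (g := fun x : ℝ => (x : ℂ)) rfl).toSchwartzMap
        (Complex.ofRealCLM.contDiff.comp f.contDiff)
      - (g.hasCompactSupport.comp_left (g := fun x : ℝ => (x : ℂ)) rfl).toSchwartzMap
        (Complex.ofRealCLM.contDiff.comp g.contDiff)
  have hχ : ∀ w, χ w = (f w : ℂ) - (g w : ℂ) := fun w => rfl
  have hF : ∀ w, 𝓕 ((𝓕⁻ χ : SchwartzMap (Space d) ℂ) : Space d → ℂ) w = χ w := fun w => by
    rw [← SchwartzMap.fourier_coe, FourierTransform.fourier_fourierInv_eq]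
  refine ⟨𝓕⁻ χ, ?_, fun ξ h1 h2 => ?_⟩
  · have h0 := hF 0
    rw [hχ, f.one_of_mem_closedBall (Metric.mem_closedBall_self hb0.le),
      g.one_of_mem_closedBall (Metric.mem_closedBall_self (by positivity : (0 : ℝ) ≤ a' / 3)), sub_self,
      Real.fourier_eq'] at h0
    simpa using h0
  · have h0 := hF ((2 * Real.pi)⁻¹ • ξ)
    have hn : ‖(2 * Real.pi)⁻¹ • ξ‖ = ‖ξ‖ / (2 * Real.pi) := by
      rw [norm_smul, Real.norm_of_nonneg (by positivity), inv_mul_eq_div]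
    rw [hχ, f.one_of_mem_closedBall (by
        rw [mem_closedBall_zero_iff, hn]; exact div_le_div_of_nonneg_right h2 hpi.le),
      g.zero_of_le_dist (by
        rw [dist_zero_right, hn]
        have : a' ≤ ‖ξ‖ / (2 * Real.pi) := div_le_div_of_nonneg_right h1 hpi.le
        change a' / 2 ≤ _
        linarith), Real.fourier_eq'] at h0
    simp only [Complex.ofReal_one, Complex.ofReal_zero, sub_zero] at h0
    rw [← h0]
    refine integral_congr_ae (.of_forall fun y => ?_)
    simp only [smul_eq_mul]
    rw [mul_comm, real_inner_smul_right]
    congr 2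
    push_cast
    have : (Real.pi : ℂ) ≠ 0 := by exact_mod_cast Real.pi_ne_zero
    field_simp

/-- Convolution in `x` multiplies `U` by the spatial transform of `L`, which is `1` wherever `U`
does not vanish. -/
lemma invFourierInt_eq_integral_mul {L : Space d → ℂ} (hL : Integrable L) {U : Space d × ℝ → ℂ}
    (hU : Integrable U)
    (hLU : ∀ ζ, U ζ ≠ 0 → ∫ y, L y * Complex.exp (-(Complex.I * ((inner ℝ y ζ.1 : ℝ) : ℂ))) = 1)
    (x : Space d) (t : ℝ) :
    invFourierInt U (x, t) = ∫ y, L y * invFourierInt U (x - y, t) := by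
  have hc : Continuous fun p : Space d × (Space d × ℝ) =>
      Complex.exp (Complex.I * (pairing (x - p.1, t) p.2 : ℝ)) := by
    have : Continuous fun p : Space d × (Space d × ℝ) => pairing (x - p.1, t) p.2 :=
      continuous_pairing.comp (f := fun p : Space d × (Space d × ℝ) => ((x - p.1, t), p.2)) (by fun_prop)
    fun_prop
  have hswap : Integrable (fun p : Space d × (Space d × ℝ) =>
      L p.1 * (U p.2 * Complex.exp (Complex.I * (pairing (x - p.1, t) p.2 : ℝ))))
      (volume.prod volume) := by
    refine ((hL.mul_prod hU).bdd_mul (c := 1) hc.aestronglyMeasurable (.of_forall fun p => ?_)).congr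
      (.of_forall fun p => ?_)
    · rw [norm_exp_I_mul_ofReal]
    · simp only; ring
  have e : ∀ y, L y * invFourierInt U (x - y, t) = (plancherelConst d : ℂ)⁻¹ *
      ∫ ζ, L y * (U ζ * Complex.exp (Complex.I * (pairing (x - y, t) ζ : ℝ))) := fun y => by
    rw [invFourierInt, integral_const_mul]; ring
  simp only [e]
  rw [integral_const_mul, integral_integral_swap hswap, invFourierInt]
  congr 1
  refine integral_congr_ae (.of_forall fun ζ => ?_)
  have e2 : ∀ y, L y * (U ζ * Complex.exp (Complex.I * (pairing (x - y, t) ζ : ℝ)))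
      = (U ζ * Complex.exp (Complex.I * (pairing (x, t) ζ : ℝ))) *
        (L y * Complex.exp (-(Complex.I * ((inner ℝ y ζ.1 : ℝ) : ℂ)))) := fun y => by
    have : Complex.exp (Complex.I * (pairing (x - y, t) ζ : ℝ))
        = Complex.exp (Complex.I * (pairing (x, t) ζ : ℝ)) *
          Complex.exp (-(Complex.I * ((inner ℝ y ζ.1 : ℝ) : ℂ))) := by
      rw [← Complex.exp_add, pairing, pairing, inner_sub_left]
      congr 1
      push_cast
      ring
    rw [this]; ring
  simp only [e2]
  rw [integral_const_mul]
  by_cases h : U ζ = 0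
  · simp [h]
  · rw [hLU ζ h, mul_one]

end Kernel

end

/-! ### Bounds for multipliers acting on the Fourier transform -/

section Multiplier
variable {d : ℕ} {q r κ βp βm : ℝ}

/-- Multiplication by `m` on the Fourier side is bounded from `L²` to `L^q_t L^r_x`. -/
def IsL2Bounded (q r : ℝ) (m : Space d × ℝ → ℂ) : Prop :=
  ∃ C : ℝ≥0, ∀ G : Space d × ℝ → ℂ, MemLp G 2 volume → ∃ u : Space d × ℝ → ℂ,
    IsFourierTransform u (fun ζ => m ζ * G ζ) ∧ mixedNorm q r u ≤ C * eLpNorm G 2 volume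

/-- Plancherel makes `g ↔ G` a correspondence of `L²` with itself; uniqueness of the Fourier
transform identifies the `G` chosen in `IsMultiplierImage` with the given one. -/
lemma isBoundedMultiplier_iff (m : Space d × ℝ → ℂ) :
    IsBoundedMultiplier q r m ↔ IsL2Bounded q r m := by
  constructor
  · rintro ⟨C, hC⟩
    refine ⟨C * (fourierBound d)⁻¹, fun G hG => ?_⟩
    obtain ⟨g, hg, hgn, hFT⟩ := exists_isFourierTransform_symm hG
    obtain ⟨u, ⟨G', hG', hu⟩, hn⟩ := hC g hg
    have hae := hG'.ae_unique_right hFT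
    refine ⟨u, hu.congr_right (hae.mono fun ζ hζ => by simp only [hζ]), hn.trans ?_⟩
    rw [ENNReal.coe_mul, mul_assoc]
    gcongr
  · rintro ⟨C, hC⟩
    refine ⟨C * fourierBound d, fun g hg => ?_⟩
    obtain ⟨G, hG, hGn, hFT⟩ := exists_isFourierTransform hg
    obtain ⟨u, hu, hn⟩ := hC G hG
    refine ⟨u, ⟨G, hFT, hu⟩, hn.trans ?_⟩
    rw [ENNReal.coe_mul, mul_assoc]
    gcongr

/-- The two halves of `exists_factorisation` give the two directions: that every `G` comes from some
`f` is what makes the estimate imply a bound for all of `L²`. -/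
lemma smoothingEstimate_iff (hd : 2 ≤ d) (hκ : -1 ≤ κ) (hκ0 : κ ≤ 0) :
    SmoothingEstimate d q r κ βp βm ↔
      IsL2Bounded q r fun ζ => hyperbolicMultiplier d βp βm ζ * sqrtWeight d κ ζ := by
  obtain ⟨B, hB, h1, h2⟩ := exists_factorisation hd hκ hκ0
  constructor
  · rintro ⟨C, hC⟩
    refine ⟨C * B⁻¹, fun G hG => ?_⟩
    obtain ⟨f, hf, hfn, hFT⟩ := h2 G hG
    obtain ⟨u, ⟨H, hH, hu⟩, hn⟩ := hC f hf
    have hae := hH.ae_unique_right hFT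
    refine ⟨u, hu.congr_right (hae.mono fun ζ hζ => by simp only [hζ, mul_assoc]), hn.trans ?_⟩
    rw [ENNReal.coe_mul, mul_assoc]
    gcongr
  · rintro ⟨C, hC⟩
    refine ⟨C * B, fun f hf => ?_⟩
    obtain ⟨G, hG, hGn, hFT⟩ := h1 f hf
    obtain ⟨u, hu, hn⟩ := hC G hG
    refine ⟨u, ⟨_, hFT, hu.congr_right (.of_forall fun ζ => by simp only [mul_assoc])⟩, hn.trans ?_⟩
    rw [ENNReal.coe_mul, mul_assoc]
    gcongr

lemma IsL2Bounded.congr_ae {m m' : Space d × ℝ → ℂ} (h : IsL2Bounded q r m)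
    (hm : m =ᵐ[volume] m') : IsL2Bounded q r m' := by
  obtain ⟨C, hC⟩ := h
  refine ⟨C, fun G hG => ?_⟩
  obtain ⟨u, hu, hn⟩ := hC G hG
  exact ⟨u, hu.congr_right (hm.mono fun ζ hζ => by simp only [hζ]), hn⟩

/-- The bounded factor is absorbed into `G`. Since the source space is `L²`, no smoothness of `b` is
required. -/
lemma IsL2Bounded.mul_bounded {m : Space d × ℝ → ℂ} (h : IsL2Bounded q r m) {b : Space d × ℝ → ℂ}
    (hb : Measurable b) {B : ℝ≥0} (hB : ∀ ζ, ‖b ζ‖ ≤ B) : IsL2Bounded q r fun ζ => m ζ * b ζ := by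
  obtain ⟨C, hC⟩ := h
  refine ⟨C * B, fun G hG => ?_⟩
  have hle : eLpNorm (fun ζ => b ζ * G ζ) 2 volume ≤ B * eLpNorm G 2 volume := by
    refine eLpNorm_le_nnreal_smul_eLpNorm_of_ae_le_mul (.of_forall fun ζ => ?_) 2
    rw [nnnorm_mul]
    gcongr
    exact hB ζ
  obtain ⟨u, hu, hn⟩ := hC (fun ζ => b ζ * G ζ) ⟨hb.aestronglyMeasurable.mul hG.1,
    hle.trans_lt (ENNReal.mul_lt_top ENNReal.coe_lt_top hG.2)⟩
  refine ⟨u, hu.congr_right (.of_forall fun ζ => by simp only [mul_assoc]), hn.trans ?_⟩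
  rw [ENNReal.coe_mul, mul_assoc]
  gcongr

/-- Pairing with the Fourier transform of a Schwartz function is continuous for the mixed norm. -/
lemma exists_enorm_integral_mul_fourierInt_le (hq : 1 < q) (hr : 1 < r)
    (ψ : SchwartzMap (Space d × ℝ) ℂ) :
    ∃ D : ℝ≥0, ∀ u : Space d × ℝ → ℂ, AEStronglyMeasurable u volume →
      ‖∫ z, u z * fourierInt ψ z‖ₑ ≤ D * mixedNorm q r u := by
  obtain ⟨C, hC⟩ := exists_lintegral_le_mixedNorm d hq hr
  obtain ⟨A, hA, hψ⟩ := norm_fourierInt_le ψ (d + 1 + 2)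
  refine ⟨A.toNNReal * C, fun u hu => ?_⟩
  calc ‖∫ z, u z * fourierInt ψ z‖ₑ ≤ ∫⁻ z, ‖u z * fourierInt ψ z‖ₑ :=
        enorm_integral_le_lintegral_enorm _
    _ ≤ ∫⁻ z, A.toNNReal * (‖u z‖ₑ * ENNReal.ofReal (((1 + ‖z‖) ^ (d + 1 + 2))⁻¹)) := by
        gcongr with z
        rw [enorm_mul, mul_left_comm]
        gcongr
        rw [← ofReal_norm, ← ENNReal.ofReal, ← ENNReal.ofReal_mul hA]
        exact ENNReal.ofReal_le_ofReal (hψ z)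
    _ ≤ _ := by
        rw [lintegral_const_mul' _ _ (by simp), ENNReal.coe_mul, mul_assoc]
        gcongr
        exact hC u hu

/-- A bounded multiplier of bounded support is square integrable. -/
lemma IsL2Bounded.memLp (hq : 1 < q) (hr : 1 < r) {m : Space d × ℝ → ℂ} (h : IsL2Bounded q r m)
    (hm : Measurable m) {R : ℝ} (hR : 0 < R) (hsupp : ∀ ζ, m ζ ≠ 0 → ‖ζ‖ ≤ R) :
    MemLp m 2 volume := by
  obtain ⟨C, hC⟩ := h
  let f : ContDiffBump (0 : Space d × ℝ) := ⟨R, 2 * R, hR, by linarith⟩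
  let ψ : SchwartzMap (Space d × ℝ) ℂ :=
    (f.hasCompactSupport.comp_left (g := fun x : ℝ => (x : ℂ)) rfl).toSchwartzMap
        (Complex.ofRealCLM.contDiff.comp f.contDiff)
  have hψ : ∀ ζ, m ζ ≠ 0 → ψ ζ = 1 := fun ζ hζ => by
    change (f ζ : ℂ) = 1
    rw [f.one_of_mem_closedBall (by rw [mem_closedBall_zero_iff]; exact hsupp ζ hζ),
      Complex.ofReal_one]
  obtain ⟨D, hD⟩ := exists_enorm_integral_mul_fourierInt_le hq hr ψ
  set S : ℕ → Set (Space d × ℝ) := fun n => {ζ | ‖m ζ‖ ≤ n} with hS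
  have hSm : ∀ n, MeasurableSet (S n) := fun n => measurableSet_le hm.norm measurable_const
  set I : ℕ → ℝ≥0∞ := fun n => ∫⁻ ζ, (S n).indicator (fun ζ => ‖m ζ‖ₑ ^ (2 : ℝ)) ζ with hI
  have hbound : ∀ n, I n ≤ (D * C : ℝ≥0) ^ (2 : ℝ) := by
    intro n
    -- Testing with the truncated conjugate of `m` and pairing with `ψ = 1` on the support gives `I
    -- n ≤ D C (I n)^(1/2)`. The truncation makes `I n` finite, so that it can be cancelled; then `n
    -- → ∞`.
    set g : Space d × ℝ → ℂ := (S n).indicator fun ζ => starRingEnd ℂ (m ζ) with hg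
    have hgm : Measurable g := (Complex.continuous_conj.measurable.comp hm).indicator (hSm n)
    have hgI : ∀ ζ, ‖g ζ‖ₑ ^ (2 : ℝ) = (S n).indicator (fun ζ => ‖m ζ‖ₑ ^ (2 : ℝ)) ζ := fun ζ => by
      by_cases hζ : ζ ∈ S n <;> simp [hg, hζ]
    have hgn : eLpNorm g 2 volume = I n ^ (1 / 2 : ℝ) := by
      rw [eLpNorm_two_eq_lintegral]; simp only [hgI, hI]
    have hIt : I n < ⊤ := by
      calc I n ≤ ∫⁻ ζ, (Metric.closedBall (0 : Space d × ℝ) R).indicator (fun _ => (n : ℝ≥0∞) ^ (2 : ℝ)) ζ := by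
            refine lintegral_mono fun ζ => ?_
            by_cases h1 : ζ ∈ S n
            · by_cases h0 : m ζ = 0
              · simp [h1, h0]
              · rw [Set.indicator_of_mem h1, Set.indicator_of_mem
                  (by rw [mem_closedBall_zero_iff]; exact hsupp ζ h0)]
                gcongr
                rw [← ofReal_norm, ← ENNReal.ofReal_natCast]
                exact ENNReal.ofReal_le_ofReal h1
            · simp [h1]
        _ = (n : ℝ≥0∞) ^ (2 : ℝ) * volume (Metric.closedBall (0 : Space d × ℝ) R) := by
            rw [lintegral_indicator_const Metric.isClosed_closedBall.measurableSet]
        _ < ⊤ := ENNReal.mul_lt_top (ENNReal.rpow_lt_top_of_nonneg (by norm_num) (by simp))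
            (isCompact_closedBall _ _).measure_lt_top
    obtain ⟨u, hu, hn⟩ := hC g ⟨hgm.aestronglyMeasurable, by
      rw [hgn]; exact ENNReal.rpow_lt_top_of_nonneg (by norm_num) hIt.ne⟩
    have h1 := hD u hu.1.aestronglyMeasurable
    have h2 : ∫ z, u z * fourierInt ψ z = ((I n).toReal : ℂ) := by
      rw [hu.2.2 ψ, hI, ← integral_toReal, ← integral_complex_ofReal]
      · refine integral_congr_ae (.of_forall fun ζ => ?_)
        by_cases hζ : ζ ∈ S n
        · by_cases h0 : m ζ = 0
          · simp [h0, hζ]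
          · simp only [hψ ζ h0, mul_one, hg, Set.indicator_of_mem hζ]
            rw [Complex.mul_conj, Complex.normSq_eq_norm_sq, ← ENNReal.toReal_rpow]
            simp
        · simp [hg, hζ]
      · exact ((hm.enorm.pow_const _).indicator (hSm n)).aemeasurable
      · refine .of_forall fun ζ => ?_
        by_cases hζ : ζ ∈ S n
        · rw [Set.indicator_of_mem hζ]
          exact ENNReal.rpow_lt_top_of_nonneg (by norm_num) (by simp)
        · simp [hζ]
    rw [h2, ← ofReal_norm, Complex.norm_real, Real.norm_of_nonneg ENNReal.toReal_nonneg,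
      ENNReal.ofReal_toReal hIt.ne] at h1
    have h3 : I n ≤ (D * C : ℝ≥0) * I n ^ (1 / 2 : ℝ) := by
      rw [ENNReal.coe_mul, mul_assoc, ← hgn]
      exact h1.trans (by gcongr)
    rcases eq_or_ne (I n) 0 with h0 | h0
    · rw [h0]; exact zero_le
    · have h4 : I n = I n ^ (1 / 2 : ℝ) * I n ^ (1 / 2 : ℝ) := by
        rw [← ENNReal.rpow_add _ _ h0 hIt.ne]; norm_num
      have h5 : I n ^ (1 / 2 : ℝ) ≠ 0 := by
        simp [ENNReal.rpow_eq_zero_iff, h0]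
      have h6 : I n ^ (1 / 2 : ℝ) ≠ ⊤ := ENNReal.rpow_ne_top_of_nonneg (by norm_num) hIt.ne
      have h7 : I n ^ (1 / 2 : ℝ) ≤ (D * C : ℝ≥0) := by
        exact (ENNReal.mul_le_mul_iff_left h5 h6).1 (h4.symm.trans_le h3)
      rw [h4, ENNReal.rpow_two, sq]
      gcongr
  refine ⟨hm.aestronglyMeasurable, ?_⟩
  rw [eLpNorm_two_eq_lintegral]
  refine ENNReal.rpow_lt_top_of_nonneg (by norm_num) (ne_of_lt ?_)
  have hlim : Filter.Tendsto I Filter.atTop (nhds (∫⁻ ζ, ‖m ζ‖ₑ ^ (2 : ℝ))) := by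
    refine lintegral_tendsto_of_tendsto_of_monotone
      (fun n => ((hm.enorm.pow_const _).indicator (hSm n)).aemeasurable) (.of_forall fun ζ => ?_)
      (.of_forall fun ζ => ?_)
    · intro i j hij
      refine Set.indicator_le_indicator_of_subset (fun ζ (hζ : ‖m ζ‖ ≤ i) => ?_) (fun _ => zero_le) ζ
      exact hζ.trans (by exact_mod_cast hij)
    · obtain ⟨k, hk⟩ := exists_nat_ge ‖m ζ‖
      refine tendsto_const_nhds.congr' ?_
      filter_upwards [Filter.eventually_ge_atTop k] with n hn
      rw [Set.indicator_of_mem (show ζ ∈ S n from hk.trans (by exact_mod_cast hn))]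
  exact (le_of_tendsto' hlim hbound).trans_lt
    (ENNReal.rpow_lt_top_of_nonneg (by norm_num) ENNReal.coe_ne_top)

end Multiplier

/-! ### Almost orthogonal series in the mixed norm -/

section Series
variable {d : ℕ} {q r : ℝ}

/-- The weight `(1 + |z|)^{-(d+3)}`. -/
def decay (d : ℕ) (z : Space d × ℝ) : ℝ := ((1 + ‖z‖) ^ (d + 1 + 2))⁻¹

lemma decay_pos (z : Space d × ℝ) : 0 < decay d z := by unfold decay; positivity

lemma continuous_decay : Continuous (decay d) := continuous_inv_one_add_pow _

/-- A series in the space `L^q_t L^r_x` whose partial sums satisfy a square function bound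
converges in the sense of tempered distributions. -/
theorem exists_hasSum_of_mixedNorm_sum_sq_le (hq : 1 < q) (hr : 1 < r) {u : ℤ → Space d × ℝ → ℂ}
    (hu : ∀ k, Measurable (u k)) {b : ℤ → ℝ≥0∞} (hb : ∑' k, b k ≠ ⊤) {D : ℝ≥0}
    (hD : ∀ s : Finset ℤ, mixedNorm q r (fun z => ∑ k ∈ s, u k z) ^ 2 ≤ D * ∑ k ∈ s, b k) :
    ∃ v : Space d × ℝ → ℂ, IsTempered v ∧ mixedNorm q r v ^ 2 ≤ D * ∑' k, b k ∧
      ∀ ψ : SchwartzMap (Space d × ℝ) ℂ,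
        HasSum (fun k => ∫ z, u k z * fourierInt ψ z) (∫ z, v z * fourierInt ψ z) := by
  obtain ⟨C, hC⟩ := exists_lintegral_le_mixedNorm d hq hr
  have hbk : ∀ k, b k ≠ ⊤ := fun k => ne_top_of_le_ne_top hb (ENNReal.le_tsum k)
  have hum : ∀ s : Finset ℤ, Measurable fun z => ∑ k ∈ s, u k z :=
    fun s => Finset.measurable_fun_sum s fun k _ => hu k
  have hw : ∀ s : Finset ℤ, (∫⁻ z, ‖((decay d z : ℝ) : ℂ) * ∑ k ∈ s, u k z‖ₑ) ^ 2
      ≤ ((C ^ 2 * D : ℝ≥0) : ℝ≥0∞) * ∑ k ∈ s, b k := fun s => by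
    have h1 := hC _ (hum s).aestronglyMeasurable
    have e : ∀ z, ‖((decay d z : ℝ) : ℂ) * ∑ k ∈ s, u k z‖ₑ
        = ‖∑ k ∈ s, u k z‖ₑ * ENNReal.ofReal (((1 + ‖z‖) ^ (d + 1 + 2))⁻¹) := fun z => by
      rw [enorm_mul, mul_comm]
      congr 1
      rw [← ofReal_norm, Complex.norm_real, Real.norm_of_nonneg (decay_pos z).le, decay]
    simp only [e]
    calc _ ≤ (C * mixedNorm q r (fun z => ∑ k ∈ s, u k z)) ^ 2 := by gcongr
      _ ≤ _ := by
        rw [mul_pow, ENNReal.coe_mul, ENNReal.coe_pow, mul_assoc]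
        gcongr
        exact hD s
  have hdm : Measurable fun z : Space d × ℝ => ((decay d z : ℝ) : ℂ) :=
    (Complex.continuous_ofReal.comp continuous_decay).measurable
  have hV : ∀ k, MemLp (fun z => ((decay d z : ℝ) : ℂ) * u k z) 1 volume := fun k => by
    refine ⟨(hdm.mul (hu k)).aestronglyMeasurable, ?_⟩
    rw [eLpNorm_one_eq_lintegral_enorm]
    have h1 := hw {k}
    simp only [Finset.sum_singleton] at h1
    by_contra hcon
    rw [not_lt_top_iff.1 hcon, ENNReal.top_pow (by norm_num)] at h1
    exact (ENNReal.mul_ne_top ENNReal.coe_ne_top (hbk k)) (top_le_iff.1 h1)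
  -- Convergence is obtained in a weighted `L¹` space, which is complete and controlled by the mixed
  -- norm; the square function bound on finite tails gives the Cauchy criterion.
  set W : ℤ → Lp ℂ 1 (volume : Measure (Space d × ℝ)) := fun k => (hV k).toLp _ with hW
  have hWs : ∀ s : Finset ℤ, ⇑(∑ k ∈ s, W k)
      =ᵐ[volume] fun z => ((decay d z : ℝ) : ℂ) * ∑ k ∈ s, u k z := fun s => by
    have h2 : ∀ᵐ z, ∀ k, W k z = ((decay d z : ℝ) : ℂ) * u k z :=
      ae_all_iff.2 fun k => (hV k).coeFn_toLp
    filter_upwards [Lp.coeFn_fun_finsetSum s W, h2] with z hz hz2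
    rw [hz, Finset.mul_sum]
    exact Finset.sum_congr rfl fun k _ => hz2 k
  have hsum : Summable W := by
    rw [summable_iff_vanishing_norm]
    intro ε hε
    have hbs : Summable fun k => (b k).toReal := ENNReal.summable_toReal hb
    have hε' : 0 < ε ^ 2 / ((C ^ 2 * D : ℝ≥0) + 1 : ℝ) := by positivity
    obtain ⟨s, hs⟩ := summable_iff_vanishing_norm.1 hbs _ hε'
    refine ⟨s, fun t ht => ?_⟩
    have h1 : ‖∑ k ∈ t, W k‖ₑ ^ 2 ≤ ((C ^ 2 * D : ℝ≥0) : ℝ≥0∞) * ∑ k ∈ t, b k := by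
      rw [Lp.enorm_def, eLpNorm_congr_ae (hWs t), eLpNorm_one_eq_lintegral_enorm]
      exact hw t
    have h2 : ‖∑ k ∈ t, W k‖ ^ 2 ≤ (C ^ 2 * D : ℝ≥0) * ∑ k ∈ t, (b k).toReal := by
      have h3 := ENNReal.toReal_mono (ENNReal.mul_ne_top ENNReal.coe_ne_top
        (ENNReal.sum_ne_top.2 fun k _ => hbk k)) h1
      rwa [ENNReal.toReal_pow, toReal_enorm, ENNReal.toReal_mul, ENNReal.coe_toReal,
        ENNReal.toReal_sum fun k _ => hbk k] at h3
    have h4 := (le_abs_self _).trans_lt (hs t ht)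
    rw [lt_div_iff₀ (by positivity)] at h4
    have h5 : 0 ≤ ∑ k ∈ t, (b k).toReal := Finset.sum_nonneg fun k _ => ENNReal.toReal_nonneg
    refine lt_of_pow_lt_pow_left₀ 2 hε.le ?_
    nlinarith
  set Z : Lp ℂ 1 (volume : Measure (Space d × ℝ)) := ∑' k, W k with hZ
  have hlim : Filter.Tendsto (fun s : Finset ℤ => ∑ k ∈ s, W k) Filter.atTop (nhds Z) := hsum.hasSum
  set v : Space d × ℝ → ℂ := fun z => (((decay d z)⁻¹ : ℝ) : ℂ) * Z z with hv
  have hdv : ∀ z, ((decay d z : ℝ) : ℂ) * v z = Z z := fun z => by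
    rw [hv, ← mul_assoc, ← Complex.ofReal_mul, mul_inv_cancel₀ (decay_pos z).ne']; simp
  have hZint : Integrable Z := L1.integrable_coeFn Z
  refine ⟨v, ⟨d + 1 + 2, hZint.congr (.of_forall fun z => ?_)⟩, ?_, fun ψ => ?_⟩
  · simp only [Complex.real_smul]; exact (hdv z).symm
  -- Convergence in `L¹` yields a subsequence of partial sums converging almost everywhere, which is
  -- what Fatou's lemma needs.
  · obtain ⟨ns, -, hns⟩ := (tendstoInMeasure_of_tendsto_Lp hlim).exists_seq_tendsto_ae'
    have hconv : ∀ᵐ z, Filter.Tendsto (fun i => ∑ k ∈ ns i, u k z) Filter.atTop (nhds (v z)) := by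
      filter_upwards [hns, ae_all_iff.2 fun i => hWs (ns i)] with z hz hz2
      have := hz.const_mul (((decay d z)⁻¹ : ℝ) : ℂ)
      refine this.congr fun i => ?_
      rw [hz2, ← mul_assoc, ← Complex.ofReal_mul, inv_mul_cancel₀ (decay_pos z).ne']; simp
    have hDT : (D : ℝ≥0∞) * ∑' k, b k ≠ ⊤ := ENNReal.mul_ne_top ENNReal.coe_ne_top hb
    have hsq : ∀ x : ℝ≥0∞, x ^ 2 ≤ D * ∑' k, b k ↔ x ≤ (D * ∑' k, b k) ^ (2⁻¹ : ℝ) := fun x => by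
      rw [ENNReal.le_rpow_inv_iff (by norm_num), ENNReal.rpow_two]
    rw [hsq, ← ENNReal.coe_toNNReal (ENNReal.rpow_ne_top_of_nonneg (by norm_num) hDT)]
    refine mixedNorm_le_of_tendsto (by linarith) (by linarith) (fun i => hum (ns i)) hconv fun i => ?_
    rw [ENNReal.coe_toNNReal (ENNReal.rpow_ne_top_of_nonneg (by norm_num) hDT), ← hsq]
    refine (hD _).trans ?_
    gcongr
    exact ENNReal.sum_le_tsum _
  · obtain ⟨A, hA, hψ⟩ := norm_fourierInt_le ψ (d + 1 + 2)
    -- The transform of a Schwartz function stays bounded after division by the weight, so pairing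
    -- with it is continuous on the weighted `L¹` space.
    set θ : Space d × ℝ → ℂ := fun z => (((decay d z)⁻¹ : ℝ) : ℂ) * fourierInt ψ z with hθ
    have hθm : Measurable θ :=
      (Complex.measurable_ofReal.comp continuous_decay.measurable.inv).mul
        (continuous_fourierInt ψ).measurable
    have hθb : ∀ z, ‖θ z‖ ≤ A := fun z => by
      rw [hθ, norm_mul, Complex.norm_real, Real.norm_of_nonneg (inv_nonneg.2 (decay_pos z).le),
        inv_mul_le_iff₀ (decay_pos z), mul_comm]
      exact hψ z
    have hint : ∀ F : Lp ℂ 1 (volume : Measure (Space d × ℝ)), Integrable fun z => F z * θ z :=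
      fun F => (L1.integrable_coeFn F).mul_bdd hθm.aestronglyMeasurable (.of_forall hθb)
    have hmain : Filter.Tendsto (fun s : Finset ℤ => ∫ z, (∑ k ∈ s, W k : Lp ℂ 1 volume) z * θ z)
        Filter.atTop (nhds (∫ z, Z z * θ z)) := by
      refine tendsto_integral_of_L1 _ (hint Z).1 (.of_forall fun s => hint _) ?_
      have h0 := (Lp.tendsto_Lp_iff_tendsto_eLpNorm' _ _).1 hlim
      have h1 := ENNReal.Tendsto.const_mul (a := ENNReal.ofReal A) h0 (.inr ENNReal.ofReal_ne_top)
      rw [mul_zero] at h1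
      refine tendsto_of_tendsto_of_tendsto_of_le_of_le tendsto_const_nhds h1 (fun _ => zero_le)
        fun s => ?_
      simp only
      rw [eLpNorm_one_eq_lintegral_enorm, ← lintegral_const_mul' _ _ ENNReal.ofReal_ne_top]
      gcongr with z
      rw [← sub_mul, enorm_mul, mul_comm, Pi.sub_apply]
      gcongr
      rw [← ofReal_norm]
      exact ENNReal.ofReal_le_ofReal (hθb z)
    have hθ' : ∀ z, ((decay d z : ℝ) : ℂ) * θ z = fourierInt ψ z := fun z => by
      rw [hθ, ← mul_assoc, ← Complex.ofReal_mul, mul_inv_cancel₀ (decay_pos z).ne']; simp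
    have e1 : ∫ z, Z z * θ z = ∫ z, v z * fourierInt ψ z := by
      refine integral_congr_ae (.of_forall fun z => ?_)
      simp only
      rw [← hdv z, ← hθ' z]; ring
    have e2 : ∀ k, Integrable fun z => u k z * fourierInt ψ z := fun k => by
      refine (hint (W k)).congr ?_
      filter_upwards [(hV k).coeFn_toLp] with z hz
      rw [hz, ← hθ' z]; ring
    have e3 : ∀ s : Finset ℤ, ∫ z, (∑ k ∈ s, W k : Lp ℂ 1 volume) z * θ z
        = ∑ k ∈ s, ∫ z, u k z * fourierInt ψ z := fun s => by
      rw [← integral_finsetSum s fun k _ => e2 k]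
      refine integral_congr_ae ((hWs s).mono fun z hz => ?_)
      simp only
      rw [hz, ← Finset.sum_mul, ← hθ' z]; ring
    rw [e1] at hmain
    exact hmain.congr e3

end Series

/-! ### Fourier multipliers on annuli -/

section Annulus
variable {d : ℕ} {q r : ℝ}

/-- The set of space-time frequencies with `a ≤ |ξ| < b`. -/
def annulus (d : ℕ) (a b : ℝ) : Set (Space d × ℝ) := {ζ | a ≤ ‖ζ.1‖ ∧ ‖ζ.1‖ < b}

lemma measurableSet_annulus (a b : ℝ) : MeasurableSet (annulus d a b) := by
  have hm : Measurable fun ζ : Space d × ℝ => ‖ζ.1‖ := by fun_prop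
  exact (measurableSet_le measurable_const hm).inter (measurableSet_lt hm measurable_const)

lemma smul_mem_annulus {a b δ : ℝ} (hδ : 0 < δ) (ζ : Space d × ℝ) :
    δ • ζ ∈ annulus d (a * δ) (b * δ) ↔ ζ ∈ annulus d a b := by
  simp only [annulus, Set.mem_ofPred_eq, Prod.smul_fst, norm_smul, Real.norm_of_nonneg hδ.le]
  rw [mul_comm a, mul_comm b, mul_le_mul_iff_right₀ hδ, mul_lt_mul_iff_right₀ hδ]

lemma disjoint_annulus {a lam : ℝ} (ha : 0 < a) (hlam : 1 < lam) :
    Pairwise fun j k : ℤ => Disjoint (annulus d (a * lam ^ j) (a * lam * lam ^ j))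
      (annulus d (a * lam ^ k) (a * lam * lam ^ k)) := by
  have key : ∀ j k : ℤ, j < k → Disjoint (annulus d (a * lam ^ j) (a * lam * lam ^ j))
      (annulus d (a * lam ^ k) (a * lam * lam ^ k)) := fun j k hjk => by
    refine Set.disjoint_left.2 fun ζ h1 h2 => ?_
    have h3 : lam ^ (j + 1) ≤ lam ^ k := zpow_le_zpow_right₀ hlam.le (by omega)
    rw [zpow_add_one₀ (by linarith)] at h3
    have h4 : a * lam * lam ^ j ≤ a * lam ^ k := by
      rw [mul_assoc, mul_comm lam]; gcongr
    exact absurd (h1.2.trans_le (h4.trans h2.1)) (lt_irrefl _)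
  intro j k hjk
  rcases lt_or_gt_of_ne hjk with h | h
  · exact key j k h
  · exact (key k j h).symm

lemma iUnion_annulus_ae_eq [NeZero d] {a lam : ℝ} (ha : 0 < a) (hlam : 1 < lam) :
    (⋃ k : ℤ, annulus d (a * lam ^ k) (a * lam * lam ^ k)) =ᵐ[volume] Set.univ := by
  have hne : ∀ᵐ ξ : Space d, ξ ≠ 0 := by simp [ae_iff, measure_singleton]
  have hne' : ∀ᵐ ζ : Space d × ℝ, ζ.1 ≠ 0 := Measure.quasiMeasurePreserving_fst.ae hne
  refine Filter.eventuallyEq_univ.2 ?_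
  filter_upwards [hne'] with ζ hζ
  obtain ⟨k, hk⟩ := exists_mem_Ico_zpow (div_pos (norm_pos_iff.2 hζ) ha) hlam
  refine Set.mem_iUnion.2 ⟨k, ?_, ?_⟩
  · have := hk.1
    rwa [le_div_iff₀ ha, mul_comm] at this
  · have := hk.2
    rwa [div_lt_iff₀ ha, zpow_add_one₀ (by linarith), mul_comm, mul_comm _ lam, ← mul_assoc] at this

lemma eLpNorm_two_comp_smul (G : Space d × ℝ → ℂ) {δ : ℝ} (hδ : 0 < δ) :
    eLpNorm (fun ζ => G (δ • ζ)) 2 volume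
      = ENNReal.ofReal (δ ^ (-((d + 1 : ℝ) / 2))) * eLpNorm G 2 volume := by
  rw [eLpNorm_two_eq_lintegral, eLpNorm_two_eq_lintegral,
    lintegral_comp_smul_eq volume (fun ζ => ‖G ζ‖ₑ ^ (2 : ℝ)) hδ.ne',
    ENNReal.mul_rpow_of_nonneg _ _ (by norm_num), finrank_spaceTime, abs_of_pos (by positivity),
    ENNReal.ofReal_rpow_of_pos (by positivity)]
  congr 2
  rw [← Real.rpow_natCast, ← Real.rpow_neg hδ.le, ← Real.rpow_mul hδ.le]
  congr 1
  push_cast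
  ring

lemma IsFourierTransform.const_mul {F G : Space d × ℝ → ℂ} (h : IsFourierTransform F G) (c : ℂ) :
    IsFourierTransform (fun z => c * F z) fun ζ => c * G ζ := by
  have hT : ∀ {H : Space d × ℝ → ℂ}, IsTempered H → IsTempered fun z => c * H z := by
    rintro H ⟨N, hN⟩
    refine ⟨N, (hN.const_mul c).congr (.of_forall fun z => ?_)⟩
    simp only [mul_smul_comm]
  refine ⟨hT h.1, hT h.2.1, fun ψ => ?_⟩
  simp only [mul_assoc, integral_const_mul, h.2.2 ψ]

/-- Rescaling a bound on an annulus. -/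
lemma exists_isFourierTransform_annulus (hq : 0 < q) (hr : 0 < r) {M : Space d × ℝ → ℂ} {s : ℝ}
    (hs : s = d / r + 1 / q - (d + 1) / 2)
    (hom : ∀ δ : ℝ, 0 < δ → ∀ ζ, M (δ • ζ) = ((δ ^ s : ℝ) : ℂ) * M ζ) {a b : ℝ} {C : ℝ≥0}
    (hC : ∀ G : Space d × ℝ → ℂ, MemLp G 2 volume → ∃ u : Space d × ℝ → ℂ,
      IsFourierTransform u (fun ζ => (annulus d a b).indicator M ζ * G ζ) ∧
        mixedNorm q r u ≤ C * eLpNorm G 2 volume)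
    {δ : ℝ} (hδ : 0 < δ) {G : Space d × ℝ → ℂ} (hG : MemLp G 2 volume) :
    ∃ u : Space d × ℝ → ℂ,
      IsFourierTransform u ((annulus d (a * δ) (b * δ)).indicator fun ζ => M ζ * G ζ) ∧
      mixedNorm q r u ≤ C * eLpNorm ((annulus d (a * δ) (b * δ)).indicator G) 2 volume := by
  set H := (annulus d (a * δ) (b * δ)).indicator G with hH
  have hHL : MemLp H 2 volume := hG.indicator (measurableSet_annulus _ _)
  have hHδ : MemLp (fun ζ => H (δ • ζ)) 2 volume := by
    refine ⟨hHL.1.comp_quasiMeasurePreserving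
      ⟨(measurable_const_smul δ), ?_⟩, ?_⟩
    · rw [Measure.map_addHaar_smul volume hδ.ne']
      exact Measure.smul_absolutelyContinuous
    · rw [eLpNorm_two_comp_smul H hδ]
      exact ENNReal.mul_lt_top ENNReal.ofReal_lt_top hHL.2
  obtain ⟨u, hu, hn⟩ := hC _ hHδ
  -- `δ^(d+1)` undoes the factor from transforming a dilate, and `δ^s` the homogeneity of `M`. With
  -- this critical `s` the powers of `δ` from the mixed norm and the `L²` norm cancel exactly.
  refine ⟨fun z => ((δ ^ (d + 1 + s) : ℝ) : ℂ) * u (δ • z),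
    ((hu.comp_smul hδ).const_mul _).congr_right (.of_forall fun ζ => ?_), ?_⟩
  · simp only [smul_smul, mul_inv_cancel₀ hδ.ne', one_smul]
    by_cases hζ : ζ ∈ annulus d (a * δ) (b * δ)
    · have hζ' : δ⁻¹ • ζ ∈ annulus d a b := by
        rw [← smul_mem_annulus hδ, smul_smul, mul_inv_cancel₀ hδ.ne', one_smul]; exact hζ
      rw [hH, Set.indicator_of_mem hζ, Set.indicator_of_mem hζ', Set.indicator_of_mem hζ,
        hom _ (inv_pos.2 hδ), Complex.real_smul, ← mul_assoc, ← mul_assoc, ← mul_assoc,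
        ← Complex.ofReal_mul, ← Complex.ofReal_mul]
      have : δ ^ (d + 1 + s) * (δ ^ (d + 1))⁻¹ * δ⁻¹ ^ s = 1 := by
        rw [Real.inv_rpow hδ.le, Real.rpow_add hδ,
          show δ ^ ((d : ℝ) + 1) = δ ^ (d + 1) by exact_mod_cast Real.rpow_natCast δ (d + 1)]
        have := (Real.rpow_pos_of_pos hδ s).ne'
        field_simp
      rw [this, Complex.ofReal_one, one_mul]
    · rw [hH, Set.indicator_of_notMem hζ, Set.indicator_of_notMem hζ]
      simp
  · rw [mixedNorm_const_mul hq, mixedNorm_comp_smul hq hr u hδ, ← ofReal_norm, Complex.norm_real,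
      Real.norm_of_nonneg (by positivity)]
    rw [eLpNorm_two_comp_smul H hδ] at hn
    calc _ ≤ ENNReal.ofReal (δ ^ (d + 1 + s)) * (ENNReal.ofReal (δ ^ (-(d / r + 1 / q))) *
          (C * (ENNReal.ofReal (δ ^ (-((d + 1 : ℝ) / 2))) * eLpNorm H 2 volume))) := by gcongr
      _ = ENNReal.ofReal (δ ^ (d + 1 + s) * δ ^ (-(d / r + 1 / q)) * δ ^ (-((d + 1 : ℝ) / 2)))
          * (C * eLpNorm H 2 volume) := by
          rw [ENNReal.ofReal_mul (by positivity), ENNReal.ofReal_mul (by positivity)]; ring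
      _ = C * eLpNorm H 2 volume := by
          rw [← Real.rpow_add hδ, ← Real.rpow_add hδ,
            show (d + 1 + s + -(d / r + 1 / q) + -((d + 1 : ℝ) / 2)) = 0 by rw [hs]; ring]
          simp

end Annulus

/-! ### Homogeneous multipliers -/

section Homogeneous
variable {d : ℕ} {q r : ℝ}

/-- As `k → -∞` the factor `lam^(k p)` decays by itself; as `k → ∞` the weight is at most a constant
times `lam^(-2 k p)` because `N ≥ p`. -/
lemma summable_dyadic_weight {a lam p : ℝ} (ha : 0 < a) (hlam : 1 < lam) (hp : 0 < p) {N : ℕ}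
    (hN : p ≤ N) :
    Summable fun k : ℤ => (((1 + a * lam ^ k) ^ N)⁻¹) ^ 2 * (lam ^ k) ^ p := by
  have hlam0 : 0 < lam := by linarith
  set ρ := lam ^ p with hρ
  have hρ1 : 1 < ρ := Real.one_lt_rpow hlam hp
  have hρ0 : 0 < ρ := by linarith
  have hgeo : Summable fun n : ℕ => ρ⁻¹ ^ n :=
    summable_geometric_of_lt_one (by positivity) (inv_lt_one_of_one_lt₀ hρ1)
  have hpw : ∀ n : ℕ, (lam ^ n) ^ p = ρ ^ n := fun n => (Real.rpow_pow_comm hlam0.le p n).symm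
  refine Summable.of_nat_of_neg ?_ ?_
  · refine Summable.of_nonneg_of_le (fun n => by positivity) (fun n => ?_)
      (hgeo.mul_left (((a ^ N)⁻¹) ^ 2))
    rw [zpow_natCast, hpw]
    have h1 : a ^ N * ρ ^ n ≤ (1 + a * lam ^ n) ^ N := by
      calc a ^ N * ρ ^ n ≤ a ^ N * (lam ^ n) ^ N := by
            gcongr
            rw [← hpw, ← Real.rpow_natCast (lam ^ n) N]
            exact Real.rpow_le_rpow_of_exponent_le (one_le_pow₀ hlam.le) hN
        _ = (a * lam ^ n) ^ N := by rw [mul_pow]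
        _ ≤ _ := by gcongr; linarith
    calc _ ≤ ((a ^ N * ρ ^ n)⁻¹) ^ 2 * ρ ^ n := by gcongr
      _ = _ := by
        rw [inv_pow ρ]
        field_simp
  · refine Summable.of_nonneg_of_le (fun n => by positivity) (fun n => ?_) hgeo
    rw [zpow_neg, zpow_natCast, Real.inv_rpow (by positivity), hpw, inv_pow ρ n]
    have h1 : 0 ≤ a * (lam ^ n)⁻¹ := by positivity
    have h2 : 1 ≤ (1 + a * (lam ^ n)⁻¹) ^ N := one_le_pow₀ (by linarith)
    exact mul_le_of_le_one_left (by positivity)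
      (pow_le_one₀ (by positivity) (inv_le_one_of_one_le₀ h2))

lemma setLIntegral_annulus_scale {M : Space d × ℝ → ℂ} {s : ℝ}
    (hom : ∀ δ : ℝ, 0 < δ → ∀ ζ, M (δ • ζ) = ((δ ^ s : ℝ) : ℂ) * M ζ) (a b : ℝ) {δ : ℝ}
    (hδ : 0 < δ) :
    ∫⁻ ζ in annulus d (a * δ) (b * δ), ‖M ζ‖ₑ ^ (2 : ℝ)
      = ENNReal.ofReal (δ ^ (2 * s + d + 1)) * ∫⁻ ζ in annulus d a b, ‖M ζ‖ₑ ^ (2 : ℝ) := by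
  rw [← lintegral_indicator (measurableSet_annulus _ _),
    ← lintegral_indicator (measurableSet_annulus _ _)]
  have h := lintegral_comp_smul_eq volume
    ((annulus d (a * δ) (b * δ)).indicator fun ζ => ‖M ζ‖ₑ ^ (2 : ℝ)) hδ.ne'
  have e : ∀ ζ, (annulus d (a * δ) (b * δ)).indicator (fun ζ => ‖M ζ‖ₑ ^ (2 : ℝ)) (δ • ζ)
      = ENNReal.ofReal (δ ^ (2 * s)) * (annulus d a b).indicator (fun ζ => ‖M ζ‖ₑ ^ (2 : ℝ)) ζ := fun ζ => by
    by_cases hζ : ζ ∈ annulus d a b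
    · rw [Set.indicator_of_mem hζ, Set.indicator_of_mem ((smul_mem_annulus hδ ζ).2 hζ), hom δ hδ,
        enorm_mul, ENNReal.mul_rpow_of_nonneg _ _ (by norm_num)]
      congr 1
      rw [← ofReal_norm, Complex.norm_real, Real.norm_of_nonneg (by positivity),
        ENNReal.ofReal_rpow_of_nonneg (by positivity) (by norm_num), ← Real.rpow_mul hδ.le, mul_comm s]
    · rw [Set.indicator_of_notMem hζ, Set.indicator_of_notMem (by rwa [smul_mem_annulus hδ]), mul_zero]
  simp only [e] at h
  rw [lintegral_const_mul' _ _ ENNReal.ofReal_ne_top, finrank_spaceTime, abs_of_pos (by positivity)] at h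
  have h2 : ENNReal.ofReal (δ ^ (d + 1)) * ENNReal.ofReal ((δ ^ (d + 1))⁻¹) = 1 := by
    rw [← ENNReal.ofReal_mul (by positivity), mul_inv_cancel₀ (by positivity), ENNReal.ofReal_one]
  have h3 : δ ^ (2 * s + d + 1) = δ ^ (d + 1) * δ ^ (2 * s) := by
    rw [← Real.rpow_natCast δ (d + 1), ← Real.rpow_add hδ]
    congr 1
    push_cast
    ring
  rw [h3, ENNReal.ofReal_mul (by positivity), mul_assoc, h, ← mul_assoc, h2, one_mul]

/-- A homogeneous function that is square integrable on an annulus is square integrable with a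
polynomial weight. -/
lemma exists_memLp_mul_weight [NeZero d] {M : Space d × ℝ → ℂ} (hM : Measurable M) {s : ℝ}
    (hs : 0 < 2 * s + d + 1)
    (hom : ∀ δ : ℝ, 0 < δ → ∀ ζ, M (δ • ζ) = ((δ ^ s : ℝ) : ℂ) * M ζ) {a lam : ℝ} (ha : 0 < a)
    (hlam : 1 < lam) (hM0 : MemLp ((annulus d a (a * lam)).indicator M) 2 volume) :
    ∃ N : ℕ, MemLp (fun ζ => M ζ * ((((1 + ‖ζ‖) ^ N)⁻¹ : ℝ) : ℂ)) 2 volume := by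
  set p := 2 * s + d + 1 with hp
  set N := ⌈p⌉₊ with hN
  have hpos : ∀ k : ℤ, 0 < lam ^ k := fun k => zpow_pos (by linarith) k
  set I := ∫⁻ ζ in annulus d a (a * lam), ‖M ζ‖ₑ ^ (2 : ℝ) with hI
  have hIt : I < ⊤ := by
    have h := hM0.2
    rw [eLpNorm_indicator_eq_eLpNorm_restrict (measurableSet_annulus _ _), eLpNorm_two_eq_lintegral,
      ENNReal.rpow_lt_top_iff_of_pos (by norm_num)] at h
    exact h
  refine ⟨N, (hM.mul (Complex.measurable_ofReal.comp
    (continuous_inv_one_add_pow N).measurable)).aestronglyMeasurable, ?_⟩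
  rw [eLpNorm_two_eq_lintegral]
  refine ENNReal.rpow_lt_top_of_nonneg (by norm_num) (ne_of_lt ?_)
  rw [← setLIntegral_univ, ← setLIntegral_congr (iUnion_annulus_ae_eq ha hlam),
    lintegral_iUnion (fun k => measurableSet_annulus _ _) (disjoint_annulus ha hlam)]
  calc _ ≤ ∑' k : ℤ, ENNReal.ofReal ((((1 + a * lam ^ k) ^ N)⁻¹) ^ 2 * (lam ^ k) ^ p) * I := by
        refine ENNReal.tsum_le_tsum fun k => ?_
        have hk := hpos k
        rw [ENNReal.ofReal_mul (by positivity), mul_assoc (ENNReal.ofReal _), hI, hp,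
          ← setLIntegral_annulus_scale hom a (a * lam) hk,
          ← lintegral_const_mul' _ _ ENNReal.ofReal_ne_top]
        refine setLIntegral_mono' (measurableSet_annulus _ _) fun ζ hζ => ?_
        rw [enorm_mul, ENNReal.mul_rpow_of_nonneg _ _ (by norm_num), mul_comm]
        gcongr
        rw [← ofReal_norm, Complex.norm_real, Real.norm_of_nonneg (by positivity),
          ENNReal.ofReal_rpow_of_nonneg (by positivity) (by norm_num), Real.rpow_two]
        gcongr
        exact hζ.1.trans (norm_fst_le ζ)
    _ = (∑' k : ℤ, ENNReal.ofReal ((((1 + a * lam ^ k) ^ N)⁻¹) ^ 2 * (lam ^ k) ^ p)) * I :=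
        ENNReal.tsum_mul_right
    _ < ⊤ := ENNReal.mul_lt_top
        (summable_dyadic_weight ha hlam hs (Nat.le_ceil p)).tsum_ofReal_lt_top hIt

/-- A homogeneous multiplier of the critical degree that is bounded on an annulus is bounded. -/
theorem isL2Bounded_of_annulus [NeZero d] (hq : 2 ≤ q) (hr : 2 ≤ r) {M : Space d × ℝ → ℂ}
    (hM : Measurable M) {s : ℝ} (hs : s = d / r + 1 / q - (d + 1) / 2)
    (hom : ∀ δ : ℝ, 0 < δ → ∀ ζ, M (δ • ζ) = ((δ ^ s : ℝ) : ℂ) * M ζ)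
    (hsupp : ∀ ζ, M ζ ≠ 0 → |ζ.2| ≤ ‖ζ.1‖) {a lam : ℝ} (ha : 0 < a) (hlam : 1 < lam)
    (h : IsL2Bounded q r ((annulus d a (a * lam)).indicator M)) : IsL2Bounded q r M := by
  have hlam0 : 0 < lam := by linarith
  have hpos : ∀ k : ℤ, 0 < lam ^ k := fun k => zpow_pos hlam0 k
  have hM0 : MemLp ((annulus d a (a * lam)).indicator M) 2 volume := by
    refine h.memLp (R := a * lam) (by linarith) (by linarith)
      (hM.indicator (measurableSet_annulus _ _)) (by positivity) fun ζ hζ => ?_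
    have hmem := Set.mem_of_indicator_ne_zero hζ
    rw [Set.indicator_of_mem hmem] at hζ
    exact max_le hmem.2.le ((hsupp ζ hζ).trans hmem.2.le)
  -- The critical degree makes this `2 (d/r + 1/q)`. Its positivity makes `|M|²` integrable near `ξ
  -- = 0`, so that `M G` is tempered.
  have hs0 : 0 < 2 * s + d + 1 := by
    have : 2 * s + d + 1 = 2 * (d / r + 1 / q) := by rw [hs]; ring
    rw [this]
    have : 0 < 1 / q := by positivity
    have : 0 ≤ (d : ℝ) / r := by positivity
    linarith
  obtain ⟨N, hN⟩ := exists_memLp_mul_weight hM hs0 hom ha hlam hM0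
  obtain ⟨K, hK0, hK1⟩ := exists_schwartz_fourier_eq_one d ha (show a ≤ a * lam by nlinarith)
  obtain ⟨A, hA, hrepr⟩ := exists_isReproducingFamily_dilate K hK0 hlam
  obtain ⟨C, hC⟩ := h
  set B := ENNReal.ofReal (2 * r ^ 2 * A ^ 2 * (1 - lam⁻¹)⁻¹ + 2 * r ^ 2) with hB
  set D : ℝ≥0 := B.toNNReal * C ^ 2 with hDdef
  refine ⟨NNReal.sqrt D, fun G hG => ?_⟩
  set E : ℤ → Set (Space d × ℝ) := fun k => annulus d (a * lam ^ k) (a * lam * lam ^ k) with hE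
  have hEm : ∀ k, MeasurableSet (E k) := fun k => measurableSet_annulus _ _
  have hMGw : Integrable fun ζ => ((((1 + ‖ζ‖) ^ N)⁻¹ : ℝ) : ℂ) * (M ζ * G ζ) := by
    refine (hN.integrable_mul hG).congr (.of_forall fun ζ => ?_)
    simp only [Pi.mul_apply]; ring
  have hMG : IsTempered fun ζ => M ζ * G ζ :=
    ⟨N, hMGw.congr (.of_forall fun ζ => by simp only [Complex.real_smul])⟩
  set U : ℤ → Space d × ℝ → ℂ := fun k => (E k).indicator fun ζ => M ζ * G ζ with hU
  have hUint : ∀ k, Integrable (U k) := fun k => by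
    refine (hMGw.norm.const_mul ((1 + a * lam * lam ^ k) ^ N)).mono'
      ((hM.aestronglyMeasurable.mul hG.1).indicator (hEm k)) (.of_forall fun ζ => ?_)
    by_cases hζ : ζ ∈ E k
    · change ‖(E k).indicator _ ζ‖ ≤ _
      rw [Set.indicator_of_mem hζ]
      by_cases hMζ : M ζ = 0
      · simp [hMζ]
      have hζn : ‖ζ‖ ≤ a * lam * lam ^ k := max_le hζ.2.le ((hsupp ζ hMζ).trans hζ.2.le)
      rw [norm_mul (((((1 + ‖ζ‖) ^ N)⁻¹ : ℝ) : ℂ)), Complex.norm_real,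
        Real.norm_of_nonneg (by positivity), ← mul_assoc]
      refine le_mul_of_one_le_left (norm_nonneg _) ?_
      rw [← div_eq_mul_inv, one_le_div (by positivity)]
      gcongr
    · have := hpos k
      change ‖(E k).indicator _ ζ‖ ≤ _
      rw [Set.indicator_of_notMem hζ, norm_zero]
      positivity
  set u : ℤ → Space d × ℝ → ℂ := fun k => invFourierInt (U k) with hu
  have huFT : ∀ k, IsFourierTransform (u k) (U k) := fun k => isFourierTransform_invFourierInt (hUint k)
  have hum : ∀ k, Measurable (u k) := fun k => (continuous_invFourierInt (hUint k)).measurable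
  -- The explicit inverse transform is used because it is measurable, bounded and reproduced at
  -- every point; uniqueness transfers to it the bound known for some function with the same Fourier
  -- transform.
  have hun : ∀ k, mixedNorm q r (u k) ≤ C * eLpNorm ((E k).indicator G) 2 volume := fun k => by
    obtain ⟨v, hv, hvn⟩ := exists_isFourierTransform_annulus (by linarith) (by linarith) hs hom hC
      (hpos k) hG
    rw [mixedNorm_congr_ae ((huFT k).ae_unique_left hv)]
    exact hvn
  -- Orthogonality of the pieces: the annuli are disjoint and cover almost everything.
  have hb : ∑' k, eLpNorm ((E k).indicator G) 2 volume ^ 2 = eLpNorm G 2 volume ^ 2 := by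
    have e : ∀ f : ℝ≥0∞, (f ^ (1 / 2 : ℝ)) ^ 2 = f := fun f => by
      rw [← ENNReal.rpow_two, ← ENNReal.rpow_mul]; norm_num
    simp only [eLpNorm_indicator_eq_eLpNorm_restrict (hEm _), eLpNorm_two_eq_lintegral, e]
    rw [← lintegral_iUnion hEm (disjoint_annulus ha hlam),
      setLIntegral_congr (iUnion_annulus_ae_eq ha hlam), setLIntegral_univ]
  have hD : ∀ t : Finset ℤ, mixedNorm q r (fun z => ∑ k ∈ t, u k z) ^ 2
      ≤ D * ∑ k ∈ t, eLpNorm ((E k).indicator G) 2 volume ^ 2 := fun t => by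
    refine (mixedNorm_sum_sq_le hq hr hlam hA hrepr hum
      (fun k => ⟨_, norm_invFourierInt_le (U k)⟩) (fun k => ?_) (fun k x y => ?_) t).trans ?_
    · exact (hun k).trans_lt (ENNReal.mul_lt_top ENNReal.coe_lt_top (hG.indicator (hEm k)).2)
    · refine invFourierInt_eq_integral_mul (hrepr.integrable k) (hUint k) (fun ζ hζ => ?_) x y
      have hmem := Set.mem_of_indicator_ne_zero hζ
      have hk := hpos k
      have h1 := integral_dilate_mul (K := K) hk fun y =>
        Complex.exp (-(Complex.I * ((inner ℝ y ((lam ^ k)⁻¹ • ζ.1) : ℝ) : ℂ)))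
      simp only [real_inner_smul_left, real_inner_smul_right, inv_mul_cancel_left₀ hk.ne'] at h1
      rw [h1]
      have h2 := hK1 ((lam ^ k)⁻¹ • ζ.1) ?_ ?_
      · simpa only [real_inner_smul_right] using h2
      · rw [norm_smul, norm_inv, Real.norm_of_nonneg hk.le, le_inv_mul_iff₀ hk, mul_comm]
        exact hmem.1
      · rw [norm_smul, norm_inv, Real.norm_of_nonneg hk.le, inv_mul_le_iff₀ hk, mul_comm]
        exact hmem.2.le
    · rw [← hB, hDdef, ENNReal.coe_mul, ENNReal.coe_toNNReal (hB ▸ ENNReal.ofReal_ne_top),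
        mul_assoc B, ENNReal.coe_pow,
        Finset.mul_sum (a := (C : ℝ≥0∞) ^ 2)]
      refine mul_le_mul_right (Finset.sum_le_sum fun k _ => ?_) B
      rw [← mul_pow]
      exact pow_le_pow_left' (hun k) 2
  obtain ⟨v, hvT, hvn, hvsum⟩ := exists_hasSum_of_mixedNorm_sum_sq_le (by linarith) (by linarith) hum
    (by rw [hb]; exact ENNReal.pow_ne_top hG.2.ne) hD
  refine ⟨v, ⟨hvT, hMG, fun ψ => (hvsum ψ).unique ?_⟩, ?_⟩
  -- Both sides of the Fourier identity are sums of the same series of pairings over the annuli.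
  · have h1 := hasSum_integral_iUnion (f := fun ζ => M ζ * G ζ * ψ ζ) hEm (disjoint_annulus ha hlam)
      (hMG.integrable_mul ψ).integrableOn
    rw [setIntegral_congr_set (iUnion_annulus_ae_eq ha hlam), setIntegral_univ] at h1
    refine h1.congr_fun fun k => ?_
    rw [(huFT k).2.2 ψ, ← integral_indicator (hEm k)]
    refine integral_congr_ae (.of_forall fun ζ => ?_)
    by_cases hζ : ζ ∈ E k <;> simp [hU, hζ]
  · rw [hb] at hvn
    have e : (D : ℝ≥0∞) * eLpNorm G 2 volume ^ 2 = ((NNReal.sqrt D : ℝ≥0) * eLpNorm G 2 volume) ^ 2 := by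
      rw [mul_pow, ← ENNReal.coe_pow, NNReal.sq_sqrt]
    rw [e] at hvn
    exact (ENNReal.pow_le_pow_left_iff two_ne_zero).1 hvn

end Homogeneous

/-! ### Comparison of the two multipliers -/

section Comparison
variable {d : ℕ} {q r κ βp βm : ℝ}

/-- A homogeneous function, smooth away from the light cone. -/
def radialFactor (d : ℕ) (β γ : ℝ) (ζ : Space d × ℝ) : ℝ :=
  posPow ‖ζ.1‖ γ * (‖ζ.1‖ + |ζ.2|) ^ β

/-- The homogeneous multiplier with the singularity of order `α` at the light cone. -/
def coneProfile (d : ℕ) (β γ α : ℝ) (ζ : Space d × ℝ) : ℂ :=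
  ((posPow (1 - ζ.2 ^ 2 / ‖ζ.1‖ ^ 2) α * radialFactor d β γ ζ : ℝ) : ℂ)

lemma measurable_radialFactor (d : ℕ) (β γ : ℝ) : Measurable (radialFactor d β γ) := by
  have := measurable_posPow γ
  unfold radialFactor
  fun_prop

lemma measurable_coneProfile (d : ℕ) (β γ α : ℝ) : Measurable (coneProfile d β γ α) := by
  have := measurable_posPow α
  have := measurable_radialFactor d β γ
  unfold coneProfile
  fun_prop

lemma posPow_mul {δ : ℝ} (hδ : 0 < δ) (x a : ℝ) : posPow (δ * x) a = δ ^ a * posPow x a := by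
  rcases lt_or_ge 0 x with hx | hx
  · rw [posPow_of_pos (by positivity), posPow_of_pos hx, Real.mul_rpow hδ.le hx.le]
  · rw [posPow_of_nonpos (mul_nonpos_of_nonneg_of_nonpos hδ.le hx), posPow_of_nonpos hx, mul_zero]

lemma coneProfile_smul (β γ α : ℝ) {δ : ℝ} (hδ : 0 < δ) (ζ : Space d × ℝ) :
    coneProfile d β γ α (δ • ζ) = ((δ ^ (β + γ) : ℝ) : ℂ) * coneProfile d β γ α ζ := by
  simp only [coneProfile, radialFactor, Prod.smul_fst, Prod.smul_snd, norm_smul, smul_eq_mul,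
    Real.norm_of_nonneg hδ.le, abs_mul, abs_of_pos hδ]
  rw [mul_pow, mul_pow, mul_div_mul_left _ _ (by positivity), posPow_mul hδ, ← mul_add,
    Real.mul_rpow hδ.le (by positivity), Real.rpow_add hδ]
  push_cast
  ring

lemma abs_lt_norm_of_pos {ζ : Space d × ℝ} (hζ : 0 < ‖ζ.1‖) (h : 0 < 1 - ζ.2 ^ 2 / ‖ζ.1‖ ^ 2) :
    |ζ.2| < ‖ζ.1‖ := by
  rw [sub_pos, div_lt_one (by positivity)] at h
  exact abs_lt_of_sq_lt_sq h hζ.le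

lemma abs_le_norm_of_coneProfile_ne_zero {β γ α : ℝ} {ζ : Space d × ℝ}
    (h : coneProfile d β γ α ζ ≠ 0) : |ζ.2| ≤ ‖ζ.1‖ := by
  have hζ : 0 < ‖ζ.1‖ := by
    by_contra hcon
    exact h (by simp [coneProfile, radialFactor, posPow_of_nonpos (not_lt.1 hcon)])
  refine (abs_lt_norm_of_pos hζ ?_).le
  by_contra hcon
  exact h (by simp [coneProfile, posPow_of_nonpos (not_lt.1 hcon)])

/-- Inside the cone `|ξ| - |τ| = |ξ|² (1 - τ²/|ξ|²) / (|ξ| + |τ|)`, and outside both sides vanish.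
The power `βm` of this produces the exponents `βp - βm` and `2 βm`; the square root of the weight
adds `-1/2` to the power of `|ξ|` and `κ/2 + (d-1)/4` to the power of `1 - τ²/|ξ|²`. -/
lemma hyperbolicMultiplier_mul_sqrtWeight (ζ : Space d × ℝ) :
    hyperbolicMultiplier d βp βm ζ * sqrtWeight d κ ζ
      = coneProfile d (βp - βm) (2 * βm - 1 / 2) (βm + κ / 2 + ((d : ℝ) - 1) / 4) ζ := by
  rw [hyperbolicMultiplier, sqrtWeight, coneProfile, ← Complex.ofReal_mul]
  congr 1
  simp only [coneWeight, radialFactor]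
  obtain ⟨ξ, τ⟩ := ζ
  simp only
  rcases (norm_nonneg ξ).eq_or_lt with hx | hx
  · simp [← hx, posPow_of_nonpos]
  set x := ‖ξ‖
  set t := |τ|
  rcases le_or_gt (1 - τ ^ 2 / x ^ 2) 0 with hX | hX
  · simp [posPow_of_nonpos hX]
  have ht0 : 0 ≤ t := abs_nonneg τ
  have htx : t < x := abs_lt_norm_of_pos (ζ := (ξ, τ)) hx hX
  have hfac : |x - t| = (x + t)⁻¹ * x ^ (2 : ℝ) * (1 - τ ^ 2 / x ^ 2) := by
    rw [abs_of_pos (sub_pos.2 htx), Real.rpow_two, ← sq_abs τ]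
    have : x + t ≠ 0 := by positivity
    field_simp
    ring
  set X := 1 - τ ^ 2 / x ^ 2
  have hxt : 0 < x + t := by positivity
  rw [posPow_of_pos hX, posPow_of_pos hX, posPow_of_pos hx, hfac,
    Real.mul_rpow (by positivity) hX.le, Real.mul_rpow (by positivity) (by positivity),
    Real.inv_rpow hxt.le, ← Real.rpow_mul hx.le, Real.sqrt_eq_rpow,
    Real.mul_rpow (by positivity) (by positivity), ← Real.rpow_mul hX.le, Real.inv_rpow hx.le,
    Real.rpow_sub hxt, Real.rpow_sub hx,
    show βm + κ / 2 + ((d : ℝ) - 1) / 4 = βm + (κ + (d - 1) / 2) * (1 / 2) by ring,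
    Real.rpow_add hX]
  have h1 := (Real.rpow_pos_of_pos hxt βm).ne'
  have h2 := (Real.rpow_pos_of_pos hx (1 / 2)).ne'
  field_simp

lemma rpow_le_four_rpow {x : ℝ} (h1 : 1 / 4 ≤ x) (h2 : x ≤ 4) (a : ℝ) : x ^ a ≤ 4 ^ |a| := by
  have hx : 0 < x := by linarith
  rcases le_total 1 x with h | h
  · calc x ^ a ≤ x ^ |a| := Real.rpow_le_rpow_of_exponent_le h (le_abs_self a)
      _ ≤ 4 ^ |a| := Real.rpow_le_rpow hx.le h2 (abs_nonneg a)
  · calc x ^ a ≤ x ^ (-|a|) := Real.rpow_le_rpow_of_exponent_ge hx h (neg_abs_le a)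
      _ = x⁻¹ ^ |a| := by rw [Real.rpow_neg hx.le, Real.inv_rpow hx.le]
      _ ≤ 4 ^ |a| := Real.rpow_le_rpow (by positivity)
        (by rw [inv_le_comm₀ hx (by norm_num)]; linarith) (abs_nonneg a)

lemma inv_four_rpow_le_rpow {x : ℝ} (h1 : 1 / 4 ≤ x) (h2 : x ≤ 4) (a : ℝ) :
    (4 ^ |a|)⁻¹ ≤ x ^ a := by
  have hx : 0 < x := by linarith
  have h := rpow_le_four_rpow h1 h2 (-a)
  rw [abs_neg, Real.rpow_neg hx.le] at h
  exact inv_le_of_inv_le₀ (by positivity) h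

/-- Here `|ξ|` and `|ξ| + |τ|` both lie in `[1/4, 4]`. -/
lemma radialFactor_bounds (β γ : ℝ) {ζ : Space d × ℝ} (h1 : ‖ζ.1‖ ∈ Set.Icc (1 / 2) 2)
    (h2 : |ζ.2| ≤ ‖ζ.1‖) :
    (4 ^ |γ| * 4 ^ |β|)⁻¹ ≤ radialFactor d β γ ζ ∧ radialFactor d β γ ζ ≤ 4 ^ |γ| * 4 ^ |β| := by
  obtain ⟨h3, h4⟩ := h1
  have hx : 0 < ‖ζ.1‖ := by linarith
  have h0 := abs_nonneg ζ.2
  rw [radialFactor, posPow_of_pos hx, mul_inv]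
  constructor
  · gcongr
    · exact inv_four_rpow_le_rpow (by linarith) (by linarith) γ
    · exact inv_four_rpow_le_rpow (by linarith) (by linarith) β
  · gcongr
    · exact rpow_le_four_rpow (by linarith) (by linarith) γ
    · exact rpow_le_four_rpow (by linarith) (by linarith) β

lemma measurableSet_abs_le_norm : MeasurableSet {ζ : Space d × ℝ | |ζ.2| ≤ ‖ζ.1‖} := by
  have h1 : Measurable fun ζ : Space d × ℝ => |ζ.2| := by fun_prop
  have h2 : Measurable fun ζ : Space d × ℝ => ‖ζ.1‖ := by fun_prop
  exact measurableSet_le h1 h2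

/-- The localised cone multiplier is dominated by the homogeneous one. -/
lemma isL2Bounded_coneMultiplier_of_coneProfile {β γ α : ℝ} {φ : ℝ → ℂ} (hφ : Continuous φ)
    (hφs : tsupport φ ⊆ Set.Icc (1 / 2) 2) (h : IsL2Bounded q r (coneProfile d β γ α)) :
    IsL2Bounded q r (coneMultiplier d φ α) := by
  have hcs : HasCompactSupport φ := isCompact_Icc.of_isClosed_subset (isClosed_tsupport φ) hφs
  obtain ⟨B, hB⟩ := hcs.exists_bound_of_continuous hφ
  have hφ0 : ∀ x, φ x ≠ 0 → x ∈ Set.Icc (1 / 2 : ℝ) 2 := fun x hx => hφs (subset_tsupport φ hx)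
  have hB0 : 0 ≤ B := (norm_nonneg _).trans (hB 0)
  -- The quotient by the radial factor need not be bounded for large `|τ|`; cutting off to the solid
  -- cone costs nothing, since the profile vanishes outside it.
  set b : Space d × ℝ → ℂ := {ζ : Space d × ℝ | |ζ.2| ≤ ‖ζ.1‖}.indicator fun ζ =>
    φ ‖ζ.1‖ * (((radialFactor d β γ ζ)⁻¹ : ℝ) : ℂ) with hb
  have hbm : Measurable b := by
    have h1 := measurable_radialFactor d β γ
    have h2 := hφ.measurable
    exact Measurable.indicator (by fun_prop) measurableSet_abs_le_norm
  have hbB : ∀ ζ, ‖b ζ‖ ≤ ((B * (4 ^ |γ| * 4 ^ |β|)).toNNReal : ℝ) := fun ζ => by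
    rw [Real.coe_toNNReal _ (by positivity)]
    by_cases hζ : |ζ.2| ≤ ‖ζ.1‖
    · rw [hb, Set.indicator_of_mem (show ζ ∈ {ζ : Space d × ℝ | |ζ.2| ≤ ‖ζ.1‖} from hζ), norm_mul]
      by_cases h0 : φ ‖ζ.1‖ = 0
      · rw [h0, norm_zero, zero_mul]; positivity
      have h1 := (radialFactor_bounds β γ (hφ0 _ h0) hζ).1
      have h2 : 0 < radialFactor d β γ ζ := lt_of_lt_of_le (by positivity) h1
      rw [Complex.norm_real, Real.norm_of_nonneg (inv_nonneg.2 h2.le)]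
      gcongr
      · exact hB _
      · exact inv_le_of_inv_le₀ (by positivity) h1
    · rw [hb, Set.indicator_of_notMem (show ζ ∉ {ζ : Space d × ℝ | |ζ.2| ≤ ‖ζ.1‖} from hζ), norm_zero]
      positivity
  refine (h.mul_bounded hbm hbB).congr_ae (.of_forall fun ζ => ?_)
  simp only [coneProfile, coneMultiplier]
  by_cases h0 : φ ‖ζ.1‖ = 0
  · have : b ζ = 0 := by
      rw [hb]
      by_cases hζ : |ζ.2| ≤ ‖ζ.1‖ <;> simp [Set.indicator, h0]
    rw [this, h0]
    simp
  rcases le_or_gt (1 - ζ.2 ^ 2 / ‖ζ.1‖ ^ 2) 0 with hX | hX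
  · simp [posPow_of_nonpos hX]
  have hx : 0 < ‖ζ.1‖ := by linarith [(hφ0 _ h0).1]
  have hlt := (abs_lt_norm_of_pos hx hX).le
  have h2 : radialFactor d β γ ζ ≠ 0 :=
    (lt_of_lt_of_le (by positivity) (radialFactor_bounds β γ (hφ0 _ h0) hlt).1).ne'
  have h2' : (radialFactor d β γ ζ : ℂ) ≠ 0 := by exact_mod_cast h2
  rw [hb, Set.indicator_of_mem (show ζ ∈ {ζ : Space d × ℝ | |ζ.2| ≤ ‖ζ.1‖} from hlt)]
  push_cast
  field_simp

/-- The homogeneous multiplier on an annulus is dominated by the localised cone multiplier. -/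
lemma exists_isL2Bounded_annulus {β γ α : ℝ} {φ : ℝ → ℂ} (hφ : Continuous φ)
    (hφs : tsupport φ ⊆ Set.Icc (1 / 2) 2) (hφ_ne : φ ≠ 0)
    (h : IsL2Bounded q r (coneMultiplier d φ α)) :
    ∃ a lam : ℝ, 0 < a ∧ 1 < lam ∧
      IsL2Bounded q r ((annulus d a (a * lam)).indicator (coneProfile d β γ α)) := by
  have hφ0 : ∀ x, φ x ≠ 0 → x ∈ Set.Icc (1 / 2 : ℝ) 2 := fun x hx => hφs (subset_tsupport φ hx)
  obtain ⟨x0, hx0⟩ := Function.ne_iff.1 hφ_ne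
  rw [Pi.zero_apply] at hx0
  have hx0p : 0 < x0 := by linarith [(hφ0 x0 hx0).1]
  have hc0 : 0 < ‖φ x0‖ / 2 := by have := norm_pos_iff.2 hx0; positivity
  -- By continuity `|φ|` exceeds `|φ(x0)| / 2` on `[x0, x0 + ε)`; the ratio `1 + ε / x0` makes this
  -- interval the range of `|ξ|` in the annulus, where `φ` can be divided out.
  obtain ⟨ε, hε, hball⟩ := Metric.eventually_nhds_iff.1
    (hφ.norm.continuousAt.eventually (lt_mem_nhds (half_lt_self (norm_pos_iff.2 hx0))))
  have hlow : ∀ x, x0 ≤ x → x < x0 + ε → ‖φ x0‖ / 2 < ‖φ x‖ := fun x h1 h2 =>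
    hball (by rw [Real.dist_eq, abs_of_nonneg (by linarith)]; linarith)
  refine ⟨x0, 1 + ε / x0, hx0p, by linarith [div_pos hε hx0p], ?_⟩
  have hend : x0 * (1 + ε / x0) = x0 + ε := by field_simp
  rw [hend]
  have hlow' : ∀ ζ ∈ annulus d x0 (x0 + ε), ‖φ x0‖ / 2 < ‖φ ‖ζ.1‖‖ := fun ζ hζ =>
    hlow _ hζ.1 hζ.2
  have hne : ∀ ζ ∈ annulus d x0 (x0 + ε), φ ‖ζ.1‖ ≠ 0 := fun ζ hζ =>
    norm_pos_iff.1 (hc0.trans (hlow' ζ hζ))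
  set S : Set (Space d × ℝ) := annulus d x0 (x0 + ε) ∩ {ζ | |ζ.2| ≤ ‖ζ.1‖} with hS
  have hSm : MeasurableSet S := (measurableSet_annulus _ _).inter measurableSet_abs_le_norm
  set b : Space d × ℝ → ℂ := S.indicator fun ζ =>
    ((radialFactor d β γ ζ : ℝ) : ℂ) * (φ ‖ζ.1‖)⁻¹ with hb
  have hbm : Measurable b := by
    have h1 := measurable_radialFactor d β γ
    have h2 := hφ.measurable
    exact Measurable.indicator (by fun_prop) hSm
  have hbB : ∀ ζ, ‖b ζ‖ ≤ (((4 ^ |γ| * 4 ^ |β|) * (‖φ x0‖ / 2)⁻¹).toNNReal : ℝ) := fun ζ => by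
    rw [Real.coe_toNNReal _ (by positivity)]
    by_cases hζ : ζ ∈ S
    · have h1 := radialFactor_bounds β γ (hφ0 _ (hne ζ hζ.1)) hζ.2
      have h2 : 0 < radialFactor d β γ ζ := lt_of_lt_of_le (by positivity) h1.1
      rw [hb, Set.indicator_of_mem hζ, norm_mul, Complex.norm_real, Real.norm_of_nonneg h2.le, norm_inv]
      gcongr
      · exact h1.2
      · exact (hlow' ζ hζ.1).le
    · rw [hb, Set.indicator_of_notMem hζ, norm_zero]
      positivity
  refine (h.mul_bounded hbm hbB).congr_ae (.of_forall fun ζ => ?_)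
  simp only [coneMultiplier]
  by_cases hζ : ζ ∈ annulus d x0 (x0 + ε)
  · rw [Set.indicator_of_mem hζ, coneProfile]
    rcases le_or_gt (1 - ζ.2 ^ 2 / ‖ζ.1‖ ^ 2) 0 with hX | hX
    · simp [posPow_of_nonpos hX]
    have hlt := (abs_lt_norm_of_pos (hx0p.trans_le hζ.1) hX).le
    rw [hb, Set.indicator_of_mem (show ζ ∈ S from ⟨hζ, hlt⟩)]
    have := hne ζ hζ
    push_cast
    field_simp
  · rw [Set.indicator_of_notMem hζ, hb, Set.indicator_of_notMem fun h => hζ h.1, mul_zero]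

end Comparison

end KineticTransport

end

/-! ### The equivalence -/

theorem theorem4p3 (d : ℕ) (hd : 2 ≤ d) (q r κ βp βm : ℝ) (hq : 2 ≤ q) (hr : 2 ≤ r)
    (hκ : -1 ≤ κ) (hκ' : κ ≤ 0)
    (hscaling : βp + βm = (d : ℝ) / r + 1 / q - (d : ℝ) / 2)
    (φ : ℝ → ℂ) (hφ : ContDiff ℝ ((⊤ : ℕ∞) : WithTop ℕ∞) φ)
    (hφ_supp : tsupport φ ⊆ Set.Icc (1 / 2) 2) (hφ_ne : φ ≠ 0) :
    KineticTransport.SmoothingEstimate d q r κ βp βm ↔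
      KineticTransport.IsBoundedMultiplier q r
        (KineticTransport.coneMultiplier d φ (βm + κ / 2 + ((d : ℝ) - 1) / 4)) := by
  have : NeZero d := ⟨by omega⟩
  rw [KineticTransport.smoothingEstimate_iff hd hκ hκ', KineticTransport.isBoundedMultiplier_iff]
  simp only [KineticTransport.hyperbolicMultiplier_mul_sqrtWeight]
  refine ⟨KineticTransport.isL2Bounded_coneMultiplier_of_coneProfile hφ.continuous hφ_supp,
    fun h => ?_⟩
  obtain ⟨a, lam, ha, hlam, hloc⟩ := KineticTransport.exists_isL2Bounded_annulus
    (β := βp - βm) (γ := 2 * βm - 1 / 2) hφ.continuous hφ_supp hφ_ne h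
  -- The degree of homogeneity `(βp - βm) + (2 βm - 1/2) = βp + βm - 1/2` equals `d/r + 1/q -
  -- (d+1)/2` precisely by the scaling relation.
  exact KineticTransport.isL2Bounded_of_annulus hq hr
    (KineticTransport.measurable_coneProfile d _ _ _) (by linarith)
    (fun δ hδ ζ => KineticTransport.coneProfile_smul _ _ _ hδ ζ)
    (fun ζ hζ => KineticTransport.abs_le_norm_of_coneProfile_ne_zero hζ) ha hlam hloc
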